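/- **Setting.** Let $A$ be a sectorial operator on a complex Banach space $X$: $A$ is closed and there is $\theta\in[0,\pi)$ such that $\sigma(A)\subseteq\{z: z=0\text{ or }|\arg z|\le\theta\}$ and $\lambda\mapsto\lambda R(\lambda,A)$ is bounded outside every larger sector. Let $\omega_{\rm se}(A)$ be the smallest such $\theta$, let $\omega\in(\omega_{\rm se}(A),\pi)$ and $S_\omega=\{z\ne0:|\arg z|<\omega\}$. ($A$ need be neither injective nor densely defined.) *Algebraic extension.* Let $E$ be a subset of a commutative unital algebra $G$ and $\Phi:E\to\mathcal L(X)$. Put $[f]_E=\{e\in E: ef\in E\}$, and call a nonempty $M\subseteq E$ an anchor set if $\bigcap_{e\in M}\ker\Phi(e)=\{0\}$. The algebraic extension of $\Phi$ in $G$ has domain $\{f\in G: [ef]_E \text{ is an anchor set for all } e\in E\}$, and $\Phi(f)x=y$ means $\Phi(ef)x=\Phi(e)y$ for all $e\in[f]_E$. *Sectorial calculus.* Let $\mathcal E(S_\omega)$ be the set of bounded holomorphic $f$ on $S_\omega$ with $\int_{\partial S_\delta}|f(z)|\,|dz|/|z|<\infty$ for all $0\le\delta<\omega$. For $f\in\mathcal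 E(S_\omega)$ and $c,d\in\mathbb C$ put $\Phi_A\bigl(f+c+\tfrac{d}{1+z}\bigr)=\frac1{2\pi i}\int_{\partial S_\delta}f(z)R(z,A)\,dz+c+d(1+A)^{-1}$, where $\omega_{\rm se}(A)<\delta<\omega$. The sectorial calculus $\Phi_A$ on $S_\omega$ is the algebraic extension of this map in the algebra of meromorphic functions on $S_\omega$. *Uniform extension.* Let $H^\infty(S_\omega\cup\{0\})$ be the set of bounded holomorphic $f$ on $S_\omega$ for which $f(0):=\lim_{t\searrow0}f(t)$ exists. For $f\in H^\infty(S_\omega\cup\{0\})$ and $T\in\mathcal L(X)$ write $\Phi_A^{\rm uni}(f)=T$ if there are $f_n\in H^\infty(S_\omega\cup\{0\})$ in the domain of $\Phi_A$ with $\Phi_A(f_n)\in\mathcal L(X)$, $f_n\to f$ uniformly on $S_\omega\cup\{0\}$ and $\Phi_A(f_n)\to T$ in operator norm. The algebraic extension of $\Phi_A^{\rm uni}$ in the meromorphic functions on $S_\omega$ is again denoted by $\Phi_A^{\rm uni}$. **Proposition.** For every sectorial $A$ and every $\omega\in(\omega_{\rm se}(A),\pi)$ the following hold. 1. Let $m\in\mathbb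 N_0$, let $\mu$ be a complex Borel measure on $[0,\infty)$ and $f(z)=\int_{[0,\infty)}(1+sz)^{-m}\,\mu(ds)$. Then $f$ is in the domain of $\Phi_A^{\rm uni}$, both before and after the algebraic extension, the function $s\mapsto(1+sA)^{-m}$ (with value $I$ at $s=0$) is Bochner integrable with respect to $|\mu|$, and $$\Phi_A^{\rm uni}(f)=\int_{[0,\infty)}(1+sA)^{-m}\,\mu(ds);$$ this operator is the only value that the definition of $\Phi_A^{\rm uni}(f)$ admits. 2. The extended Stieltjes calculus, that is, the algebraic extension in the meromorphic functions on $S_\pi$ of the map $\int(1+sz)^{-m}\mu(ds)\mapsto\int(1+sA)^{-m}\mu(ds)$ ($m\in\mathbb N_0$, $\mu$ a complex Borel measure on $[0,\infty)$), is contained in the uniform extension: if $f$ is in its domain, then $f|_{S_\omega}$ is in the domain of $\Phi_A^{\rm uni}$ and the two calculi assign to $f$ the same operator, with the same domain. 3. The Hirsch calculus is contained in the uniform extension: if $a\in\mathbb C$, $\nu$ is a complex Radon measure on $[0,\infty)$ with $\int\frac{|\nu|(dt)}{1+t}<\infty$ and $f(z)=a+\int_{[0,\infty)}\frac{z}{1+zt}\,\nu(dt)$,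 then $f$ is in the domain of $\Phi_A^{\rm uni}$, the two operator integrals below converge absolutely, and $$\Phi_A^{\rm uni}(f)=a+A\int_{[0,1]}(1+tA)^{-1}\,\nu(dt)+\int_{(1,\infty)}A(1+tA)^{-1}\,\nu(dt),$$ with equality of domains. -/

import Mathlib

open MeasureTheory Filter Topology Set
open scoped NNReal

namespace SectCalc

/-! ### Sectors, meromorphic functions on a sector -/

/-- The open sector `{z ≠ 0 : |arg z| < ω}`. -/
def sector (ω : ℝ) : Set ℂ := {z | z ≠ 0 ∧ |z.arg| < ω}

/-- The closed sector `{z : z = 0 or |arg z| ≤ ω}` (for `ω ≥ 0`; recall that `arg 0 = 0` in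
Mathlib). For `ω = 0` it is the half-line `[0, ∞)`. -/
def closedSector (ω : ℝ) : Set ℂ := {z | |z.arg| ≤ ω}

/-- The commutative unital algebra of complex functions on the sector modulo equality off a
relatively closed discrete subset of the sector. Meromorphic functions, with arbitrary values at
their poles, are identified by this relation exactly as they are in complex analysis. -/
abbrev SGerm (ω : ℝ) : Type := (codiscreteWithin (sector ω)).Germ ℂ

/-- The class of a function in `SGerm ω`, that is, its restriction to the sector. -/
noncomputable def germ (ω : ℝ) (f : ℂ → ℂ) : SGerm ω := (f : (codiscreteWithin (sector ω)).Germ ℂ)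

/-- The algebra of meromorphic functions on the sector. -/
def mer (ω : ℝ) : Set (SGerm ω) := {F | ∃ f : ℂ → ℂ, MeromorphicOn f (sector ω) ∧ F = germ ω f}

/-- Bounded holomorphic functions on the sector. -/
def Hinf (ω : ℝ) : Set (ℂ → ℂ) :=
  {f | DifferentiableOn ℂ f (sector ω) ∧ ∃ C : ℝ, ∀ z ∈ sector ω, ‖f z‖ ≤ C}

/-- Bounded holomorphic functions on the sector which have a limit as `z ↘ 0` along the positive
half-line; the value at `0` is this limit. -/
def HinfZero (ω : ℝ) : Set (ℂ → ℂ) :=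
  {f | f ∈ Hinf ω ∧ Tendsto (fun t : ℝ => f (t : ℂ)) (𝓝[>] 0) (𝓝 (f 0))}

/-- Elementary functions: bounded holomorphic functions on the sector which are absolutely
integrable with respect to `|dz| / |z|` along the boundary of each smaller sector. -/
def elemFun (ω : ℝ) : Set (ℂ → ℂ) :=
  {f | f ∈ Hinf ω ∧ ∀ δ : ℝ, |δ| < ω →
    IntegrableOn (fun r : ℝ => ‖f ((r : ℂ) * Complex.exp (δ * Complex.I))‖ / r) (Ioi 0)}

/-! ### Algebraic extension

A representation `Φ : E → L(X)` of a subset (subalgebra) `E` of a commutative algebra `F` is given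
by its graph, the set `Γ` of all pairs `(e, Φ(e))`. -/

section Algebraic

variable {F : Type*} [CommRing F] {X : Type*} [NormedAddCommGroup X] [NormedSpace ℂ X]

/-- The domain `E` of the representation with graph `Γ`. -/
def dom (Γ : Set (F × (X →L[ℂ] X))) : Set F := {e | ∃ T, (e, T) ∈ Γ}

/-- `[f]_E = {e ∈ E : e f ∈ E}`. -/
def regs (Γ : Set (F × (X →L[ℂ] X))) (f : F) : Set F := {e | e ∈ dom Γ ∧ e * f ∈ dom Γ}

/-- `M ⊆ E` is an anchor set if it is nonempty and the kernels of `Φ(e)`, `e ∈ M`, have trivial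
intersection. -/
def IsAnchorSet (Γ : Set (F × (X →L[ℂ] X))) (M : Set F) : Prop :=
  M.Nonempty ∧ ∀ x : X, (∀ e ∈ M, ∀ T, (e, T) ∈ Γ → T x = 0) → x = 0

/-- The maximal anchored subalgebra `{f ∈ G : [e f]_E is an anchor set for every e ∈ E}` of the
surrounding algebra `G`. It is the domain of the canonical algebraic extension within `G`. -/
def anchored (Γ : Set (F × (X →L[ℂ] X))) (G : Set F) : Set F :=
  {f | f ∈ G ∧ ∀ e ∈ dom Γ, IsAnchorSet Γ (regs Γ (e * f))}

/-- The graph of the (possibly unbounded) operator that the canonical algebraic extension assigns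
to `f`: `Φ(f) x = y` if and only if `Φ(e f) x = Φ(e) y` for all `e ∈ [f]_E`. -/
def algExt (Γ : Set (F × (X →L[ℂ] X))) (f : F) : Set (X × X) :=
  {p | ∀ e T S, (e, T) ∈ Γ → (e * f, S) ∈ Γ → S p.1 = T p.2}

end Algebraic

/-! ### Sectorial operators -/

section Operators

variable {X : Type*} [NormedAddCommGroup X] [NormedSpace ℂ X]

/-- `R` is the bounded everywhere defined inverse of the operator `a + b A` with domain that
of `A`. -/
def IsInverse (A : X →ₗ.[ℂ] X) (a b : ℂ) (R : X →L[ℂ] X) : Prop :=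
  (∀ x : X, ∃ h : R x ∈ A.domain, a • R x + b • A ⟨R x, h⟩ = x) ∧
    ∀ x : A.domain, R (a • (x : X) + b • A x) = x

open Classical in
/-- The bounded inverse `(a + b A)⁻¹` (which is unique if it exists; the value is `0` if it does
not exist). -/
noncomputable def inverse (A : X →ₗ.[ℂ] X) (a b : ℂ) : X →L[ℂ] X :=
  if h : ∃ R, IsInverse A a b R then h.choose else 0

/-- The resolvent `R(z, A) = (z - A)⁻¹`. -/
noncomputable def resolv (A : X →ₗ.[ℂ] X) (z : ℂ) : X →L[ℂ] X := inverse A z (-1)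

/-- The spectrum of `A`. -/
def spec (A : X →ₗ.[ℂ] X) : Set ℂ := {z | ¬ ∃ R, IsInverse A z (-1) R}

/-- The conditions on the angle `θ ∈ [0, π)` in the definition of a sectorial operator. -/
def SectorialOfAngle (A : X →ₗ.[ℂ] X) (θ : ℝ) : Prop :=
  0 ≤ θ ∧ θ < Real.pi ∧ spec A ⊆ closedSector θ ∧
    ∀ θ', θ < θ' → θ' < Real.pi → ∃ C : ℝ, ∀ z ∉ closedSector θ', ‖z • resolv A z‖ ≤ C

/-- Sectorial operators; neither injectivity nor a dense domain is required. -/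
def IsSectorial (A : X →ₗ.[ℂ] X) : Prop := A.IsClosed ∧ ∃ θ, SectorialOfAngle A θ

/-- The sectoriality angle: the minimal admissible angle. -/
noncomputable def sectAngle (A : X →ₗ.[ℂ] X) : ℝ := sInf {θ | SectorialOfAngle A θ}

/-- `(1 + s A)⁻¹` for `s ≥ 0`; for `s = 0` this is the identity operator on `X`, also when the
domain of `A` is not all of `X`. -/
noncomputable def stieltjesRes (A : X →ₗ.[ℂ] X) (s : ℝ≥0) : X →L[ℂ] X :=
  if s = 0 then 1 else inverse A 1 ((s : ℝ) : ℂ)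

/-! ### The sectorial calculus and its uniform extension -/

/-- The Cauchy integral `(2πi)⁻¹ ∫ f(z) R(z, A) dz` along the positively oriented boundary of the
sector of angle `δ` (from infinity to `0` on the upper ray, then to infinity on the lower ray). -/
noncomputable def cauchyInt (A : X →ₗ.[ℂ] X) (δ : ℝ) (f : ℂ → ℂ) : X →L[ℂ] X :=
  (2 * Real.pi * Complex.I : ℂ)⁻¹ •
    ((∫ r in Ioi (0 : ℝ), (f (r * Complex.exp (-δ * Complex.I)) * Complex.exp (-δ * Complex.I)) •
        resolv A (r * Complex.exp (-δ * Complex.I))) -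
      ∫ r in Ioi (0 : ℝ), (f (r * Complex.exp (δ * Complex.I)) * Complex.exp (δ * Complex.I)) •
        resolv A (r * Complex.exp (δ * Complex.I)))

/-- The graph of the elementary calculus: `f + c + d (1 + z)⁻¹` with `f` an elementary function is
sent to `(2πi)⁻¹ ∫ f(z) R(z, A) dz + c + d (1 + A)⁻¹`. The integral does not depend on the angle
`δ` of the contour, `sectAngle A < δ < ω`. -/
def elemGraph (A : X →ₗ.[ℂ] X) (ω : ℝ) : Set (SGerm ω × (X →L[ℂ] X)) :=
  {p | ∃ f ∈ elemFun ω, ∃ c d : ℂ, ∃ δ : ℝ, sectAngle A < δ ∧ δ < ω ∧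
    p.1 = germ ω (fun z => f z + c + d * (1 + z)⁻¹) ∧
    p.2 = cauchyInt A δ f + c • 1 + d • inverse A 1 1}

/-- The domain of the sectorial calculus on the sector of angle `ω`. -/
def sectDom (A : X →ₗ.[ℂ] X) (ω : ℝ) : Set (SGerm ω) := anchored (elemGraph A ω) (mer ω)

/-- The graph of the operator that the sectorial calculus assigns to a function. -/
def sectCalc (A : X →ₗ.[ℂ] X) (ω : ℝ) (F : SGerm ω) : Set (X × X) := algExt (elemGraph A ω) F

/-- `(f, T)` with `f` a bounded holomorphic function with a limit at `0`, such that `f` is in the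
domain of the sectorial calculus and is sent to the bounded operator `T`. -/
def IsSectBounded (A : X →ₗ.[ℂ] X) (ω : ℝ) (f : ℂ → ℂ) (T : X →L[ℂ] X) : Prop :=
  f ∈ HinfZero ω ∧ germ ω f ∈ sectDom A ω ∧ sectCalc A ω (germ ω f) = {p | p.2 = T p.1}

/-- The graph of the uniform (topological) extension of the sectorial calculus: the pairs `(f, T)`
with `f` bounded holomorphic with a limit at `0` for which there are `f_n` as in `IsSectBounded`
with `f_n → f` uniformly on the sector together with `0` and `Φ(f_n) → T` in operator norm. -/
def uniGraph (A : X →ₗ.[ℂ] X) (ω : ℝ) : Set (SGerm ω × (X →L[ℂ] X)) :=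
  {p | ∃ f ∈ HinfZero ω, p.1 = germ ω f ∧ ∃ (e : ℕ → ℂ → ℂ) (T : ℕ → X →L[ℂ] X),
    (∀ n, IsSectBounded A ω (e n) (T n)) ∧
    TendstoUniformlyOn e f atTop (insert 0 (sector ω)) ∧ Tendsto T atTop (𝓝 p.2)}

/-- The domain of the canonical algebraic extension of the uniform extension. -/
def uniDom (A : X →ₗ.[ℂ] X) (ω : ℝ) : Set (SGerm ω) := anchored (uniGraph A ω) (mer ω)

/-- The graph of the operator that the uniform extension, after its canonical algebraic extension
within the meromorphic functions, assigns to a function. -/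
def uniCalc (A : X →ₗ.[ℂ] X) (ω : ℝ) (F : SGerm ω) : Set (X × X) := algExt (uniGraph A ω) F

/-! ### The Stieltjes calculus and the Hirsch calculus -/

/-- The integral of a function on `[0, ∞)`, with values in a complex Banach space, with respect to
a complex Borel measure. -/
noncomputable def cintegral {E : Type*} [NormedAddCommGroup E] [NormedSpace ℂ E]
    (μ : ComplexMeasure ℝ≥0) (g : ℝ≥0 → E) : E :=
  VectorMeasure.integral μ g (ContinuousLinearMap.lsmul ℝ ℂ).flip

/-- The function `z ↦ ∫ (1 + s z)^(-m) μ(ds)`. -/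
noncomputable def stieltjesFun (m : ℕ) (μ : ComplexMeasure ℝ≥0) (z : ℂ) : ℂ :=
  cintegral μ (fun s => ((1 + ((s : ℝ) : ℂ) * z) ^ m)⁻¹)

/-- The operator `∫ (1 + s A)^(-m) μ(ds)`. -/
noncomputable def stieltjesOp (A : X →ₗ.[ℂ] X) (m : ℕ) (μ : ComplexMeasure ℝ≥0) : X →L[ℂ] X :=
  cintegral μ (fun s => stieltjesRes A s ^ m)

/-- The graph of the Stieltjes calculus on the bounded Stieltjes algebra, whose elements are
functions on the slit plane (the sector of angle `π`). -/
def stieltjesGraph (A : X →ₗ.[ℂ] X) : Set (SGerm Real.pi × (X →L[ℂ] X)) :=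
  {p | ∃ (m : ℕ) (μ : ComplexMeasure ℝ≥0),
    p.1 = germ Real.pi (stieltjesFun m μ) ∧ p.2 = stieltjesOp A m μ}

/-- The domain of the extended Stieltjes calculus: the canonical algebraic extension of the
Stieltjes calculus within the meromorphic functions on the slit plane. -/
def extStieltjesDom (A : X →ₗ.[ℂ] X) : Set (SGerm Real.pi) :=
  anchored (stieltjesGraph A) (mer Real.pi)

/-- The graph of the operator that the extended Stieltjes calculus assigns to a function. -/
def extStieltjesCalc (A : X →ₗ.[ℂ] X) (F : SGerm Real.pi) : Set (X × X) :=
  algExt (stieltjesGraph A) F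

/-- The function `z ↦ a + ∫ z / (1 + z t) ν(dt)`, where the complex Radon measure `ν` is given by
its polar decomposition `dν = h dρ`, with `ρ = |ν|` and `|h| = 1`. -/
noncomputable def hirschFun (a : ℂ) (ρ : Measure ℝ≥0) (h : ℝ≥0 → ℂ) (z : ℂ) : ℂ :=
  a + ∫ t, h t * (z / (1 + z * ((t : ℝ) : ℂ))) ∂ρ

/-- `∫_{[0,1]} (1 + t A)⁻¹ ν(dt)`. -/
noncomputable def hirschNear (A : X →ₗ.[ℂ] X) (ρ : Measure ℝ≥0) (h : ℝ≥0 → ℂ) : X →L[ℂ] X :=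
  ∫ t in Icc 0 1, h t • stieltjesRes A t ∂ρ

/-- `∫_{(1,∞)} A (1 + t A)⁻¹ ν(dt)`, where `A (1 + t A)⁻¹ = t⁻¹ (1 - (1 + t A)⁻¹)`. -/
noncomputable def hirschFar (A : X →ₗ.[ℂ] X) (ρ : Measure ℝ≥0) (h : ℝ≥0 → ℂ) : X →L[ℂ] X :=
  ∫ t in Ioi 1, h t • ((((t : ℝ) : ℂ)⁻¹) • (1 - stieltjesRes A t)) ∂ρ

/-- The graph of the operator
`a + A ∫_{[0,1]} (1 + t A)⁻¹ ν(dt) + ∫_{(1,∞)} A (1 + t A)⁻¹ ν(dt)` of the Hirsch calculus. -/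
def hirschCalc (A : X →ₗ.[ℂ] X) (a : ℂ) (ρ : Measure ℝ≥0) (h : ℝ≥0 → ℂ) : Set (X × X) :=
  {p | ∃ hx : hirschNear A ρ h p.1 ∈ A.domain,
    p.2 = a • p.1 + A ⟨hirschNear A ρ h p.1, hx⟩ + hirschFar A ρ h p.1}

end Operators

end SectCalc

/-!
The proof rests on one product rule and on one uniqueness statement. Write `r_s(z) = (1 + s z)⁻¹`
and `S_s = (1 + s A)⁻¹`.

*Product rule.* By the resolvent identity, multiplication of an elementary function by `r_s` is
multiplication of its Cauchy integral by `S_s` (`IsSectorial.stieltjesRes_mul_cauchyInt`): the scalar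
remainder integrates to zero by Cauchy's theorem. With the normalisation `z / (1 + z) ^ 2 ↦ S_1 - S_1 ^ 2`
(`IsSectorial.cauchyInt_bumpFun`) this gives `r_s ↦ S_s` in the elementary calculus, which is
therefore stable under multiplication by the pairs `(r_s, S_s)`
(`IsSectorial.elemGraph_mul_resFun`). Full multiplicativity of the elementary calculus is not needed.
A single regulariser, `(1 + z)⁻¹` if `A` has a nontrivial kernel and `z / (1 + z) ^ 2` otherwise,
describes the bounded elements of the sectorial calculus (`IsRegulariser.isSectBounded_iff`), so
these are stable under the same multiplications.

*Uniqueness.* If `d_n → 0` uniformly and `Φ(d_n) → D` in norm, then `D = 0`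
(`IsSectorial.eq_zero_of_tendsto`). Regularisation by `z / (1 + z) ^ 2` shows that `D` maps into the
kernel of `A`. There the calculus acts as multiplication by the value at `0`, and letting `N → ∞` in
`S_N` excludes a nonzero `D`. Hence the uniform extension is single valued
(`IsSectorial.uniGraph_unique`).

*Multipliers.* The pairs of a function and a commuting operator that act on the graph of the uniform
extension by multiplication contain the closed unital algebra generated by all `(r_s, S_s)`, in the
product of the bounded continuous functions and the bounded operators (`IsSectorial.mem_uniMul`). A
family of multipliers with trivial joint kernel which regularises `f` to multipliers puts `f` in the
domain of the algebraic extension and determines the operator (`IsSectorial.uniCalc_eq`).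

The three parts follow. The map `s ↦ (r_s, S_s)` is bounded and continuous off `0` by the resolvent
identity, so its powers are Bochner integrable with respect to finite measures and the integrals stay
in the closed algebra; evaluating the two components gives the bounded Stieltjes functions
(`IsSectorial.stieltjes_mem_uniMul`). The regularisers in the Stieltjes algebra are thus multipliers,
which transfers the extended Stieltjes calculus. For the Hirsch calculus the injective `S_1` serves as
the regulariser, because the function `r_1 f` and the bounded operator that extends `S_1 Φ(f)` are
combinations of integrals of the same pairs
(`IsSectorial.hirsch_mem_uniMul`).
-/

namespace SectCalc

/-! ### Shifting the line of integration in a strip -/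

section Strip

variable {E : Type*} [NormedAddCommGroup E] [NormedSpace ℂ E]

theorem norm_cexp_neg_mul_sq (ε x y : ℝ) :
    ‖Complex.exp (-ε * ((x : ℂ) + y * Complex.I) ^ 2)‖ = Real.exp (-ε * (x ^ 2 - y ^ 2)) := by
  rw [Complex.norm_exp]
  congr 1
  simp [pow_two]

theorem continuous_line {B : Type*} [TopologicalSpace B] {G : ℂ → B} {a : ℝ}
    (hd : ∀ x : ℝ, ContinuousAt G (x + a * Complex.I)) :
    Continuous (fun x : ℝ => G (x + a * Complex.I)) := by
  refine continuous_iff_continuousAt.2 fun x => ?_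
  exact ContinuousAt.comp (f := fun x : ℝ => (x : ℂ) + a * Complex.I) (hd x) (by fun_prop)

theorem integrable_gauss_line {G : ℂ → E} {ε a : ℝ} (hε : 0 ≤ ε)
    (ia : Integrable (fun x : ℝ => G (x + a * Complex.I))) :
    Integrable (fun x : ℝ => Complex.exp (-ε * ((x : ℂ) + a * Complex.I) ^ 2) •
      G (x + a * Complex.I)) := by
  refine Integrable.bdd_smul (C := Real.exp (ε * a ^ 2)) ia ?_ ?_
  · exact Continuous.aestronglyMeasurable (by fun_prop)
  · refine Eventually.of_forall fun x => ?_
    rw [norm_cexp_neg_mul_sq, Real.exp_le_exp]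
    nlinarith [mul_nonneg hε (sq_nonneg x)]

/-- Cauchy's theorem for a strip and an integrand with a Gaussian factor, which makes the integrals
over the vertical sides of rectangles tend to zero. -/
theorem integral_gauss_line_eq {G : ℂ → E} {a b C ε : ℝ} (hab : a ≤ b)
    (hε : 0 < ε) (hd : ∀ w : ℂ, w.im ∈ Icc a b → DifferentiableAt ℂ G w)
    (hb : ∀ w : ℂ, w.im ∈ Icc a b → 1 ≤ |w.re| → ‖G w‖ ≤ C)
    (ia : Integrable (fun x : ℝ => G (x + a * Complex.I)))
    (ib : Integrable (fun x : ℝ => G (x + b * Complex.I))) :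
    ∫ x : ℝ, Complex.exp (-ε * ((x : ℂ) + a * Complex.I) ^ 2) • G (x + a * Complex.I) =
      ∫ x : ℝ, Complex.exp (-ε * ((x : ℂ) + b * Complex.I) ^ 2) • G (x + b * Complex.I) := by
  set H : ℂ → E := fun w => Complex.exp (-ε * w ^ 2) • G w with hH
  have hvert : ∀ σ : ℝ, |σ| = 1 →
      Tendsto (fun R : ℝ => ∫ y : ℝ in a..b, H ((σ * R : ℝ) + y * Complex.I)) atTop (𝓝 0) := by
    intro σ hσ
    have hσ2 : σ ^ 2 = 1 := by rw [← sq_abs, hσ, one_pow]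
    have hlim : Tendsto (fun R : ℝ => Real.exp (-ε * (R ^ 2 - (|a| + |b|) ^ 2)) * C * |b - a|)
        atTop (𝓝 0) := by
      have h1 : Tendsto (fun R : ℝ => -ε * (R ^ 2 - (|a| + |b|) ^ 2)) atTop atBot := by
        refine Tendsto.const_mul_atTop_of_neg (by linarith) ?_
        exact tendsto_atTop_add_const_right _ _ (tendsto_pow_atTop two_ne_zero)
      simpa using ((Real.tendsto_exp_atBot.comp h1).mul_const C).mul_const |b - a|
    refine squeeze_zero_norm' ?_ hlim
    filter_upwards [eventually_ge_atTop 1] with R hR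
    refine intervalIntegral.norm_integral_le_of_norm_le_const fun y hy => ?_
    rw [uIoc_of_le hab] at hy
    have hy' : y ∈ Icc a b := Ioc_subset_Icc_self hy
    have hG := hb ((σ * R : ℝ) + y * Complex.I) (by simpa using hy')
      (by simpa [abs_mul, hσ] using hR.trans (le_abs_self R))
    rw [hH]
    simp only
    rw [norm_smul, norm_cexp_neg_mul_sq]
    refine mul_le_mul ?_ hG (norm_nonneg _) (Real.exp_nonneg _)
    rw [Real.exp_le_exp, mul_pow, hσ2, one_mul]
    have : y ^ 2 ≤ (|a| + |b|) ^ 2 := by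
      rw [← sq_abs y]
      refine pow_le_pow_left₀ (abs_nonneg _) ?_ 2
      refine abs_le.2 ⟨?_, ?_⟩
      · linarith [hy'.1, neg_abs_le a, abs_nonneg b]
      · linarith [hy'.2, le_abs_self b, abs_nonneg a]
    nlinarith
  have hrect : ∀ R : ℝ, (∫ x : ℝ in (-R)..R, H (x + a * Complex.I)) -
      (∫ x : ℝ in (-R)..R, H (x + b * Complex.I)) =
      Complex.I • (∫ y : ℝ in a..b, H ((-1 * R : ℝ) + y * Complex.I)) -
      Complex.I • (∫ y : ℝ in a..b, H ((1 * R : ℝ) + y * Complex.I)) := by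
    intro R
    have := Complex.integral_boundary_rect_eq_zero_of_differentiableOn H
      (⟨-R, a⟩ : ℂ) (⟨R, b⟩ : ℂ) (by
        intro w hw
        have hw' : w.im ∈ Icc a b := by
          have := hw.2
          rwa [mem_preimage, uIcc_of_le hab] at this
        exact (DifferentiableAt.smul (by fun_prop) (hd w hw')).differentiableWithinAt)
    simp only at this
    rw [← sub_eq_zero, ← this]
    push_cast
    simp only [neg_mul, one_mul]
    abel
  have h1 : Tendsto (fun R : ℝ => (∫ x : ℝ in (-R)..R, H (x + a * Complex.I)) -
      (∫ x : ℝ in (-R)..R, H (x + b * Complex.I))) atTop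
      (𝓝 ((∫ x : ℝ, H (x + a * Complex.I)) - ∫ x : ℝ, H (x + b * Complex.I))) :=
    (intervalIntegral_tendsto_integral (integrable_gauss_line hε.le ia)
      tendsto_neg_atTop_atBot tendsto_id).sub
    (intervalIntegral_tendsto_integral (integrable_gauss_line hε.le ib)
      tendsto_neg_atTop_atBot tendsto_id)
  have h2 : Tendsto (fun R : ℝ => (∫ x : ℝ in (-R)..R, H (x + a * Complex.I)) -
      (∫ x : ℝ in (-R)..R, H (x + b * Complex.I))) atTop (𝓝 0) := by
    simp_rw [hrect]
    simpa using ((hvert (-1) (by simp)).const_smul Complex.I).sub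
      ((hvert 1 (by simp)).const_smul Complex.I)
  exact sub_eq_zero.1 (tendsto_nhds_unique h1 h2)

/-- Cauchy's theorem for a strip. Boundedness near the two ends suffices and integrability is
only needed on the two boundary lines: the decay that makes the vertical sides of rectangles
negligible is supplied by the factor `exp (-ε w ^ 2)`, and then `ε` tends to zero. -/
theorem integral_line_eq {G : ℂ → E} {a b C : ℝ} (hab : a ≤ b)
    (hd : ∀ w : ℂ, w.im ∈ Icc a b → DifferentiableAt ℂ G w)
    (hb : ∀ w : ℂ, w.im ∈ Icc a b → 1 ≤ |w.re| → ‖G w‖ ≤ C)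
    (ia : Integrable (fun x : ℝ => G (x + a * Complex.I)))
    (ib : Integrable (fun x : ℝ => G (x + b * Complex.I))) :
    ∫ x : ℝ, G (x + a * Complex.I) = ∫ x : ℝ, G (x + b * Complex.I) := by
  have hlim : ∀ c : ℝ, Integrable (fun x : ℝ => G (x + c * Complex.I)) →
      Tendsto (fun n : ℕ => ∫ x : ℝ, Complex.exp (-((1 / ((n : ℝ) + 1) : ℝ) : ℂ) *
        ((x : ℂ) + c * Complex.I) ^ 2) • G (x + c * Complex.I)) atTop
        (𝓝 (∫ x : ℝ, G (x + c * Complex.I))) := by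
    intro c ic
    refine tendsto_integral_of_dominated_convergence
      (fun x => Real.exp (c ^ 2) * ‖G (x + c * Complex.I)‖) (fun n => ?_) ?_ (fun n => ?_) ?_
    · exact (integrable_gauss_line (by positivity) ic).aestronglyMeasurable
    · exact ic.norm.const_mul _
    · refine Eventually.of_forall fun x => ?_
      rw [norm_smul, norm_cexp_neg_mul_sq]
      refine mul_le_mul_of_nonneg_right ?_ (norm_nonneg _)
      rw [Real.exp_le_exp]
      have h0 : (0 : ℝ) ≤ 1 / ((n : ℝ) + 1) := by positivity
      have h1 : 1 / ((n : ℝ) + 1) ≤ 1 := by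
        rw [div_le_one (by positivity)]
        linarith [Nat.cast_nonneg (α := ℝ) n]
      nlinarith [mul_nonneg h0 (sq_nonneg x), mul_le_mul_of_nonneg_right h1 (sq_nonneg c)]
    · refine Eventually.of_forall fun x => ?_
      have h0 : Tendsto (fun n : ℕ => ((1 / ((n : ℝ) + 1) : ℝ) : ℂ)) atTop (𝓝 ((0 : ℝ) : ℂ)) :=
        (Complex.continuous_ofReal.tendsto 0).comp tendsto_one_div_add_atTop_nhds_zero_nat
      have h1 : Tendsto (fun n : ℕ => Complex.exp (-((1 / ((n : ℝ) + 1) : ℝ) : ℂ) *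
          ((x : ℂ) + c * Complex.I) ^ 2)) atTop (𝓝 (Complex.exp (-((0 : ℝ) : ℂ) *
          ((x : ℂ) + c * Complex.I) ^ 2))) :=
        (Complex.continuous_exp.tendsto _).comp (h0.neg.mul_const _)
      simpa using h1.smul_const (G (x + c * Complex.I))
  refine tendsto_nhds_unique (hlim a ia) ?_
  convert hlim b ib using 2 with n
  exact integral_gauss_line_eq hab (by positivity) hd hb ia ib

end Strip

/-! ### Geometry of sectors -/

theorem isOpen_sector (ω : ℝ) : IsOpen (sector ω) := by
  refine isOpen_iff_mem_nhds.2 fun z hz => ?_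
  have h1 : ContinuousAt (fun y : ℂ => InnerProductGeometry.angle (1 : ℂ) y) z :=
    ContinuousAt.comp (f := fun y : ℂ => ((1 : ℂ), y))
      (InnerProductGeometry.continuousAt_angle (x := ((1 : ℂ), z)) one_ne_zero hz.1) (by fun_prop)
  have h2 : ∀ᶠ y in 𝓝 z, InnerProductGeometry.angle (1 : ℂ) y < ω :=
    h1.eventually_lt continuousAt_const (by rw [Complex.angle_one_left hz.1]; exact hz.2)
  filter_upwards [h2, isOpen_ne.mem_nhds hz.1] with y hy hy0
  exact ⟨hy0, by rwa [Complex.angle_one_left hy0] at hy⟩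

theorem eventually_notMem_closedSector {θ : ℝ} (hθ : 0 ≤ θ) {z : ℂ} (hz : z ∉ closedSector θ) :
    ∀ᶠ y in 𝓝 z, y ∉ closedSector θ := by
  have hz0 : z ≠ 0 := by
    rintro rfl
    exact hz (by simpa [closedSector] using hθ)
  have h1 : ContinuousAt (fun y : ℂ => InnerProductGeometry.angle (1 : ℂ) y) z :=
    ContinuousAt.comp (f := fun y : ℂ => ((1 : ℂ), y))
      (InnerProductGeometry.continuousAt_angle (x := ((1 : ℂ), z)) one_ne_zero hz0) (by fun_prop)
  have h2 : ∀ᶠ y in 𝓝 z, θ < InnerProductGeometry.angle (1 : ℂ) y :=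
    continuousAt_const.eventually_lt h1 (by
      rw [Complex.angle_one_left hz0]; exact not_le.1 hz)
  filter_upwards [h2, isOpen_ne.mem_nhds hz0] with y hy hy0
  rw [Complex.angle_one_left hy0] at hy
  exact not_le.2 hy

theorem arg_cexp {w : ℂ} (h1 : -Real.pi < w.im) (h2 : w.im ≤ Real.pi) :
    (Complex.exp w).arg = w.im := by
  rw [← Complex.log_im, Complex.log_exp h1 h2]

theorem cexp_mem_sector {ω : ℝ} (hω : ω ≤ Real.pi) {w : ℂ} (hw : |w.im| < ω) :
    Complex.exp w ∈ sector ω := by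
  have := abs_lt.1 hw
  refine ⟨Complex.exp_ne_zero _, ?_⟩
  rwa [arg_cexp (by linarith) (by linarith)]

theorem cexp_notMem_closedSector {θ : ℝ} (hθ : 0 ≤ θ) {w : ℂ} (h1 : θ < w.im)
    (h2 : w.im < 2 * Real.pi - θ) : Complex.exp w ∉ closedSector θ := by
  intro h
  simp only [closedSector, mem_ofPred_eq] at h
  rcases le_or_gt w.im Real.pi with h3 | h3
  · rw [arg_cexp (by linarith [Real.pi_pos]) h3] at h
    linarith [le_abs_self w.im]
  · rw [← Complex.exp_periodic.sub_eq w, arg_cexp (by simp; linarith)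
      (by simp; linarith)] at h
    have := abs_le.1 h
    simp at this
    linarith

theorem ofReal_mem_sector {ω : ℝ} (hω : 0 < ω) {t : ℝ} (ht : 0 < t) : (t : ℂ) ∈ sector ω :=
  ⟨by exact_mod_cast ht.ne', by rwa [Complex.arg_ofReal_of_nonneg ht.le, abs_zero]⟩

/-- The function `z ↦ (1 + s z)⁻¹`. -/
noncomputable def resFun (s : ℝ) (z : ℂ) : ℂ := (1 + (s : ℂ) * z)⁻¹

/-- A positive lower bound for `‖1 + s z‖ / (1 + s ‖z‖)` on the sector. -/
noncomputable def sectConst (ω : ℝ) : ℝ := Real.sqrt ((1 + Real.cos ω) / 2)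

theorem sectConst_pos {ω : ℝ} (h0 : 0 ≤ ω) (hω : ω < Real.pi) : 0 < sectConst ω := by
  have : Real.cos Real.pi < Real.cos ω := Real.cos_lt_cos_of_nonneg_of_le_pi h0 le_rfl hω
  rw [Real.cos_pi] at this
  exact Real.sqrt_pos.2 (by linarith)

theorem le_norm_one_add_mul {ω : ℝ} (hω : ω ≤ Real.pi) {z : ℂ}
    (hz : z ∈ insert 0 (sector ω)) {s : ℝ} (hs : 0 ≤ s) :
    sectConst ω * (1 + s * ‖z‖) ≤ ‖1 + (s : ℂ) * z‖ := by
  have hre : Real.cos ω * ‖z‖ ≤ z.re := by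
    rcases hz with rfl | hz
    · simp
    · have h := Complex.norm_mul_cos_arg z
      rw [← h, mul_comm, ← Real.cos_abs z.arg]
      refine mul_le_mul_of_nonneg_left ?_ (norm_nonneg _)
      exact Real.cos_le_cos_of_nonneg_of_le_pi (abs_nonneg _) hω hz.2.le
  have hn : ‖z‖ ^ 2 = z.re ^ 2 + z.im ^ 2 := by
    rw [← Complex.normSq_eq_norm_sq, Complex.normSq_apply]; ring
  have hc : 0 ≤ (1 + Real.cos ω) / 2 := by linarith [Real.neg_one_le_cos ω]
  refine le_of_sq_le_sq ?_ (norm_nonneg _)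
  rw [mul_pow, sectConst, Real.sq_sqrt hc, ← Complex.normSq_eq_norm_sq, Complex.normSq_apply]
  simp only [Complex.add_re, Complex.one_re, Complex.mul_re, Complex.ofReal_re, Complex.ofReal_im,
    Complex.add_im, Complex.one_im, Complex.mul_im, zero_mul, sub_zero, add_zero, zero_add]
  have h1 := mul_le_mul_of_nonneg_left hre hs
  have h2 := mul_nonneg (sub_nonneg.2 (Real.cos_le_one ω)) (sq_nonneg (1 - s * ‖z‖))
  have h3 : (1 + s * z.re) * (1 + s * z.re) + s * z.im * (s * z.im) =
      1 + 2 * (s * z.re) + s ^ 2 * ‖z‖ ^ 2 := by rw [hn]; ring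
  rw [h3]
  linear_combination 2 * h1 + h2 / 2

/-! ### Resolvents of sectorial operators -/

section Resolvent

variable {X : Type*} [NormedAddCommGroup X] [NormedSpace ℂ X] {A : X →ₗ.[ℂ] X}

theorem IsInverse.eq {a b : ℂ} {R R' : X →L[ℂ] X} (h : IsInverse A a b R)
    (h' : IsInverse A a b R') : R = R' := by
  ext x
  obtain ⟨hx, e⟩ := h.1 x
  have := h'.2 ⟨R x, hx⟩
  rw [e] at this
  exact this.symm

theorem isInverse_inverse {a b : ℂ} (h : ∃ R, IsInverse A a b R) :
    IsInverse A a b (inverse A a b) := by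
  rw [inverse, dif_pos h]
  exact h.choose_spec

theorem IsInverse.smul {a b c : ℂ} {R : X →L[ℂ] X} (h : IsInverse A a b R) (hc : c ≠ 0) :
    IsInverse A (c * a) (c * b) (c⁻¹ • R) := by
  refine ⟨fun x => ?_, fun x => ?_⟩
  · obtain ⟨hx, e⟩ := h.1 x
    refine ⟨A.domain.smul_mem _ hx, ?_⟩
    have : A ⟨(c⁻¹ • R) x, A.domain.smul_mem _ hx⟩ = c⁻¹ • A ⟨R x, hx⟩ :=
      A.map_smul c⁻¹ ⟨R x, hx⟩
    rw [this, smul_apply, smul_smul, smul_smul]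
    convert e using 3 <;> field_simp
  · rw [mul_smul, mul_smul, ← smul_add, smul_apply, map_smul, h.2,
      inv_smul_smul₀ hc]

theorem isInverse_resolv {z : ℂ} (hz : z ∉ spec A) : IsInverse A z (-1) (resolv A z) :=
  isInverse_inverse (not_not.1 hz)

theorem resolv_identity {z l : ℂ} (hz : z ∉ spec A) (hl : l ∉ spec A) :
    (z - l) • (resolv A z * resolv A l) = resolv A l - resolv A z := by
  ext x
  obtain ⟨hx, e⟩ := (isInverse_resolv hl).1 x
  have h := (isInverse_resolv hz).2 ⟨resolv A l x, hx⟩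
  have h2 : z • resolv A l x + (-1 : ℂ) • A ⟨resolv A l x, hx⟩ =
      x + (z - l) • resolv A l x := by
    have h3 : z • resolv A l x + (-1 : ℂ) • A ⟨resolv A l x, hx⟩ =
        (l • resolv A l x + (-1 : ℂ) • A ⟨resolv A l x, hx⟩) + (z - l) • resolv A l x := by
      module
    rw [h3, e]
  simp only [h2, map_add, map_smul] at h
  simp only [smul_apply, mul_apply_eq_comp,
    sub_apply]
  exact eq_sub_of_add_eq' h

theorem resolv_comm {z l : ℂ} (hz : z ∉ spec A) (hl : l ∉ spec A) :
    resolv A z * resolv A l = resolv A l * resolv A z := by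
  rcases eq_or_ne z l with rfl | hne
  · rfl
  · have h1 := resolv_identity hz hl
    have h2 := resolv_identity hl hz
    have : (z - l) • (resolv A z * resolv A l) = (z - l) • (resolv A l * resolv A z) := by
      rw [h1, ← neg_sub l z, neg_smul, h2, neg_sub]
    exact smul_right_injective _ (sub_ne_zero.2 hne) this

theorem sectAngle_nonneg (A : X →ₗ.[ℂ] X) : 0 ≤ sectAngle A :=
  Real.sInf_nonneg fun _ h => h.1

theorem IsSectorial.sectAngle_lt_pi (hA : IsSectorial A) : sectAngle A < Real.pi := by
  obtain ⟨θ, h⟩ := hA.2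
  exact (csInf_le (s := {θ | SectorialOfAngle A θ}) ⟨0, fun _ h => h.1⟩ h).trans_lt h.2.1

theorem IsSectorial.sectorialOfAngle (hA : IsSectorial A) {θ : ℝ} (h1 : sectAngle A < θ)
    (h2 : θ < Real.pi) : SectorialOfAngle A θ := by
  obtain ⟨θ₀, h0, h3⟩ := exists_lt_of_csInf_lt (s := {θ | SectorialOfAngle A θ}) hA.2 h1
  refine ⟨(h0.1.trans h3.le), h2, h0.2.2.1.trans fun z hz => le_trans hz h3.le, ?_⟩
  exact fun θ' h4 => h0.2.2.2 θ' (h3.trans h4)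

theorem IsSectorial.notMem_spec (hA : IsSectorial A) {θ : ℝ} (h1 : sectAngle A < θ)
    (h2 : θ < Real.pi) {z : ℂ} (hz : z ∉ closedSector θ) : z ∉ spec A :=
  fun h => hz ((hA.sectorialOfAngle h1 h2).2.2.1 h)

theorem IsSectorial.exists_bound (hA : IsSectorial A) {θ : ℝ} (h1 : sectAngle A < θ)
    (h2 : θ < Real.pi) : ∃ C : ℝ, 0 ≤ C ∧ ∀ z ∉ closedSector θ, ‖z • resolv A z‖ ≤ C := by
  obtain ⟨θ₀, h3, h4⟩ := exists_between h1
  obtain ⟨C, hC⟩ := (hA.sectorialOfAngle h3 (h4.trans h2)).2.2.2 θ h4 h2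
  exact ⟨max C 0, le_max_right _ _, fun z hz => (hC z hz).trans (le_max_left _ _)⟩

theorem IsSectorial.hasDerivAt_resolv (hA : IsSectorial A) {θ : ℝ} (h1 : sectAngle A < θ)
    (h2 : θ < Real.pi) {z : ℂ} (hz : z ∉ closedSector θ) :
    HasDerivAt (resolv A) (-(resolv A z * resolv A z)) z := by
  have hθ : 0 ≤ θ := (sectAngle_nonneg A).trans h1.le
  have hz0 : z ≠ 0 := by
    rintro rfl
    exact hz (by simpa [closedSector] using hθ)
  obtain ⟨C, hC0, hC⟩ := hA.exists_bound h1 h2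
  have hev := eventually_notMem_closedSector hθ hz
  have hcont : Tendsto (resolv A) (𝓝 z) (𝓝 (resolv A z)) := by
    rw [tendsto_iff_norm_sub_tendsto_zero]
    have hlim : Tendsto (fun y : ℂ => ‖y - z‖ * (C / ‖y‖ * ‖resolv A z‖)) (𝓝 z) (𝓝 0) := by
      have h3 : Tendsto (fun y : ℂ => C / ‖y‖ * ‖resolv A z‖) (𝓝 z)
          (𝓝 (C / ‖z‖ * ‖resolv A z‖)) :=
        (tendsto_const_nhds.div (continuous_norm.tendsto z) (norm_ne_zero_iff.2 hz0)).mul_const _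
      have h4 : Tendsto (fun y : ℂ => ‖y - z‖) (𝓝 z) (𝓝 0) :=
        tendsto_iff_norm_sub_tendsto_zero.1 tendsto_id
      simpa using h4.mul h3
    refine squeeze_zero' (Eventually.of_forall fun _ => norm_nonneg _) ?_ hlim
    filter_upwards [hev, isOpen_ne.mem_nhds hz0] with y hy hy0
    have h5 := resolv_identity (hA.notMem_spec h1 h2 hy) (hA.notMem_spec h1 h2 hz)
    rw [← norm_neg, neg_sub, ← h5, norm_smul]
    refine mul_le_mul_of_nonneg_left ((norm_mul_le _ _).trans ?_) (norm_nonneg _)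
    refine mul_le_mul_of_nonneg_right ?_ (norm_nonneg _)
    rw [le_div_iff₀ (norm_pos_iff.2 hy0), mul_comm, ← norm_smul]
    exact hC y hy
  rw [hasDerivAt_iff_tendsto_slope]
  have h6 : Tendsto (fun y => -(resolv A y * resolv A z)) (𝓝[≠] z)
      (𝓝 (-(resolv A z * resolv A z))) :=
    ((hcont.mul_const _).neg).mono_left nhdsWithin_le_nhds
  refine h6.congr' ?_
  filter_upwards [nhdsWithin_le_nhds hev, self_mem_nhdsWithin] with y hy hne
  have h5 := resolv_identity (hA.notMem_spec h1 h2 hy) (hA.notMem_spec h1 h2 hz)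
  rw [slope_def_module, ← neg_sub (resolv A z) (resolv A y), ← h5, smul_neg, smul_smul,
    inv_mul_cancel₀ (sub_ne_zero.2 hne), one_smul]

/-! ### The resolvent in logarithmic coordinates -/

/-- The function `w ↦ e ^ w R(e ^ w, A)`, that is, `z R(z, A)` in the coordinate `w = log z`; on
lines parallel to the real axis it is the bounded kernel of the elementary calculus. -/
noncomputable def expRes (A : X →ₗ.[ℂ] X) (w : ℂ) : X →L[ℂ] X :=
  Complex.exp w • resolv A (Complex.exp w)

theorem expRes_add_two_pi (w : ℂ) : expRes A (w + 2 * Real.pi * Complex.I) = expRes A w := by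
  simp only [expRes, Complex.exp_periodic w]

theorem IsSectorial.hasDerivAt_expRes (hA : IsSectorial A) {w : ℂ} (h1 : sectAngle A < w.im)
    (h2 : w.im < 2 * Real.pi - sectAngle A) :
    HasDerivAt (expRes A) (expRes A w - expRes A w * expRes A w) w := by
  obtain ⟨θ, h3, h4⟩ : ∃ θ, sectAngle A < θ ∧ θ < min (min w.im (2 * Real.pi - w.im)) Real.pi := by
    exact exists_between (lt_min (lt_min h1 (by linarith)) hA.sectAngle_lt_pi)
  have h5 : θ < w.im := h4.trans_le ((min_le_left _ _).trans (min_le_left _ _))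
  have h6 : θ < 2 * Real.pi - w.im := h4.trans_le ((min_le_left _ _).trans (min_le_right _ _))
  have hz := cexp_notMem_closedSector ((sectAngle_nonneg A).trans h3.le) h5 (by linarith)
  have h7 := hA.hasDerivAt_resolv h3 (h4.trans_le (min_le_right _ _)) hz
  have h8 := (Complex.hasDerivAt_exp w).smul (h7.scomp w (Complex.hasDerivAt_exp w))
  have h9 : Complex.exp w • Complex.exp w • -(resolv A (Complex.exp w) * resolv A (Complex.exp w)) +
      Complex.exp w • (resolv A ∘ Complex.exp) w = expRes A w - expRes A w * expRes A w := by
    simp only [expRes, smul_mul_smul_comm, Function.comp_apply]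
    module
  rw [h9] at h8
  exact h8

theorem IsSectorial.exists_expRes_bound (hA : IsSectorial A) {θ : ℝ} (h1 : sectAngle A < θ)
    (h2 : θ < Real.pi) : ∃ C : ℝ, 0 ≤ C ∧ ∀ w : ℂ, θ ≤ w.im → w.im ≤ 2 * Real.pi - θ →
      ‖expRes A w‖ ≤ C := by
  obtain ⟨θ', h3, h4⟩ := exists_between h1
  obtain ⟨C, hC0, hC⟩ := hA.exists_bound h3 (h4.trans h2)
  exact ⟨C, hC0, fun w h5 h6 => hC _ (cexp_notMem_closedSector
    ((sectAngle_nonneg A).trans h3.le) (by linarith) (by linarith))⟩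

/-! ### The operators `(1 + s A)⁻¹` -/

theorem neg_notMem_closedSector {θ : ℝ} (hθ : θ < Real.pi) {t : ℝ} (ht : 0 < t) :
    (-(t : ℂ)) ∉ closedSector θ := by
  simp only [closedSector, mem_ofPred_eq, not_le]
  rw [← Complex.ofReal_neg, Complex.arg_ofReal_of_neg (by linarith), abs_of_pos Real.pi_pos]
  exact hθ

theorem IsSectorial.neg_notMem_spec (hA : IsSectorial A) {t : ℝ} (ht : 0 < t) :
    (-(t : ℂ)) ∉ spec A := by
  obtain ⟨θ, h1, h2⟩ := exists_between hA.sectAngle_lt_pi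
  exact hA.notMem_spec h1 h2 (neg_notMem_closedSector h2 ht)

theorem IsSectorial.isInverse_stieltjesRes (hA : IsSectorial A) {s : ℝ≥0} (hs : s ≠ 0) :
    IsInverse A 1 ((s : ℝ) : ℂ) (stieltjesRes A s) := by
  have hs0 : ((s : ℝ) : ℂ) ≠ 0 := by exact_mod_cast hs
  have h := (isInverse_resolv (hA.neg_notMem_spec (t := (s : ℝ)⁻¹) (by positivity))).smul
    (neg_ne_zero.2 hs0)
  rw [stieltjesRes, if_neg hs]
  have h3 : -((s : ℝ) : ℂ) * -(((s : ℝ)⁻¹ : ℝ) : ℂ) = 1 := by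
    push_cast
    field_simp
  have h4 : -((s : ℝ) : ℂ) * -1 = ((s : ℝ) : ℂ) := by ring
  rw [h3, h4] at h
  exact isInverse_inverse ⟨_, h⟩

theorem stieltjesRes_zero : stieltjesRes A 0 = 1 := by simp [stieltjesRes]

theorem stieltjesRes_one : stieltjesRes A 1 = inverse A 1 1 := by simp [stieltjesRes]

theorem IsSectorial.stieltjesRes_eq (hA : IsSectorial A) {s : ℝ≥0} (hs : s ≠ 0) :
    stieltjesRes A s = (-(((s : ℝ)⁻¹ : ℝ) : ℂ)) • resolv A (-(((s : ℝ)⁻¹ : ℝ) : ℂ)) := by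
  have hs0 : ((s : ℝ) : ℂ) ≠ 0 := by exact_mod_cast hs
  have h := (isInverse_resolv (hA.neg_notMem_spec (t := (s : ℝ)⁻¹) (by positivity))).smul
    (neg_ne_zero.2 hs0)
  have h2 := hA.isInverse_stieltjesRes hs
  have h3 : -((s : ℝ) : ℂ) * -(((s : ℝ)⁻¹ : ℝ) : ℂ) = 1 := by
    push_cast
    field_simp
  have h4 : -((s : ℝ) : ℂ) * -1 = ((s : ℝ) : ℂ) := by ring
  rw [h3, h4] at h
  rw [h2.eq h]
  congr 1
  push_cast
  rw [neg_inv]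

theorem IsSectorial.exists_stieltjesRes_bound (hA : IsSectorial A) :
    ∃ C : ℝ, 1 ≤ C ∧ ∀ s : ℝ≥0, ‖stieltjesRes A s‖ ≤ C := by
  obtain ⟨θ, h1, h2⟩ := exists_between hA.sectAngle_lt_pi
  obtain ⟨C, hC0, hC⟩ := hA.exists_bound h1 h2
  refine ⟨max C 1, le_max_right _ _, fun s => ?_⟩
  rcases eq_or_ne s 0 with rfl | hs
  · rw [stieltjesRes_zero]
    exact ContinuousLinearMap.norm_id_le.trans (le_max_right _ _)
  · rw [hA.stieltjesRes_eq hs]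
    exact (hC _ (neg_notMem_closedSector h2 (by positivity))).trans (le_max_left _ _)

theorem IsSectorial.stieltjesRes_comm_resolv (hA : IsSectorial A) (s : ℝ≥0) {z : ℂ}
    (hz : z ∉ spec A) : stieltjesRes A s * resolv A z = resolv A z * stieltjesRes A s := by
  rcases eq_or_ne s 0 with rfl | hs
  · rw [stieltjesRes_zero, one_mul, mul_one]
  · rw [hA.stieltjesRes_eq hs, smul_mul_assoc, mul_smul_comm,
      resolv_comm (hA.neg_notMem_spec (by positivity)) hz]

theorem IsSectorial.stieltjesRes_comm (hA : IsSectorial A) (s t : ℝ≥0) :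
    stieltjesRes A s * stieltjesRes A t = stieltjesRes A t * stieltjesRes A s := by
  rcases eq_or_ne t 0 with rfl | ht
  · rw [stieltjesRes_zero, one_mul, mul_one]
  · rw [hA.stieltjesRes_eq ht, smul_mul_assoc, mul_smul_comm,
      hA.stieltjesRes_comm_resolv s (hA.neg_notMem_spec (by positivity))]

/-- The resolvent identity, written for `z R(z, A)` and `(1 + s A)⁻¹`. -/
theorem IsSectorial.stieltjesRes_mul_resolv (hA : IsSectorial A) (s : ℝ≥0) {z : ℂ}
    (hz : z ∉ spec A) (h1 : 1 + ((s : ℝ) : ℂ) * z ≠ 0) :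
    stieltjesRes A s * (z • resolv A z) =
      resFun s z • (z • resolv A z) + (1 - resFun s z) • stieltjesRes A s := by
  rcases eq_or_ne s 0 with rfl | hs
  · simp [stieltjesRes_zero, resFun]
  · have hs0 : ((s : ℝ) : ℂ) ≠ 0 := by exact_mod_cast hs
    have h := resolv_identity (hA.neg_notMem_spec (t := (s : ℝ)⁻¹) (by positivity)) hz
    rw [hA.stieltjesRes_eq hs]
    obtain ⟨l, hl⟩ : ∃ l : ℂ, l = -(((s : ℝ)⁻¹ : ℝ) : ℂ) := ⟨_, rfl⟩
    rw [← hl] at h ⊢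
    have hsl : ((s : ℝ) : ℂ) * l = -1 := by
      rw [hl]
      push_cast
      field_simp
    have hl0 : l ≠ 0 := by
      rintro h0
      rw [h0, mul_zero] at hsl
      norm_num at hsl
    have hne : l - z ≠ 0 := by
      intro h0
      rw [← sub_eq_zero.1 h0, hsl] at h1
      norm_num at h1
    have h2 : resolv A l * resolv A z = (l - z)⁻¹ • (resolv A z - resolv A l) := by
      rw [← h, inv_smul_smul₀ hne]
    have h3 : resFun s z = l * (l - z)⁻¹ := by
      rw [resFun]
      field_simp
      linear_combination (-z) * hsl
    rw [smul_mul_smul_comm, h2, h3]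
    have h4 : 1 - l * (l - z)⁻¹ = -(z * (l - z)⁻¹) := by
      field_simp
      ring
    rw [h4]
    module

/-- The resolvent identity for the operators `(1 + s A)⁻¹`, free of division. -/
theorem IsSectorial.stieltjesRes_mul (hA : IsSectorial A) (s t : ℝ≥0) :
    (((t : ℝ) : ℂ) - ((s : ℝ) : ℂ)) • (stieltjesRes A s * stieltjesRes A t) =
      ((t : ℝ) : ℂ) • stieltjesRes A t - ((s : ℝ) : ℂ) • stieltjesRes A s := by
  rcases eq_or_ne s t with rfl | hst
  · simp
  rcases eq_or_ne t 0 with rfl | ht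
  · simp [stieltjesRes_zero]
  have ht0 : ((t : ℝ) : ℂ) ≠ 0 := by exact_mod_cast ht
  have hne : ((t : ℝ) : ℂ) - ((s : ℝ) : ℂ) ≠ 0 := by
    rw [sub_ne_zero]
    exact_mod_cast hst.symm
  have h3 : 1 + ((s : ℝ) : ℂ) * -(((t : ℝ)⁻¹ : ℝ) : ℂ) =
      (((t : ℝ) : ℂ) - ((s : ℝ) : ℂ)) / ((t : ℝ) : ℂ) := by
    push_cast
    field_simp
    ring
  have h := hA.stieltjesRes_mul_resolv s (hA.neg_notMem_spec (t := (t : ℝ)⁻¹) (by positivity))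
    (by rw [h3]; exact div_ne_zero hne ht0)
  rw [← hA.stieltjesRes_eq ht, resFun, h3] at h
  rw [h, inv_div, smul_add, smul_smul, smul_smul, mul_div_cancel₀ _ hne, mul_sub,
    mul_div_cancel₀ _ hne]
  module

theorem IsSectorial.stieltjesRes_injective (hA : IsSectorial A) {s : ℝ≥0} {x : X}
    (h : stieltjesRes A s x = 0) : x = 0 := by
  rcases eq_or_ne s 0 with rfl | hs
  · simpa [stieltjesRes_zero] using h
  · obtain ⟨hx, e⟩ := (hA.isInverse_stieltjesRes hs).1 x
    have : (⟨stieltjesRes A s x, hx⟩ : A.domain) = 0 := Subtype.ext h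
    rw [this, LinearPMap.map_zero, h] at e
    simpa using e.symm

/-- The fixed vectors of `(1 + A)⁻¹`, which form the kernel of `A`, are fixed by every
`(1 + s A)⁻¹`. -/
theorem IsSectorial.stieltjesRes_apply_of_fixed (hA : IsSectorial A) (s : ℝ≥0) {x : X}
    (h : stieltjesRes A 1 x = x) : stieltjesRes A s x = x := by
  have h1 := congrArg (fun T => T x) (hA.stieltjesRes_mul s 1)
  simp only [smul_apply, mul_apply_eq_comp,
    sub_apply, h] at h1
  simp only [NNReal.coe_one, Complex.ofReal_one, sub_smul, one_smul] at h1
  exact sub_left_injective h1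

theorem IsSectorial.resolv_apply_of_fixed (hA : IsSectorial A) {z : ℂ} (hz : z ∉ spec A)
    (h0 : z ≠ 0) (h1 : 1 + z ≠ 0) {x : X} (h : stieltjesRes A 1 x = x) :
    z • resolv A z x = x := by
  have h2 := congrArg (fun T => T x) (hA.stieltjesRes_mul_resolv 1 hz (by simpa using h1))
  have h3 := congrArg (fun T => T x) (hA.stieltjesRes_comm_resolv 1 hz)
  simp only [smul_apply, mul_apply_eq_comp,
    add_apply, h, map_smul] at h2 h3
  rw [h3] at h2
  have h4 : (1 - resFun (1 : ℝ≥0) z) • (z • resolv A z x - x) = 0 := by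
    rw [smul_sub, sub_smul, one_smul, sub_eq_zero, sub_eq_iff_eq_add]
    nth_rewrite 1 [h2]
    abel
  have h5 : 1 - resFun (1 : ℝ≥0) z ≠ 0 := by
    have : 1 - resFun (1 : ℝ≥0) z = z / (1 + z) := by
      simp only [resFun, NNReal.coe_one, Complex.ofReal_one, one_mul]
      field_simp
      ring
    rw [this]
    exact div_ne_zero h0 h1
  exact sub_eq_zero.1 ((smul_eq_zero.1 h4).resolve_left h5)

theorem IsSectorial.expRes_pi (hA : IsSectorial A) :
    expRes A (Real.pi * Complex.I) = stieltjesRes A 1 := by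
  rw [hA.stieltjesRes_eq one_ne_zero, expRes, Complex.exp_pi_mul_I]
  simp

end Resolvent

/-! ### Elementary functions -/

section ElementaryFunctions

theorem integral_Ioi_eq_integral_exp {E : Type*} [NormedAddCommGroup E] [NormedSpace ℝ E]
    (g : ℝ → E) : ∫ r in Ioi (0 : ℝ), g r = ∫ x : ℝ, Real.exp x • g (Real.exp x) := by
  have h := integral_image_eq_integral_abs_deriv_smul (s := univ) MeasurableSet.univ
    (fun x _ => (Real.hasDerivAt_exp x).hasDerivWithinAt) Real.exp_injective.injOn g
  rw [image_univ, Real.range_exp] at h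
  simpa [abs_of_pos (Real.exp_pos _)] using h

theorem integrableOn_Ioi_iff_integrable_exp {E : Type*} [NormedAddCommGroup E] [NormedSpace ℝ E]
    (g : ℝ → E) : IntegrableOn g (Ioi (0 : ℝ)) ↔
      Integrable (fun x : ℝ => Real.exp x • g (Real.exp x)) := by
  have h := integrableOn_image_iff_integrableOn_abs_deriv_smul (s := univ) MeasurableSet.univ
    (fun x _ => (Real.hasDerivAt_exp x).hasDerivWithinAt) Real.exp_injective.injOn g
  rw [image_univ, Real.range_exp] at h
  simpa [abs_of_pos (Real.exp_pos _)] using h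

theorem cexp_line (x δ : ℝ) : Complex.exp (x + δ * Complex.I) =
    (Real.exp x : ℂ) * Complex.exp (δ * Complex.I) := by
  rw [Complex.exp_add, Complex.ofReal_exp]

variable {ω : ℝ}

theorem line_mem_sector (hωπ : ω ≤ Real.pi) {δ : ℝ} (hδ : |δ| < ω) (x : ℝ) :
    Complex.exp (x + δ * Complex.I) ∈ sector ω :=
  cexp_mem_sector hωπ (by simpa using hδ)

theorem differentiableAt_of_mem_sector {f : ℂ → ℂ} (hf : DifferentiableOn ℂ f (sector ω)) {z : ℂ}
    (hz : z ∈ sector ω) : DifferentiableAt ℂ f z :=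
  (hf z hz).differentiableAt ((isOpen_sector ω).mem_nhds hz)

theorem continuous_comp_line {f : ℂ → ℂ} (hωπ : ω ≤ Real.pi)
    (hf : DifferentiableOn ℂ f (sector ω)) {δ : ℝ} (hδ : |δ| < ω) :
    Continuous (fun x : ℝ => f (Complex.exp (x + δ * Complex.I))) := by
  refine continuous_iff_continuousAt.2 fun x => ?_
  exact ContinuousAt.comp (f := fun x : ℝ => Complex.exp (x + δ * Complex.I))
    (differentiableAt_of_mem_sector hf (line_mem_sector hωπ hδ x)).continuousAt (by fun_prop)

/-- The elementary functions in the coordinate `w = log z`: integrability on rays with respect to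
`dr / r` is integrability on lines parallel to the real axis. -/
theorem mem_elemFun_iff (hωπ : ω ≤ Real.pi) {f : ℂ → ℂ} : f ∈ elemFun ω ↔ f ∈ Hinf ω ∧
    ∀ δ : ℝ, |δ| < ω → Integrable (fun x : ℝ => f (Complex.exp (x + δ * Complex.I))) := by
  refine and_congr_right fun hf => forall₂_congr fun δ hδ => ?_
  rw [integrableOn_Ioi_iff_integrable_exp, ← integrable_norm_iff
    (continuous_comp_line hωπ hf.1 hδ).aestronglyMeasurable]
  refine iff_of_eq (congrArg (fun g => Integrable g volume) (funext fun x => ?_))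
  rw [cexp_line, smul_eq_mul, mul_div_cancel₀ _ (Real.exp_pos x).ne']

theorem add_mem_Hinf {f g : ℂ → ℂ} (hf : f ∈ Hinf ω) (hg : g ∈ Hinf ω) :
    (fun z => f z + g z) ∈ Hinf ω := by
  obtain ⟨hf, C, hC⟩ := hf
  obtain ⟨hg, D, hD⟩ := hg
  exact ⟨hf.add hg, C + D, fun z hz => (norm_add_le _ _).trans (add_le_add (hC z hz) (hD z hz))⟩

theorem mul_mem_Hinf {f g : ℂ → ℂ} (hf : f ∈ Hinf ω) (hg : g ∈ Hinf ω) :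
    (fun z => f z * g z) ∈ Hinf ω := by
  obtain ⟨hf, C, hC⟩ := hf
  obtain ⟨hg, D, hD⟩ := hg
  refine ⟨hf.mul hg, C * D, fun z hz => ?_⟩
  rw [norm_mul]
  exact mul_le_mul (hC z hz) (hD z hz) (norm_nonneg _) ((norm_nonneg _).trans (hC z hz))

theorem const_mem_Hinf (c : ℂ) : (fun _ => c) ∈ Hinf ω :=
  ⟨differentiableOn_const c, ‖c‖, fun _ _ => le_rfl⟩

theorem add_mem_elemFun (hωπ : ω ≤ Real.pi) {f g : ℂ → ℂ} (hf : f ∈ elemFun ω)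
    (hg : g ∈ elemFun ω) : (fun z => f z + g z) ∈ elemFun ω := by
  rw [mem_elemFun_iff hωπ] at *
  exact ⟨add_mem_Hinf hf.1 hg.1, fun δ hδ => (hf.2 δ hδ).add (hg.2 δ hδ)⟩

theorem mul_mem_elemFun (hωπ : ω ≤ Real.pi) {f g : ℂ → ℂ} (hf : f ∈ Hinf ω)
    (hg : g ∈ elemFun ω) : (fun z => f z * g z) ∈ elemFun ω := by
  rw [mem_elemFun_iff hωπ] at *
  refine ⟨mul_mem_Hinf hf hg.1, fun δ hδ => ?_⟩
  obtain ⟨C, hC⟩ := hf.2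
  exact (hg.2 δ hδ).bdd_mul (c := C) (continuous_comp_line hωπ hf.1 hδ).aestronglyMeasurable
    (Eventually.of_forall fun x => hC _ (line_mem_sector hωπ hδ x))

theorem zero_mem_elemFun (hωπ : ω ≤ Real.pi) : (fun _ => 0) ∈ elemFun ω := by
  rw [mem_elemFun_iff hωπ]
  exact ⟨const_mem_Hinf 0, fun δ _ => integrable_zero _ _ _⟩

theorem one_add_mul_ne_zero (h0 : 0 ≤ ω) (hωπ : ω < Real.pi) {z : ℂ}
    (hz : z ∈ insert 0 (sector ω)) {s : ℝ} (hs : 0 ≤ s) : 1 + (s : ℂ) * z ≠ 0 := by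
  have h := le_norm_one_add_mul hωπ.le hz hs
  have h1 := sectConst_pos h0 hωπ
  rw [← norm_pos_iff]
  exact lt_of_lt_of_le (by positivity) h

theorem norm_resFun_le (h0 : 0 ≤ ω) (hωπ : ω < Real.pi) {z : ℂ}
    (hz : z ∈ insert 0 (sector ω)) {s : ℝ} (hs : 0 ≤ s) :
    ‖resFun s z‖ ≤ (sectConst ω * (1 + s * ‖z‖))⁻¹ := by
  have h1 := sectConst_pos h0 hωπ
  rw [resFun, norm_inv]
  exact inv_anti₀ (by positivity) (le_norm_one_add_mul hωπ.le hz hs)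

theorem norm_resFun_le_const (h0 : 0 ≤ ω) (hωπ : ω < Real.pi) {z : ℂ}
    (hz : z ∈ insert 0 (sector ω)) {s : ℝ} (hs : 0 ≤ s) : ‖resFun s z‖ ≤ (sectConst ω)⁻¹ := by
  have h1 := sectConst_pos h0 hωπ
  refine (norm_resFun_le h0 hωπ hz hs).trans (inv_anti₀ h1 ?_)
  nlinarith [mul_nonneg h1.le (mul_nonneg hs (norm_nonneg z))]

theorem differentiableAt_resFun {s : ℝ} {z : ℂ} (hz : 1 + (s : ℂ) * z ≠ 0) :
    DifferentiableAt ℂ (resFun s) z := by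
  unfold resFun
  exact DifferentiableAt.inv (by fun_prop) hz

theorem resFun_mem_Hinf (h0 : 0 ≤ ω) (hωπ : ω < Real.pi) {s : ℝ} (hs : 0 ≤ s) :
    resFun s ∈ Hinf ω :=
  ⟨fun _ hz => (differentiableAt_resFun (one_add_mul_ne_zero h0 hωπ (mem_insert_of_mem 0 hz)
    hs)).differentiableWithinAt, _, fun _ hz => norm_resFun_le_const h0 hωπ (mem_insert_of_mem 0 hz) hs⟩

/-- The elementary function `z ↦ z / (1 + z) ^ 2`, written with `(1 + z)⁻¹`. -/
noncomputable def bumpFun (z : ℂ) : ℂ := resFun 1 z * (1 - resFun 1 z)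

theorem bumpFun_eq {z : ℂ} (hz : 1 + z ≠ 0) : bumpFun z = z / (1 + z) ^ 2 := by
  rw [bumpFun, resFun, Complex.ofReal_one, one_mul]
  field_simp
  ring

theorem norm_bumpFun_exp_le (h0 : 0 ≤ ω) (hωπ : ω < Real.pi) {δ : ℝ} (hδ : |δ| < ω) (x : ℝ) :
    ‖bumpFun (Complex.exp (x + δ * Complex.I))‖ ≤
      ((sectConst ω) ^ 2)⁻¹ * (Real.exp x / (1 + Real.exp x) ^ 2) := by
  have hz := mem_insert_of_mem 0 (line_mem_sector hωπ.le hδ x)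
  have h1 := one_add_mul_ne_zero h0 hωπ hz zero_le_one
  have h2 := le_norm_one_add_mul hωπ.le hz zero_le_one
  rw [Complex.ofReal_one, one_mul] at h1 h2
  have hn : ‖Complex.exp (x + δ * Complex.I)‖ = Real.exp x := by
    rw [Complex.norm_exp]; simp
  rw [one_mul, hn] at h2
  have h3 := sectConst_pos h0 hωπ
  rw [bumpFun_eq h1, norm_div, norm_pow, hn, ← div_eq_inv_mul, div_div, ← mul_pow]
  refine div_le_div_of_nonneg_left (Real.exp_pos x).le (by positivity) ?_
  refine pow_le_pow_left₀ (by positivity) ?_ 2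
  rw [mul_comm]
  exact h2

theorem exp_div_sq_le (x : ℝ) : Real.exp x / (1 + Real.exp x) ^ 2 ≤ Real.exp (-|x|) := by
  rw [div_le_iff₀ (by positivity)]
  have h1 := Real.exp_pos x
  rcases le_total 0 x with h | h
  · rw [abs_of_nonneg h, Real.exp_neg, ← div_eq_inv_mul, le_div_iff₀ h1]
    nlinarith
  · rw [abs_of_nonpos h, neg_neg]
    refine le_mul_of_one_le_right h1.le ?_
    nlinarith

theorem integrable_exp_neg_mul_abs' {c : ℝ} (hc : 0 < c) :
    Integrable (fun x : ℝ => Real.exp (-(c * |x|))) := by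
  rw [← integrableOn_univ, ← Iic_union_Ioi (a := (0 : ℝ)), integrableOn_union]
  refine ⟨?_, ?_⟩
  · refine (integrableOn_exp_mul_Iic hc 0).congr_fun (fun x hx => ?_) measurableSet_Iic
    simp only [abs_of_nonpos (mem_Iic.1 hx)]
    ring_nf
  · refine (integrableOn_exp_mul_Ioi (a := -c) (by linarith) 0).congr_fun (fun x hx => ?_)
      measurableSet_Ioi
    simp only [abs_of_pos (mem_Ioi.1 hx)]
    ring_nf

theorem bumpFun_mem_Hinf (h0 : 0 ≤ ω) (hωπ : ω < Real.pi) : bumpFun ∈ Hinf ω := by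
  have h1 := resFun_mem_Hinf h0 hωπ zero_le_one
  have h2 := mul_mem_Hinf h1 (add_mem_Hinf (const_mem_Hinf 1) (mul_mem_Hinf (const_mem_Hinf (-1)) h1))
  convert h2 using 1
  funext z
  rw [bumpFun]
  ring

theorem bumpFun_mem_elemFun (h0 : 0 ≤ ω) (hωπ : ω < Real.pi) : bumpFun ∈ elemFun ω := by
  rw [mem_elemFun_iff hωπ.le]
  refine ⟨bumpFun_mem_Hinf h0 hωπ, fun δ hδ => ?_⟩
  refine Integrable.mono' (((integrable_exp_neg_mul_abs' one_pos).const_mul ((sectConst ω) ^ 2)⁻¹))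
    (continuous_comp_line hωπ.le (bumpFun_mem_Hinf h0 hωπ).1 hδ).aestronglyMeasurable
    (Eventually.of_forall fun x => (norm_bumpFun_exp_le h0 hωπ hδ x).trans ?_)
  rw [one_mul]
  exact mul_le_mul_of_nonneg_left (exp_div_sq_le x) (by positivity)

theorem resFun_sub_mem_elemFun (h0 : 0 ≤ ω) (hωπ : ω < Real.pi) {s : ℝ} (hs : 0 < s) :
    (fun z => resFun s z - resFun 1 z) ∈ elemFun ω := by
  -- `r_s - r_1 = (1 - s) ((1 + z) r_s) (z r_1 ^ 2)` and `(1 + z) r_s` is bounded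
  have h1 := mul_mem_elemFun hωπ.le (mul_mem_Hinf (const_mem_Hinf (1 - (s : ℂ)))
    (add_mem_Hinf (const_mem_Hinf (s : ℂ)⁻¹) (mul_mem_Hinf (const_mem_Hinf (1 - (s : ℂ)⁻¹))
      (resFun_mem_Hinf h0 hωπ hs.le)))) (bumpFun_mem_elemFun h0 hωπ)
  rw [mem_elemFun_iff hωπ.le] at h1 ⊢
  have hs0 : (s : ℂ) ≠ 0 := by exact_mod_cast hs.ne'
  have h3 : ∀ z ∈ sector ω, (1 - (s : ℂ)) * ((s : ℂ)⁻¹ + (1 - (s : ℂ)⁻¹) * resFun s z) *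
      bumpFun z = resFun s z - resFun 1 z := by
    intro z hz
    have h4 := one_add_mul_ne_zero h0 hωπ (mem_insert_of_mem 0 hz) hs.le
    have h5 := one_add_mul_ne_zero h0 hωπ (mem_insert_of_mem 0 hz) zero_le_one
    rw [Complex.ofReal_one, one_mul] at h5
    rw [bumpFun_eq h5, resFun, resFun, Complex.ofReal_one, one_mul]
    field_simp
    ring
  refine ⟨⟨h1.1.1.congr fun z hz => (h3 z hz).symm, ?_⟩, fun δ hδ => ?_⟩
  · obtain ⟨C, hC⟩ := h1.1.2
    exact ⟨C, fun z hz => (congrArg norm (h3 z hz)).ge.trans (hC z hz)⟩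
  · refine (h1.2 δ hδ).congr (Eventually.of_forall fun x => h3 _ (line_mem_sector hωπ.le hδ x))

/-- A function that is integrable with respect to `dt / t` on `(0, ∞)` has no nonzero limit at `0`
or at infinity. -/
theorem eq_zero_of_tendsto_of_integrable {u : ℝ → ℂ} (hu : Integrable u) {L : ℂ} {l : Filter ℝ}
    (hl : l = atTop ∨ l = atBot) (h : Tendsto u l (𝓝 L)) : L = 0 := by
  by_contra hL
  have h1 : ∀ᶠ x in l, ‖L‖ / 2 < ‖u x‖ :=
    h.norm.eventually (lt_mem_nhds (half_lt_self (norm_pos_iff.2 hL)))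
  have h2 : volume {x | ‖L‖ / 2 ≤ ‖u x‖} < ⊤ :=
    hu.measure_norm_ge_lt_top (half_pos (norm_pos_iff.2 hL))
  rcases hl with rfl | rfl
  · obtain ⟨a, ha⟩ := eventually_atTop.1 h1
    have : volume (Ici a) ≤ volume {x | ‖L‖ / 2 ≤ ‖u x‖} := measure_mono fun x hx => (ha x hx).le
    rw [Real.volume_Ici] at this
    exact absurd h2 (not_lt.2 this)
  · obtain ⟨a, ha⟩ := eventually_atBot.1 h1
    have : volume (Iic a) ≤ volume {x | ‖L‖ / 2 ≤ ‖u x‖} := measure_mono fun x hx => (ha x hx).le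
    rw [Real.volume_Iic] at this
    exact absurd h2 (not_lt.2 this)

end ElementaryFunctions

/-! ### The Cauchy integral of elementary functions -/

section Cauchy

variable {X : Type*} [NormedAddCommGroup X] [NormedSpace ℂ X]
  {A : X →ₗ.[ℂ] X} {ω : ℝ}

/-- On lines below the real axis the differential equation of `expRes` follows by periodicity. -/
theorem IsSectorial.hasDerivAt_expRes_abs (hA : IsSectorial A) {w : ℂ}
    (h1 : sectAngle A < |w.im|) (h2 : |w.im| < 2 * Real.pi - sectAngle A) :
    HasDerivAt (expRes A) (expRes A w - expRes A w * expRes A w) w := by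
  rcases le_total 0 w.im with h | h
  · rw [abs_of_nonneg h] at h1 h2
    exact hA.hasDerivAt_expRes h1 h2
  · rw [abs_of_nonpos h] at h1 h2
    have h3 := hA.hasDerivAt_expRes (w := w + 2 * Real.pi * Complex.I) (by simp; linarith)
      (by simp; linarith)
    have h4 := h3.comp_add_const w (2 * Real.pi * Complex.I)
    simpa only [expRes_add_two_pi] using h4

theorem IsSectorial.exists_expRes_abs_bound (hA : IsSectorial A) {θ : ℝ} (h1 : sectAngle A < θ)
    (h2 : θ < Real.pi) : ∃ C : ℝ, 0 ≤ C ∧ ∀ w : ℂ, θ ≤ |w.im| → |w.im| ≤ 2 * Real.pi - θ →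
      ‖expRes A w‖ ≤ C := by
  obtain ⟨C, hC0, hC⟩ := hA.exists_expRes_bound h1 h2
  refine ⟨C, hC0, fun w h3 h4 => ?_⟩
  rcases le_total 0 w.im with h | h
  · rw [abs_of_nonneg h] at h3 h4
    exact hC w h3 h4
  · rw [abs_of_nonpos h] at h3 h4
    rw [← expRes_add_two_pi]
    exact hC _ (by simp; linarith) (by simp; linarith)

/-- The integral of `f(z) R(z, A) dz` along the ray of angle `δ`, in logarithmic coordinates. -/
noncomputable def lineInt (A : X →ₗ.[ℂ] X) (δ : ℝ) (f : ℂ → ℂ) : X →L[ℂ] X :=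
  ∫ x : ℝ, f (Complex.exp (x + δ * Complex.I)) • expRes A (x + δ * Complex.I)

theorem integral_ray_eq_lineInt (δ : ℝ) (f : ℂ → ℂ) :
    ∫ r in Ioi (0 : ℝ), (f (r * Complex.exp (δ * Complex.I)) * Complex.exp (δ * Complex.I)) •
        resolv A (r * Complex.exp (δ * Complex.I)) = lineInt A δ f := by
  rw [integral_Ioi_eq_integral_exp, lineInt]
  congr 1
  funext x
  rw [expRes, cexp_line, ← Complex.coe_smul, smul_smul, smul_smul]
  congr 1
  ring

theorem cauchyInt_eq_lineInt (δ : ℝ) (f : ℂ → ℂ) : cauchyInt A δ f =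
    (2 * Real.pi * Complex.I : ℂ)⁻¹ • (lineInt A (-δ) f - lineInt A δ f) := by
  rw [cauchyInt, ← integral_ray_eq_lineInt, ← integral_ray_eq_lineInt, Complex.ofReal_neg]

theorem IsSectorial.integrable_line (hA : IsSectorial A) (hωπ : ω < Real.pi) {δ : ℝ}
    (h1 : sectAngle A < |δ|) (h2 : |δ| < ω) {f : ℂ → ℂ} (hf : f ∈ elemFun ω) :
    Integrable (fun x : ℝ => f (Complex.exp (x + δ * Complex.I)) •
      expRes A (x + δ * Complex.I)) := by
  obtain ⟨C, -, hC⟩ := hA.exists_expRes_abs_bound h1 (h2.trans hωπ)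
  refine (((mem_elemFun_iff hωπ.le).1 hf).2 δ h2).smul_bdd C ?_ ?_
  · refine (continuous_line (G := expRes A) fun x => ?_).aestronglyMeasurable
    exact (hA.hasDerivAt_expRes_abs (by simpa using h1) (by simp; linarith)).continuousAt
  · exact Eventually.of_forall fun x => hC _ (by simp) (by simp; linarith)

theorem IsSectorial.norm_lineInt_le (hA : IsSectorial A) (hωπ : ω < Real.pi) {δ : ℝ}
    (h1 : sectAngle A < |δ|) (h2 : |δ| < ω) : ∃ C : ℝ, 0 ≤ C ∧ ∀ f ∈ elemFun ω,
      ‖lineInt A δ f‖ ≤ C * ∫ x : ℝ, ‖f (Complex.exp (x + δ * Complex.I))‖ := by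
  obtain ⟨C, hC0, hC⟩ := hA.exists_expRes_abs_bound h1 (h2.trans hωπ)
  refine ⟨C, hC0, fun f hf => ?_⟩
  rw [← integral_const_mul]
  refine norm_integral_le_of_norm_le ((((mem_elemFun_iff hωπ.le).1 hf).2 δ h2).norm.const_mul C)
    (Eventually.of_forall fun x => ?_)
  rw [norm_smul, mul_comm]
  exact mul_le_mul_of_nonneg_right (hC _ (by simp) (by simp; linarith)) (norm_nonneg _)

theorem IsSectorial.lineInt_congr (hωπ : ω ≤ Real.pi) {δ : ℝ} (h2 : |δ| < ω) {f g : ℂ → ℂ}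
    (h : EqOn f g (sector ω)) : lineInt A δ f = lineInt A δ g := by
  rw [lineInt, lineInt]
  congr 1
  funext x
  rw [h (line_mem_sector hωπ h2 x)]

theorem cauchyInt_congr (hωπ : ω ≤ Real.pi) {δ : ℝ} (h2 : |δ| < ω) {f g : ℂ → ℂ}
    (h : EqOn f g (sector ω)) : cauchyInt A δ f = cauchyInt A δ g := by
  rw [cauchyInt_eq_lineInt, cauchyInt_eq_lineInt, IsSectorial.lineInt_congr hωπ h2 h,
    IsSectorial.lineInt_congr hωπ (by rwa [abs_neg]) h]

theorem IsSectorial.lineInt_add (hA : IsSectorial A) (hωπ : ω < Real.pi) {δ : ℝ}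
    (h1 : sectAngle A < |δ|) (h2 : |δ| < ω) {f g : ℂ → ℂ} (hf : f ∈ elemFun ω)
    (hg : g ∈ elemFun ω) : lineInt A δ (fun z => f z + g z) = lineInt A δ f + lineInt A δ g := by
  rw [lineInt, lineInt, lineInt, ← integral_add (hA.integrable_line hωπ h1 h2 hf)
    (hA.integrable_line hωπ h1 h2 hg)]
  simp only [add_smul]

theorem IsSectorial.cauchyInt_add (hA : IsSectorial A) (hωπ : ω < Real.pi) {δ : ℝ}
    (h1 : sectAngle A < δ) (h2 : δ < ω) {f g : ℂ → ℂ} (hf : f ∈ elemFun ω)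
    (hg : g ∈ elemFun ω) :
    cauchyInt A δ (fun z => f z + g z) = cauchyInt A δ f + cauchyInt A δ g := by
  have h0 : |δ| = δ := abs_of_nonneg ((sectAngle_nonneg A).trans h1.le)
  simp only [cauchyInt_eq_lineInt]
  rw [hA.lineInt_add hωπ (by simpa only [abs_neg, h0] using h1)
      (by simpa only [abs_neg, h0] using h2) hf hg,
    hA.lineInt_add hωπ (by simpa only [abs_neg, h0] using h1)
      (by simpa only [abs_neg, h0] using h2) hf hg]
  module

theorem cauchyInt_const_mul (δ : ℝ) (c : ℂ) (f : ℂ → ℂ) :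
    cauchyInt A δ (fun z => c * f z) = c • cauchyInt A δ f := by
  have h : ∀ δ, lineInt A δ (fun z => c * f z) = c • lineInt A δ f := by
    intro δ
    rw [lineInt, lineInt, ← integral_smul]
    simp only [smul_smul]
  rw [cauchyInt_eq_lineInt, cauchyInt_eq_lineInt, h, h]
  module

theorem differentiableAt_comp_exp (hωπ : ω ≤ Real.pi) {f : ℂ → ℂ}
    (hf : DifferentiableOn ℂ f (sector ω)) {w : ℂ} (hw : |w.im| < ω) :
    DifferentiableAt ℂ (fun w => f (Complex.exp w)) w :=
  (differentiableAt_of_mem_sector hf (cexp_mem_sector hωπ hw)).comp w Complex.differentiableAt_exp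

theorem integral_elemFun_line_eq (hωπ : ω ≤ Real.pi) {f : ℂ → ℂ} (hf : f ∈ elemFun ω) {a b : ℝ}
    (hab : a ≤ b) (ha : |a| < ω) (hb : |b| < ω) :
    ∫ x : ℝ, f (Complex.exp (x + a * Complex.I)) = ∫ x : ℝ, f (Complex.exp (x + b * Complex.I)) := by
  obtain ⟨C, hC⟩ := hf.1.2
  have him : ∀ w : ℂ, w.im ∈ Icc a b → |w.im| < ω := fun w hw =>
    abs_lt.2 ⟨(abs_lt.1 ha).1.trans_le hw.1, hw.2.trans_lt (abs_lt.1 hb).2⟩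
  exact integral_line_eq (G := fun w => f (Complex.exp w)) (C := C) hab
    (fun w hw => differentiableAt_comp_exp hωπ hf.1.1 (him w hw))
    (fun w hw _ => hC _ (cexp_mem_sector hωπ (him w hw)))
    (((mem_elemFun_iff hωπ).1 hf).2 a ha) (((mem_elemFun_iff hωπ).1 hf).2 b hb)

theorem IsSectorial.lineInt_eq (hA : IsSectorial A) (hωπ : ω < Real.pi) {a b : ℝ} (hab : a ≤ b)
    {θ : ℝ} (hθ : sectAngle A < θ) (h : ∀ y ∈ Icc a b, θ ≤ |y| ∧ |y| < ω) {f : ℂ → ℂ}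
    (hf : f ∈ elemFun ω) : lineInt A a f = lineInt A b f := by
  have ha := h a (left_mem_Icc.2 hab)
  have hb := h b (right_mem_Icc.2 hab)
  obtain ⟨C, hC0, hC⟩ := hA.exists_expRes_abs_bound hθ (ha.1.trans_lt (ha.2.trans hωπ))
  obtain ⟨D, hD⟩ := hf.1.2
  refine integral_line_eq (G := fun w => f (Complex.exp w) • expRes A w) (C := D * C) hab
    (fun w hw => ?_) (fun w hw _ => ?_) (hA.integrable_line hωπ (hθ.trans_le ha.1) ha.2 hf)
    (hA.integrable_line hωπ (hθ.trans_le hb.1) hb.2 hf)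
  · exact (differentiableAt_comp_exp hωπ.le hf.1.1 (h _ hw).2).smul
      (hA.hasDerivAt_expRes_abs (hθ.trans_le (h _ hw).1)
        (by linarith [(h _ hw).1, (h _ hw).2])).differentiableAt
  · rw [norm_smul]
    have h3 := hD _ (cexp_mem_sector hωπ.le (h _ hw).2)
    refine mul_le_mul h3 (hC w (h _ hw).1 (by linarith [(h _ hw).1, (h _ hw).2]))
      (norm_nonneg _) ((norm_nonneg _).trans h3)

/-- The Cauchy integral does not depend on the angle of the contour. -/
theorem IsSectorial.cauchyInt_eq (hA : IsSectorial A) (hωπ : ω < Real.pi) {a b : ℝ}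
    (ha : sectAngle A < a) (ha' : a < ω) (hb : sectAngle A < b) (hb' : b < ω) {f : ℂ → ℂ}
    (hf : f ∈ elemFun ω) : cauchyInt A a f = cauchyInt A b f := by
  wlog hab : a ≤ b generalizing a b
  · exact (this hb hb' ha ha' (le_of_not_ge hab)).symm
  have h0 := (sectAngle_nonneg A).trans_lt ha
  rw [cauchyInt_eq_lineInt, cauchyInt_eq_lineInt,
    hA.lineInt_eq hωπ hab ha (fun y hy => ?_) hf,
    hA.lineInt_eq hωπ (neg_le_neg hab) ha (fun y hy => ?_) hf]
  · rw [abs_of_nonpos (by linarith [hy.2])]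
    constructor <;> linarith [hy.1, hy.2]
  · rw [abs_of_nonneg (by linarith [hy.1])]
    constructor <;> linarith [hy.1, hy.2]

/-! ### Multiplication by resolvents -/

theorem resFun_mul_mem_elemFun (h0 : 0 ≤ ω) (hωπ : ω < Real.pi) (s : ℝ≥0)
    {f : ℂ → ℂ} (hf : f ∈ elemFun ω) : (fun z => resFun s z * f z) ∈ elemFun ω :=
  mul_mem_elemFun hωπ.le (resFun_mem_Hinf h0 hωπ s.coe_nonneg) hf

theorem IsSectorial.notMem_spec_line (hA : IsSectorial A) {δ : ℝ} (h1 : sectAngle A < |δ|)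
    (h2 : |δ| < Real.pi) (x : ℝ) : Complex.exp (x + δ * Complex.I) ∉ spec A := by
  obtain ⟨θ, h3, h4⟩ := exists_between h1
  refine hA.notMem_spec h3 (h4.trans h2) ?_
  have := abs_lt.1 h2
  rw [closedSector, mem_ofPred_eq, arg_cexp (by simp; linarith) (by simp; linarith), not_le]
  simpa using h4

variable [CompleteSpace X]

/-- The resolvent identity turns `f(z) (1 + s A)⁻¹ R(z, A)` into `f(z) (1 + s z)⁻¹ R(z, A)` plus a
scalar multiple of `(1 + s A)⁻¹`; the scalar drops out after integration over the whole contour. -/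
theorem IsSectorial.stieltjesRes_mul_lineInt (hA : IsSectorial A) (hω : sectAngle A < ω)
    (hωπ : ω < Real.pi) (s : ℝ≥0) {δ : ℝ} (h1 : sectAngle A < |δ|) (h2 : |δ| < ω) {f : ℂ → ℂ}
    (hf : f ∈ elemFun ω) : stieltjesRes A s * lineInt A δ f =
      lineInt A δ (fun z => resFun s z * f z) +
      (∫ x : ℝ, (f (Complex.exp (x + δ * Complex.I)) +
        -1 * (resFun s (Complex.exp (x + δ * Complex.I)) * f (Complex.exp (x + δ * Complex.I))))) •
        stieltjesRes A s := by
  have hs := resFun_mul_mem_elemFun ((sectAngle_nonneg A).trans hω.le) hωπ s hf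
  have hi := ((mem_elemFun_iff hωπ.le).1 (add_mem_elemFun hωπ.le hf
    (mul_mem_elemFun hωπ.le (const_mem_Hinf (-1)) hs))).2 δ h2
  have h3 : stieltjesRes A s * lineInt A δ f = ∫ x : ℝ, stieltjesRes A s *
      (f (Complex.exp (x + δ * Complex.I)) • expRes A (x + δ * Complex.I)) :=
    ((ContinuousLinearMap.mul ℂ (X →L[ℂ] X) (stieltjesRes A s)).integral_comp_comm
      (hA.integrable_line hωπ h1 h2 hf)).symm
  have h6 : (∫ x : ℝ, (f (Complex.exp (x + δ * Complex.I)) +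
      -1 * (resFun s (Complex.exp (x + δ * Complex.I)) * f (Complex.exp (x + δ * Complex.I))))) •
      stieltjesRes A s = _ := (integral_smul_const _ (stieltjesRes A s)).symm
  rw [h3, lineInt, h6, ← integral_add (hA.integrable_line hωπ h1 h2 hs) (hi.smul_const _)]
  congr 1
  funext x
  have hz := hA.notMem_spec_line h1 (h2.trans hωπ) x
  have h4 := hA.stieltjesRes_mul_resolv s hz (one_add_mul_ne_zero
    ((sectAngle_nonneg A).trans hω.le) hωπ (mem_insert_of_mem 0 (line_mem_sector hωπ.le h2 x))
    s.coe_nonneg)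
  rw [mul_smul_comm, expRes, h4]
  module

theorem IsSectorial.lineInt_comm (hA : IsSectorial A)
    (hωπ : ω < Real.pi) (s : ℝ≥0) {δ : ℝ} (h1 : sectAngle A < |δ|) (h2 : |δ| < ω) {f : ℂ → ℂ}
    (hf : f ∈ elemFun ω) : stieltjesRes A s * lineInt A δ f =
      lineInt A δ f * stieltjesRes A s := by
  have h3 : stieltjesRes A s * lineInt A δ f = ∫ x : ℝ, stieltjesRes A s *
      (f (Complex.exp (x + δ * Complex.I)) • expRes A (x + δ * Complex.I)) :=
    ((ContinuousLinearMap.mul ℂ (X →L[ℂ] X) (stieltjesRes A s)).integral_comp_comm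
      (hA.integrable_line hωπ h1 h2 hf)).symm
  have h4 : lineInt A δ f * stieltjesRes A s = ∫ x : ℝ,
      (f (Complex.exp (x + δ * Complex.I)) • expRes A (x + δ * Complex.I)) * stieltjesRes A s :=
    (((ContinuousLinearMap.mul ℂ (X →L[ℂ] X)).flip (stieltjesRes A s)).integral_comp_comm
      (hA.integrable_line hωπ h1 h2 hf)).symm
  rw [h3, h4]
  congr 1
  funext x
  rw [mul_smul_comm, smul_mul_assoc, expRes, mul_smul_comm, smul_mul_assoc,
    hA.stieltjesRes_comm_resolv s (hA.notMem_spec_line h1 (h2.trans hωπ) x)]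

theorem IsSectorial.cauchyInt_comm (hA : IsSectorial A)
    (hωπ : ω < Real.pi) (s : ℝ≥0) {δ : ℝ} (h1 : sectAngle A < δ) (h2 : δ < ω) {f : ℂ → ℂ}
    (hf : f ∈ elemFun ω) : stieltjesRes A s * cauchyInt A δ f =
      cauchyInt A δ f * stieltjesRes A s := by
  have h0 : |δ| = δ := abs_of_nonneg ((sectAngle_nonneg A).trans h1.le)
  rw [cauchyInt_eq_lineInt, mul_smul_comm, smul_mul_assoc, mul_sub, sub_mul,
    hA.lineInt_comm hωπ s (by simpa only [abs_neg, h0] using h1)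
      (by simpa only [abs_neg, h0] using h2) hf,
    hA.lineInt_comm hωπ s (by simpa only [abs_neg, h0] using h1)
      (by simpa only [abs_neg, h0] using h2) hf]

theorem IsSectorial.stieltjesRes_mul_cauchyInt (hA : IsSectorial A) (hω : sectAngle A < ω)
    (hωπ : ω < Real.pi) (s : ℝ≥0) {δ : ℝ} (h1 : sectAngle A < δ) (h2 : δ < ω) {f : ℂ → ℂ}
    (hf : f ∈ elemFun ω) : stieltjesRes A s * cauchyInt A δ f =
      cauchyInt A δ (fun z => resFun s z * f z) := by
  have hp := (sectAngle_nonneg A).trans h1.le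
  have h0 : |δ| = δ := abs_of_nonneg hp
  have hs := resFun_mul_mem_elemFun ((sectAngle_nonneg A).trans hω.le) hωπ s hf
  have hi := integral_elemFun_line_eq hωπ.le (add_mem_elemFun hωπ.le hf
    (mul_mem_elemFun hωπ.le (const_mem_Hinf (-1)) hs)) (a := -δ) (b := δ) (by linarith)
    (by rwa [abs_neg, h0]) (by rwa [h0])
  rw [cauchyInt_eq_lineInt, cauchyInt_eq_lineInt, mul_smul_comm, mul_sub,
    hA.stieltjesRes_mul_lineInt hω hωπ s (by simpa only [abs_neg, h0] using h1)
      (by simpa only [abs_neg, h0] using h2) hf,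
    hA.stieltjesRes_mul_lineInt hω hωπ s (by simpa only [abs_neg, h0] using h1)
      (by simpa only [abs_neg, h0] using h2) hf, hi,
    add_sub_add_right_eq_sub]

/-- The Cauchy integral of an elementary function vanishes on the kernel of `A`, which is the space
of fixed vectors of `(1 + A)⁻¹`. -/
theorem IsSectorial.cauchyInt_apply_of_fixed (hA : IsSectorial A)
    (hωπ : ω < Real.pi) {δ : ℝ} (h1 : sectAngle A < δ) (h2 : δ < ω) {f : ℂ → ℂ}
    (hf : f ∈ elemFun ω) {x : X} (hx : stieltjesRes A 1 x = x) : cauchyInt A δ f x = 0 := by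
  have hp := (sectAngle_nonneg A).trans h1.le
  have h0 : |δ| = δ := abs_of_nonneg hp
  have h3 : ∀ η : ℝ, sectAngle A < |η| → |η| < ω → lineInt A η f x =
      (∫ y : ℝ, f (Complex.exp (y + η * Complex.I))) • x := by
    intro η h3 h4
    rw [lineInt, ContinuousLinearMap.integral_apply (hA.integrable_line hωπ h3 h4 hf),
      ← integral_smul_const]
    congr 1
    funext y
    have h5 := one_add_mul_ne_zero ((sectAngle_nonneg A).trans (h3.trans h4).le) hωπ
      (mem_insert_of_mem 0 (line_mem_sector hωπ.le h4 y)) zero_le_one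
    rw [Complex.ofReal_one, one_mul] at h5
    rw [smul_apply, expRes, smul_apply, hA.resolv_apply_of_fixed
      (hA.notMem_spec_line h3 (h4.trans hωπ) y) (Complex.exp_ne_zero _) h5 hx]
  rw [cauchyInt_eq_lineInt, smul_apply, sub_apply, h3 δ (by simpa only [abs_neg, h0] using h1)
      (by simpa only [abs_neg, h0] using h2),
    h3 (-δ) (by simpa only [abs_neg, h0] using h1) (by simpa only [abs_neg, h0] using h2),
    integral_elemFun_line_eq hωπ.le hf (a := -δ) (b := δ) (by linarith)
    (by rwa [abs_neg, h0]) (by rwa [h0]), sub_self, smul_zero]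

end Cauchy

/-! ### Normalisation of the Cauchy integral -/

section Normalisation

theorem one_add_cexp_ne_zero_of_re {w : ℂ} (h : w.re ≠ 0) : 1 + Complex.exp w ≠ 0 := by
  intro h1
  have h2 : ‖Complex.exp w‖ = 1 := by
    rw [eq_neg_of_add_eq_zero_right h1, norm_neg, norm_one]
  rw [Complex.norm_exp, Real.exp_eq_one_iff] at h2
  exact h h2

theorem norm_bumpFun_exp_le_inv_sq {w : ℂ} (h : w.re ≠ 0) :
    ‖bumpFun (Complex.exp w)‖ ≤ (w.re ^ 2)⁻¹ := by
  have hx : 0 < w.re ^ 2 := by positivity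
  have h1 : (w.re / 2) ^ 2 ≤ Real.sinh (w.re / 2) ^ 2 := by
    rw [← sq_abs (w.re / 2), ← sq_abs (Real.sinh (w.re / 2)), Real.abs_sinh]
    exact pow_le_pow_left₀ (abs_nonneg _) (Real.self_le_sinh_iff.2 (abs_nonneg _)) 2
  have h2 : (Real.exp w.re - 1) ^ 2 = 4 * Real.exp w.re * Real.sinh (w.re / 2) ^ 2 := by
    have h3 : Real.exp w.re = Real.exp (w.re / 2) ^ 2 := by
      rw [← Real.exp_nat_mul]; congr 1; push_cast; ring
    have h4 : Real.exp (w.re / 2) ≠ 0 := (Real.exp_pos _).ne'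
    rw [Real.sinh_eq, Real.exp_neg, h3]
    field_simp
    ring
  have h5 : (Real.exp w.re - 1) ^ 2 ≤ ‖1 + Complex.exp w‖ ^ 2 := by
    rw [← sq_abs]
    refine pow_le_pow_left₀ (abs_nonneg _) ?_ 2
    have := abs_norm_sub_norm_le (Complex.exp w) (-1)
    rwa [norm_neg, norm_one, sub_neg_eq_add, add_comm, Complex.norm_exp] at this
  have h6 := Real.exp_pos w.re
  rw [bumpFun_eq (one_add_cexp_ne_zero_of_re h), norm_div, norm_pow, Complex.norm_exp,
    div_le_iff₀ (by have := norm_pos_iff.2 (one_add_cexp_ne_zero_of_re h); positivity),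
    inv_mul_eq_div, le_div_iff₀ hx]
  nlinarith [mul_le_mul_of_nonneg_left h1 h6.le]

theorem one_add_cexp_ne_zero {w : ℂ} (h : |w.im| < Real.pi) : 1 + Complex.exp w ≠ 0 := by
  intro h1
  have h2 := arg_cexp (w := w) (abs_lt.1 h).1 (abs_lt.1 h).2.le
  rw [eq_neg_of_add_eq_zero_right h1, Complex.arg_neg_one] at h2
  rw [← h2, abs_of_pos Real.pi_pos] at h
  exact lt_irrefl _ h

theorem differentiableAt_bumpFun {z : ℂ} (hz : 1 + z ≠ 0) : DifferentiableAt ℂ bumpFun z := by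
  have := differentiableAt_resFun (s := 1) (z := z) (by simpa using hz)
  unfold bumpFun
  fun_prop

variable {ω : ℝ}

theorem integral_bumpFun_line (hωπ : ω < Real.pi) {a : ℝ} (ha : |a| < ω) :
    ∫ x : ℝ, bumpFun (Complex.exp (x + a * Complex.I)) = 1 := by
  have h0 : 0 < ω := (abs_nonneg a).trans_lt ha
  have hb := bumpFun_mem_elemFun h0.le hωπ
  have h1 : ∫ x : ℝ, bumpFun (Complex.exp (x + a * Complex.I)) =
      ∫ x : ℝ, bumpFun (Complex.exp (x + (0 : ℝ) * Complex.I)) := by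
    rcases le_total a 0 with h | h
    · exact integral_elemFun_line_eq hωπ.le hb h ha (by simpa using h0)
    · exact (integral_elemFun_line_eq hωπ.le hb h (by simpa using h0) ha).symm
  have h2 : ∀ x : ℝ, bumpFun (Complex.exp (x + (0 : ℝ) * Complex.I)) =
      ((Real.exp x / (1 + Real.exp x) ^ 2 : ℝ) : ℂ) := by
    intro x
    rw [Complex.ofReal_zero, zero_mul, add_zero, bumpFun_eq (one_add_cexp_ne_zero
      (by simpa using Real.pi_pos))]
    push_cast
    rfl
  have hint := ((mem_elemFun_iff hωπ.le).1 hb).2 0 (by simpa using h0)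
  rw [h1]
  simp only [h2] at hint ⊢
  have hint' : Integrable (fun x : ℝ => Real.exp x / (1 + Real.exp x) ^ 2) := by
    exact hint.re
  rw [integral_complex_ofReal]
  have h3 := integral_of_hasDerivAt_of_tendsto (f := fun x : ℝ => -(1 + Real.exp x)⁻¹)
    (f' := fun x => Real.exp x / (1 + Real.exp x) ^ 2) (m := -1) (n := 0) (fun x => ?_) hint' ?_ ?_
  · rw [h3]
    norm_num
  · have h4 : HasDerivAt (fun x : ℝ => -(1 + Real.exp x)⁻¹)
        (-(-Real.exp x / (1 + Real.exp x) ^ 2)) x :=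
      (((Real.hasDerivAt_exp x).const_add 1).inv (by have := Real.exp_pos x; positivity)).neg
    rwa [neg_div, neg_neg] at h4
  · have := ((Real.tendsto_exp_atBot.const_add 1).inv₀ (by norm_num)).neg
    simpa using this
  · have := (tendsto_atTop_add_const_left _ (1 : ℝ) Real.tendsto_exp_atTop).inv_tendsto_atTop.neg
    simpa using this

theorem integrable_bumpFun_mul_line (hωπ : ω < Real.pi) {a : ℝ} (ha : |a| < ω) (c : ℂ) :
    Integrable (fun x : ℝ => bumpFun (Complex.exp (x + a * Complex.I)) *
      (x + a * Complex.I - c)) := by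
  have h0 : 0 < ω := (abs_nonneg a).trans_lt ha
  refine Integrable.mono' ((integrable_exp_neg_mul_abs' (c := 1 / 2) (by norm_num)).const_mul
    (((sectConst ω) ^ 2)⁻¹ * (2 + (|a| + ‖c‖)))) ?_ (Eventually.of_forall fun x => ?_)
  · refine Continuous.aestronglyMeasurable ?_
    exact (continuous_comp_line hωπ.le (bumpFun_mem_Hinf h0.le hωπ).1 ha).mul (by fun_prop)
  · have h1 := (norm_bumpFun_exp_le h0.le hωπ ha x).trans (mul_le_mul_of_nonneg_left
      (exp_div_sq_le x) (by positivity))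
    have h2 : ‖(x + a * Complex.I - c : ℂ)‖ ≤ |x| + (|a| + ‖c‖) := by
      refine (norm_sub_le _ _).trans ?_
      rw [← add_assoc]
      refine add_le_add_left ((norm_add_le _ _).trans ?_) _
      simp
    have h3 : Real.exp (-|x|) * (|x| + (|a| + ‖c‖)) ≤
        (2 + (|a| + ‖c‖)) * Real.exp (-(1 / 2 * |x|)) := by
      have h4 : Real.exp (-|x|) = Real.exp (-(1 / 2 * |x|)) * Real.exp (-(1 / 2 * |x|)) := by
        rw [← Real.exp_add]; congr 1; ring
      have h5 : (1 / 2 * |x|) * Real.exp (-(1 / 2 * |x|)) ≤ 1 := by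
        rw [Real.exp_neg, ← div_eq_mul_inv, div_le_one (Real.exp_pos _)]
        linarith [Real.add_one_le_exp (1 / 2 * |x|)]
      have h6 : Real.exp (-(1 / 2 * |x|)) ≤ 1 := Real.exp_le_one_iff.2 (by
        have := abs_nonneg x; linarith)
      have h7 := Real.exp_pos (-(1 / 2 * |x|))
      rw [h4, mul_assoc, mul_comm]
      refine mul_le_mul_of_nonneg_right ?_ h7.le
      have h8 : 0 ≤ |a| + ‖c‖ := by positivity
      nlinarith
    rw [norm_mul]
    calc _ ≤ (((sectConst ω) ^ 2)⁻¹ * Real.exp (-|x|)) * (|x| + (|a| + ‖c‖)) := by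
          refine mul_le_mul h1 h2 (norm_nonneg _) (by positivity)
      _ = ((sectConst ω) ^ 2)⁻¹ * (Real.exp (-|x|) * (|x| + (|a| + ‖c‖))) := by ring
      _ ≤ _ := by
          rw [mul_assoc]
          exact mul_le_mul_of_nonneg_left h3 (by positivity)

theorem integral_bumpFun_mul_line_eq (hωπ : ω < Real.pi) {δ : ℝ} (h0 : 0 ≤ δ) (hδ : δ < ω)
    (c : ℂ) : ∫ x : ℝ, bumpFun (Complex.exp (x + (-δ : ℝ) * Complex.I)) *
        (x + (-δ : ℝ) * Complex.I - c) =
      ∫ x : ℝ, bumpFun (Complex.exp (x + δ * Complex.I)) * (x + δ * Complex.I - c) := by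
  refine integral_line_eq (G := fun w => bumpFun (Complex.exp w) * (w - c)) (by linarith)
    (C := 1 + (δ + ‖c‖)) (fun w hw => ?_) (fun w hw hre => ?_)
    (integrable_bumpFun_mul_line hωπ (by rwa [abs_neg, abs_of_nonneg h0]) c)
    (integrable_bumpFun_mul_line hωπ (by rwa [abs_of_nonneg h0]) c)
  · have h1 : |w.im| < Real.pi := (abs_le.2 ⟨hw.1, hw.2⟩).trans_lt (hδ.trans hωπ)
    exact ((differentiableAt_bumpFun (one_add_cexp_ne_zero h1)).comp w
      Complex.differentiableAt_exp).mul (by fun_prop)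
  · have h1 : w.re ≠ 0 := by
      intro h; rw [h, abs_zero] at hre; linarith
    have h2 : ‖w - c‖ ≤ |w.re| + (δ + ‖c‖) := by
      refine (norm_sub_le _ _).trans ?_
      rw [← add_assoc]
      refine add_le_add_left ((Complex.norm_le_abs_re_add_abs_im w).trans ?_) _
      exact add_le_add_right (abs_le.2 hw) _
    rw [norm_mul]
    refine (mul_le_mul (norm_bumpFun_exp_le_inv_sq h1) h2 (norm_nonneg _) (by positivity)).trans ?_
    rw [inv_mul_eq_div, div_le_iff₀ (by positivity), ← sq_abs]
    have h3 : 0 ≤ δ + ‖c‖ := by positivity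
    nlinarith [mul_nonneg h3 (sub_nonneg.2 hre)]

variable {X : Type*} [NormedAddCommGroup X] [NormedSpace ℂ X] [CompleteSpace X]
  {A : X →ₗ.[ℂ] X}

/-- The function `z / (1 + z) ^ 2` is sent to `A (1 + A)⁻²`. The integrand is holomorphic in the
strip `δ ≤ Im w ≤ 2π - δ` of the coordinate `w = log z` apart from a double pole at `iπ`. After
subtraction of its principal part, times the scalar kernel, Cauchy's theorem applies; the integral
of `(w - iπ) e ^ w / (1 + e ^ w) ^ 2` increases by `2πi` from one boundary line to the other. -/
theorem IsSectorial.cauchyInt_bumpFun (hA : IsSectorial A) (hωπ : ω < Real.pi) {δ : ℝ}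
    (h1 : sectAngle A < δ) (h2 : δ < ω) :
    cauchyInt A δ bumpFun = stieltjesRes A 1 - stieltjesRes A 1 * stieltjesRes A 1 := by
  have hp0 := sectAngle_nonneg A
  have hp : 0 < δ := hp0.trans_lt h1
  have habs : |δ| = δ := abs_of_pos hp
  have habs' : |(-δ)| = δ := by rw [abs_neg, habs]
  set w₀ : ℂ := Real.pi * Complex.I with hw₀
  have hw₀im : w₀.im = Real.pi := by simp [hw₀]
  set D : Set ℂ := {w : ℂ | sectAngle A < w.im ∧ w.im < 2 * Real.pi - sectAngle A} with hD
  have hDo : IsOpen D := (isOpen_lt continuous_const Complex.continuous_im).inter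
    (isOpen_lt Complex.continuous_im continuous_const)
  have hwD : w₀ ∈ D := by
    rw [hD, mem_ofPred_eq, hw₀im]
    constructor <;> linarith
  set K₀ := stieltjesRes A 1 with hK₀
  have hK : expRes A w₀ = K₀ := hA.expRes_pi
  set K₁ := K₀ - K₀ * K₀ with hK₁
  have hd1 : deriv (expRes A) w₀ = K₁ := by
    rw [(hA.hasDerivAt_expRes hwD.1 hwD.2).deriv, hK]
  have hdiff : DifferentiableOn ℂ (expRes A) D := fun w hw =>
    (hA.hasDerivAt_expRes hw.1 hw.2).differentiableAt.differentiableWithinAt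
  set φ : ℂ → X →L[ℂ] X := dslope (dslope (expRes A) w₀) w₀ with hφ
  have hφd : DifferentiableOn ℂ φ D :=
    (Complex.differentiableOn_dslope (hDo.mem_nhds hwD)).2
      ((Complex.differentiableOn_dslope (hDo.mem_nhds hwD)).2 hdiff)
  have hφe : ∀ w, (w - w₀) • ((w - w₀) • φ w) = expRes A w - K₀ - (w - w₀) • K₁ := by
    intro w
    rw [hφ, sub_smul_dslope, smul_sub, sub_smul_dslope, dslope_same, hd1, hK]
  -- `1 + e ^ w = (w - iπ) σ(w)` with `σ` entire and without zeros in the strip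
  set σ : ℂ → ℂ := dslope (fun w => 1 + Complex.exp w) w₀ with hσ
  have hσd : DifferentiableOn ℂ σ univ :=
    (Complex.differentiableOn_dslope univ_mem).2 (by fun_prop)
  have hexp₀ : Complex.exp w₀ = -1 := Complex.exp_pi_mul_I
  have hσe : ∀ w, (w - w₀) * σ w = 1 + Complex.exp w := by
    intro w
    have := sub_smul_dslope (fun w => 1 + Complex.exp w) w₀ w
    simp only [hexp₀, smul_eq_mul] at this
    rw [hσ, this]
    ring
  have hσ0 : ∀ w ∈ D, σ w ≠ 0 := by
    intro w hw h
    rcases eq_or_ne w w₀ with h0 | hne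
    · rw [h0, hσ, dslope_same] at h
      have h3 : HasDerivAt (fun w => 1 + Complex.exp w) (Complex.exp w₀) w₀ :=
        (Complex.hasDerivAt_exp w₀).const_add 1
      rw [h3.deriv] at h
      exact Complex.exp_ne_zero _ h
    · have h3 := hσe w
      rw [h, mul_zero] at h3
      have h4 : Complex.exp (w - w₀) = 1 := by
        rw [Complex.exp_sub, hexp₀, ← eq_neg_of_add_eq_zero_right h3.symm,
          div_self (Complex.exp_ne_zero _)]
      obtain ⟨n, hn⟩ := Complex.exp_eq_one_iff.1 h4
      have h5 := congrArg Complex.im hn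
      simp [hw₀im] at h5
      have h6 := hw.1
      have h7 := hw.2
      have hpi := Real.pi_pos
      have h8 : (n : ℝ) < 1 := by nlinarith
      have h9 : (-1 : ℝ) < n := by nlinarith
      have h10 : n = 0 := by
        have a1 : n < 1 := by exact_mod_cast h8
        have a2 : -1 < n := by exact_mod_cast h9
        omega
      rw [h10] at hn
      simp at hn
      exact hne (sub_eq_zero.1 hn)
  set G : ℂ → X →L[ℂ] X := fun w => (Complex.exp w / σ w ^ 2) • φ w with hG
  have hGe : ∀ w ∈ D, w ≠ w₀ → G w = bumpFun (Complex.exp w) • expRes A w -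
      bumpFun (Complex.exp w) • K₀ - (bumpFun (Complex.exp w) * (w - w₀)) • K₁ := by
    intro w hw hne
    have h3 : w - w₀ ≠ 0 := sub_ne_zero.2 hne
    have h4 : 1 + Complex.exp w ≠ 0 := by
      rw [← hσe]
      exact mul_ne_zero h3 (hσ0 w hw)
    have h5 : bumpFun (Complex.exp w) * ((w - w₀) * (w - w₀)) = Complex.exp w / σ w ^ 2 := by
      have := hσ0 w hw
      rw [bumpFun_eq h4, ← hσe]
      field_simp
    rw [hG]
    simp only
    rw [← h5, mul_smul, mul_smul, hφe]
    module
  obtain ⟨C, hC0, hC⟩ := hA.exists_expRes_bound h1 (h2.trans hωπ)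
  have hmemD : ∀ w : ℂ, w.im ∈ Icc δ (2 * Real.pi - δ) → w ∈ D := fun w hw =>
    ⟨h1.trans_le hw.1, hw.2.trans_lt (by linarith)⟩
  have hne1 : ∀ x : ℝ, (x + δ * Complex.I : ℂ) ≠ w₀ := by
    intro x h
    have := congrArg Complex.im h
    rw [hw₀im] at this
    simp at this
    linarith
  have hne2 : ∀ x : ℝ, (x + (2 * Real.pi - δ : ℝ) * Complex.I : ℂ) ≠ w₀ := by
    intro x h
    have := congrArg Complex.im h
    rw [hw₀im] at this
    simp at this
    linarith
  have hD1 : ∀ x : ℝ, (x + δ * Complex.I : ℂ) ∈ D := fun x =>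
    hmemD _ (by simp; linarith)
  have hD2 : ∀ x : ℝ, (x + (2 * Real.pi - δ : ℝ) * Complex.I : ℂ) ∈ D := fun x =>
    hmemD _ (by simp; linarith)
  have hb := bumpFun_mem_elemFun (hp.trans h2).le hωπ
  have hi0 : ∀ η : ℝ, |η| < ω → Integrable (fun x : ℝ =>
      bumpFun (Complex.exp (x + η * Complex.I))) := ((mem_elemFun_iff hωπ.le).1 hb).2
  -- on the upper line, use periodicity to return to the angle `-δ`
  have hper : ∀ x : ℝ, (x + (2 * Real.pi - δ : ℝ) * Complex.I : ℂ) =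
      (x + (-δ : ℝ) * Complex.I) + 2 * Real.pi * Complex.I := by
    intro x
    push_cast
    ring
  have hG1 : ∀ x : ℝ, G (x + δ * Complex.I) =
      bumpFun (Complex.exp (x + δ * Complex.I)) • expRes A (x + δ * Complex.I) -
      bumpFun (Complex.exp (x + δ * Complex.I)) • K₀ -
      (bumpFun (Complex.exp (x + δ * Complex.I)) * (x + δ * Complex.I - w₀)) • K₁ :=
    fun x => hGe _ (hD1 x) (hne1 x)
  have hG2 : ∀ x : ℝ, G (x + (2 * Real.pi - δ : ℝ) * Complex.I) =
      bumpFun (Complex.exp (x + (-δ : ℝ) * Complex.I)) • expRes A (x + (-δ : ℝ) * Complex.I) -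
      bumpFun (Complex.exp (x + (-δ : ℝ) * Complex.I)) • K₀ -
      (bumpFun (Complex.exp (x + (-δ : ℝ) * Complex.I)) *
        (x + (-δ : ℝ) * Complex.I - (w₀ - 2 * Real.pi * Complex.I))) • K₁ := by
    intro x
    have h3 : (x + (-δ : ℝ) * Complex.I : ℂ) + 2 * Real.pi * Complex.I - w₀ =
        x + (-δ : ℝ) * Complex.I - (w₀ - 2 * Real.pi * Complex.I) := by ring
    rw [hGe _ (hD2 x) (hne2 x), hper, expRes_add_two_pi, Complex.exp_periodic, h3]
  have j1 := hA.integrable_line hωπ (δ := δ) (by rwa [habs]) (by rwa [habs]) hb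
  have j2 := hA.integrable_line hωπ (δ := -δ) (by rwa [habs']) (by rwa [habs']) hb
  have j3 := (hi0 δ (by rwa [habs])).smul_const K₀
  have j4 := (hi0 (-δ) (by rwa [habs'])).smul_const K₀
  have j5 := (integrable_bumpFun_mul_line hωπ (a := δ) (by rwa [habs]) w₀).smul_const K₁
  have j6 := (integrable_bumpFun_mul_line hωπ (a := -δ) (by rwa [habs'])
    (w₀ - 2 * Real.pi * Complex.I)).smul_const K₁
  have hline : ∫ x : ℝ, G (x + δ * Complex.I) =
      ∫ x : ℝ, G (x + (2 * Real.pi - δ : ℝ) * Complex.I) := by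
    refine integral_line_eq (C := (C + ‖K₀‖) + (1 + 3 * Real.pi) * ‖K₁‖) (by linarith)
      (fun w hw => ?_) (fun w hw hre => ?_) ?_ ?_
    · have hw' := hmemD w hw
      have h3 : DifferentiableAt ℂ σ w := (hσd w (mem_univ w)).differentiableAt univ_mem
      have h4 : DifferentiableAt ℂ φ w := (hφd w hw').differentiableAt (hDo.mem_nhds hw')
      exact DifferentiableAt.smul (DifferentiableAt.div (by fun_prop) (h3.pow 2)
        (pow_ne_zero 2 (hσ0 w hw'))) h4
    · have hre0 : w.re ≠ 0 := by
        intro h; rw [h, abs_zero] at hre; linarith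
      have hne : w ≠ w₀ := by
        rintro rfl
        exact hre0 (by simp [hw₀])
      have h3 := norm_bumpFun_exp_le_inv_sq hre0
      have h4 : ‖bumpFun (Complex.exp w)‖ ≤ 1 := h3.trans (inv_le_one_of_one_le₀ (by
        rw [← sq_abs]; nlinarith))
      have h5 : ‖bumpFun (Complex.exp w) * (w - w₀)‖ ≤ 1 + 3 * Real.pi := by
        have h6 : ‖w - w₀‖ ≤ |w.re| + 3 * Real.pi := by
          refine (norm_sub_le _ _).trans ?_
          have h7 : ‖w₀‖ = Real.pi := by simp [hw₀, abs_of_pos Real.pi_pos]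
          have h8 := Complex.norm_le_abs_re_add_abs_im w
          have h9 : |w.im| ≤ 2 * Real.pi := by
            rw [abs_of_nonneg (hp.le.trans hw.1)]
            linarith [hw.2]
          linarith
        rw [norm_mul]
        refine (mul_le_mul h3 h6 (norm_nonneg _) (by positivity)).trans ?_
        rw [inv_mul_eq_div, div_le_iff₀ (by positivity), ← sq_abs]
        nlinarith [mul_nonneg (mul_nonneg (by norm_num : (0 : ℝ) ≤ 3) Real.pi_pos.le)
          (sub_nonneg.2 hre), Real.pi_pos]
      rw [hGe w (hmemD w hw) hne]
      refine (norm_sub_le _ _).trans (add_le_add ((norm_sub_le _ _).trans (add_le_add ?_ ?_)) ?_)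
      · rw [norm_smul]
        exact (mul_le_mul h4 (hC w hw.1 hw.2) (norm_nonneg _) zero_le_one).trans_eq (one_mul C)
      · rw [norm_smul]
        exact (mul_le_mul_of_nonneg_right h4 (norm_nonneg _)).trans_eq (one_mul _)
      · rw [norm_smul]
        exact mul_le_mul_of_nonneg_right h5 (norm_nonneg _)
    · simp only [hG1]
      exact (j1.sub j3).sub j5
    · simp only [hG2]
      exact (j2.sub j4).sub j6
  simp only [hG1, hG2] at hline
  have hsub : ∀ {f g h : ℝ → X →L[ℂ] X}, Integrable f → Integrable g → Integrable h →
      ∫ x, (f x - g x - h x) = (∫ x, f x) - (∫ x, g x) - ∫ x, h x := fun hf hg hh =>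
    (integral_sub (hf.sub hg) hh).trans (congrArg (· - _) (integral_sub hf hg))
  rw [hsub j1 j3 j5, hsub j2 j4 j6, integral_smul_const, integral_smul_const, integral_smul_const,
    integral_smul_const, integral_bumpFun_line hωπ (by rwa [habs]),
    integral_bumpFun_line hωπ (by rwa [habs'])] at hline
  have hres : ∫ x : ℝ, bumpFun (Complex.exp (x + (-δ : ℝ) * Complex.I)) *
        (x + (-δ : ℝ) * Complex.I - (w₀ - 2 * Real.pi * Complex.I)) =
      (∫ x : ℝ, bumpFun (Complex.exp (x + δ * Complex.I)) * (x + δ * Complex.I - w₀)) +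
        2 * Real.pi * Complex.I := by
    rw [← integral_bumpFun_mul_line_eq hωπ hp.le h2 w₀]
    have h3 : (2 * Real.pi * Complex.I : ℂ) = ∫ x : ℝ,
        bumpFun (Complex.exp (x + (-δ : ℝ) * Complex.I)) * (2 * Real.pi * Complex.I) := by
      rw [integral_mul_const, integral_bumpFun_line hωπ (by rwa [habs']), one_mul]
    nth_rewrite 2 [h3]
    rw [← integral_add (integrable_bumpFun_mul_line hωπ (by rwa [habs']) w₀)
      ((hi0 (-δ) (by rwa [habs'])).mul_const _)]
    congr 1
    funext x
    ring
  rw [hres] at hline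
  have hfin : lineInt A (-δ) bumpFun - lineInt A δ bumpFun =
      (2 * Real.pi * Complex.I : ℂ) • K₁ := by
    rw [lineInt, lineInt]
    rw [add_smul, sub_sub, sub_sub, sub_eq_iff_eq_add] at hline
    rw [hline]
    abel
  rw [cauchyInt_eq_lineInt, hfin, inv_smul_smul₀]
  exact Complex.two_pi_I_ne_zero

end Normalisation

/-! ### The elementary calculus as a multiplicative graph -/

section Germs

theorem germ_congr {ω : ℝ} {f g : ℂ → ℂ} (h : EqOn f g (sector ω)) : germ ω f = germ ω g :=
  Filter.Germ.coe_eq.2 (mem_of_superset (Filter.self_mem_codiscreteWithin _) h)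

theorem eqOn_of_germ_eq {ω : ℝ} {f g : ℂ → ℂ} (hf : ContinuousOn f (sector ω))
    (hg : ContinuousOn g (sector ω)) (h : germ ω f = germ ω g) : EqOn f g (sector ω) := by
  intro z hz
  have hS := (isOpen_sector ω).mem_nhds hz
  have h1 := mem_codiscreteWithin_iff_forall_mem_nhdsNE.1 (Filter.Germ.coe_eq.1 h) z hz
  have h2 : f =ᶠ[𝓝[≠] z] g := by
    filter_upwards [h1, nhdsWithin_le_nhds hS] with y hy hyS
    exact hy.resolve_right fun h => h hyS
  have hf' : Tendsto f (𝓝[≠] z) (𝓝 (f z)) :=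
    ((hf z hz).continuousAt hS).tendsto.mono_left nhdsWithin_le_nhds
  have hg' : Tendsto g (𝓝[≠] z) (𝓝 (g z)) :=
    ((hg z hz).continuousAt hS).tendsto.mono_left nhdsWithin_le_nhds
  exact tendsto_nhds_unique (hf'.congr' h2) hg'

theorem sector_mono {ω ω' : ℝ} (h : ω ≤ ω') : sector ω ⊆ sector ω' :=
  fun _ hz => ⟨hz.1, hz.2.trans_le h⟩

theorem germ_eq_of_le {ω ω' : ℝ} (h : ω ≤ ω') {f g : ℂ → ℂ} (hfg : germ ω' f = germ ω' g) :
    germ ω f = germ ω g :=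
  Filter.Germ.coe_eq.2 (Filter.codiscreteWithin_mono (sector_mono h) (Filter.Germ.coe_eq.1 hfg))

theorem germ_mem_mer {ω : ℝ} {f : ℂ → ℂ} (hf : DifferentiableOn ℂ f (sector ω)) :
    germ ω f ∈ mer ω :=
  ⟨f, (hf.analyticOnNhd (isOpen_sector ω)).meromorphicOn, rfl⟩

theorem elemFun_congr {ω : ℝ} (hωπ : ω ≤ Real.pi) {f g : ℂ → ℂ} (h : EqOn f g (sector ω))
    (hf : f ∈ elemFun ω) : g ∈ elemFun ω := by
  rw [mem_elemFun_iff hωπ] at *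
  refine ⟨⟨hf.1.1.congr fun z hz => (h hz).symm, ?_⟩, fun δ hδ => ?_⟩
  · obtain ⟨C, hC⟩ := hf.1.2
    exact ⟨C, fun z hz => h hz ▸ hC z hz⟩
  · exact (hf.2 δ hδ).congr (Eventually.of_forall fun x => h (line_mem_sector hωπ hδ x))

end Germs

section Graph

variable {X : Type*} [NormedAddCommGroup X] [NormedSpace ℂ X]
  {A : X →ₗ.[ℂ] X} {ω δ : ℝ}

theorem inv_one_add_eq_resFun (z : ℂ) : (1 + z)⁻¹ = resFun 1 z := by
  rw [resFun, Complex.ofReal_one, one_mul]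

theorem IsSectorial.mem_elemGraph_iff (hA : IsSectorial A) (hωπ : ω < Real.pi)
    (h1 : sectAngle A < δ) (h2 : δ < ω) {F : SGerm ω} {T : X →L[ℂ] X} :
    (F, T) ∈ elemGraph A ω ↔ ∃ f ∈ elemFun ω, ∃ c d : ℂ,
      F = germ ω (fun z => f z + c + d * resFun 1 z) ∧
      T = cauchyInt A δ f + c • 1 + d • stieltjesRes A 1 := by
  simp only [elemGraph, mem_ofPred_eq, inv_one_add_eq_resFun, ← stieltjesRes_one]
  constructor
  · rintro ⟨f, hf, c, d, η, h3, h4, rfl, rfl⟩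
    exact ⟨f, hf, c, d, rfl, by rw [hA.cauchyInt_eq hωπ h1 h2 h3 h4 hf]⟩
  · rintro ⟨f, hf, c, d, rfl, rfl⟩
    exact ⟨f, hf, c, d, δ, h1, h2, rfl, rfl⟩

theorem elem_form_mem_Hinf (h0 : 0 ≤ ω) (hωπ : ω < Real.pi) {f : ℂ → ℂ} (hf : f ∈ elemFun ω)
    (c d : ℂ) : (fun z => f z + c + d * resFun 1 z) ∈ Hinf ω :=
  add_mem_Hinf (add_mem_Hinf hf.1 (const_mem_Hinf c))
    (mul_mem_Hinf (const_mem_Hinf d) (resFun_mem_Hinf h0 hωπ zero_le_one))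

theorem tendsto_resFun_exp_atBot (s : ℝ) :
    Tendsto (fun x : ℝ => resFun s (Complex.exp (x + (0 : ℝ) * Complex.I))) atBot (𝓝 1) := by
  have h : Tendsto (fun x : ℝ => ((Real.exp x : ℝ) : ℂ)) atBot (𝓝 ((0 : ℝ) : ℂ)) :=
    (Complex.continuous_ofReal.tendsto 0).comp Real.tendsto_exp_atBot
  have h2 := ((h.const_mul (s : ℂ)).const_add 1).inv₀ (by simp)
  simpa [resFun] using h2

theorem tendsto_resFun_exp_atTop :
    Tendsto (fun x : ℝ => resFun 1 (Complex.exp (x + (0 : ℝ) * Complex.I))) atTop (𝓝 0) := by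
  have h : Tendsto (fun x : ℝ => (1 + Real.exp x)⁻¹) atTop (𝓝 0) :=
    (tendsto_atTop_add_const_left _ (1 : ℝ) Real.tendsto_exp_atTop).inv_tendsto_atTop
  have h2 := (Complex.continuous_ofReal.tendsto 0).comp h
  simpa [resFun, Function.comp_def] using h2

/-- The constants in `f + c + d (1 + z)⁻¹` are determined by the limits at `0` and at infinity. -/
theorem elem_form_unique (h0 : 0 < ω) (hωπ : ω < Real.pi) {f : ℂ → ℂ} (hf : f ∈ elemFun ω)
    {c d : ℂ} (h : ∀ z ∈ sector ω, f z + c + d * resFun 1 z = 0) : c = 0 ∧ d = 0 := by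
  have hu := ((mem_elemFun_iff hωπ.le).1 hf).2 0 (by simpa using h0)
  have he : ∀ x : ℝ, -(c + d * resFun 1 (Complex.exp (x + (0 : ℝ) * Complex.I))) =
      f (Complex.exp (x + (0 : ℝ) * Complex.I)) := by
    intro x
    have := h _ (line_mem_sector hωπ.le (δ := 0) (by simpa using h0) x)
    linear_combination -this
  have h1 := (((tendsto_resFun_exp_atTop).const_mul d).const_add c).neg
  have h2 := (((tendsto_resFun_exp_atBot 1).const_mul d).const_add c).neg
  simp only [he] at h1 h2
  have h3 := eq_zero_of_tendsto_of_integrable hu (Or.inl rfl) h1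
  have h4 := eq_zero_of_tendsto_of_integrable hu (Or.inr rfl) h2
  have hc : c = 0 := by linear_combination -h3
  exact ⟨hc, by linear_combination -h4 - hc⟩

theorem IsSectorial.elemGraph_unique (hA : IsSectorial A) (hω : sectAngle A < ω)
    (hωπ : ω < Real.pi) {F : SGerm ω} {T T' : X →L[ℂ] X} (h : (F, T) ∈ elemGraph A ω)
    (h' : (F, T') ∈ elemGraph A ω) : T = T' := by
  obtain ⟨δ, h1, h2⟩ := exists_between hω
  have h0 := (sectAngle_nonneg A).trans_lt hω
  obtain ⟨f, hf, c, d, rfl, rfl⟩ := (hA.mem_elemGraph_iff hωπ h1 h2).1 h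
  obtain ⟨f', hf', c', d', he, rfl⟩ := (hA.mem_elemGraph_iff hωπ h1 h2).1 h'
  have heq := eqOn_of_germ_eq (elem_form_mem_Hinf h0.le hωπ hf c d).1.continuousOn
    (elem_form_mem_Hinf h0.le hωπ hf' c' d').1.continuousOn he
  have h3 := elem_form_unique h0 hωπ (add_mem_elemFun hωπ.le hf
    (mul_mem_elemFun hωπ.le (const_mem_Hinf (-1)) hf')) (c := c - c') (d := d - d')
    (fun z hz => by
      have := heq hz
      simp only at this
      linear_combination this)
  have hc : c = c' := sub_eq_zero.1 h3.1
  have hd : d = d' := sub_eq_zero.1 h3.2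
  subst hc hd
  have h4 : EqOn f f' (sector ω) := fun z hz => by
    have := heq hz
    simp only at this
    linear_combination this
  rw [cauchyInt_congr hωπ.le (by
    rwa [abs_of_nonneg ((sectAngle_nonneg A).trans h1.le)]) h4]

theorem IsSectorial.elemGraph_of_elemFun (hA : IsSectorial A)
    (hωπ : ω < Real.pi) (h1 : sectAngle A < δ) (h2 : δ < ω) {f : ℂ → ℂ} (hf : f ∈ elemFun ω) :
    (germ ω f, cauchyInt A δ f) ∈ elemGraph A ω :=
  (hA.mem_elemGraph_iff hωπ h1 h2).2 ⟨f, hf, 0, 0, by simp, by simp⟩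

theorem IsSectorial.elemGraph_add (hA : IsSectorial A) (hω : sectAngle A < ω)
    (hωπ : ω < Real.pi) {F G : SGerm ω} {T S : X →L[ℂ] X} (hF : (F, T) ∈ elemGraph A ω)
    (hG : (G, S) ∈ elemGraph A ω) : (F + G, T + S) ∈ elemGraph A ω := by
  obtain ⟨δ, h1, h2⟩ := exists_between hω
  obtain ⟨f, hf, c, d, rfl, rfl⟩ := (hA.mem_elemGraph_iff hωπ h1 h2).1 hF
  obtain ⟨f', hf', c', d', rfl, rfl⟩ := (hA.mem_elemGraph_iff hωπ h1 h2).1 hG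
  refine (hA.mem_elemGraph_iff hωπ h1 h2).2 ⟨fun z => f z + f' z, add_mem_elemFun hωπ.le hf hf',
    c + c', d + d', ?_, ?_⟩
  · refine germ_congr (f := fun z => (f z + c + d * resFun 1 z) + (f' z + c' + d' * resFun 1 z))
      fun z _ => ?_
    ring
  · rw [hA.cauchyInt_add hωπ h1 h2 hf hf']
    module

theorem IsSectorial.elemGraph_const_mul (hA : IsSectorial A) (hω : sectAngle A < ω)
    (hωπ : ω < Real.pi) (a : ℂ) {F : SGerm ω} {T : X →L[ℂ] X} (hF : (F, T) ∈ elemGraph A ω) :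
    (germ ω (fun _ => a) * F, a • T) ∈ elemGraph A ω := by
  obtain ⟨δ, h1, h2⟩ := exists_between hω
  obtain ⟨f, hf, c, d, rfl, rfl⟩ := (hA.mem_elemGraph_iff hωπ h1 h2).1 hF
  refine (hA.mem_elemGraph_iff hωπ h1 h2).2 ⟨fun z => a * f z,
    mul_mem_elemFun hωπ.le (const_mem_Hinf a) hf, a * c, a * d, ?_, ?_⟩
  · refine germ_congr (f := fun z => a * (f z + c + d * resFun 1 z)) fun z _ => ?_
    ring
  · rw [cauchyInt_const_mul]
    module

theorem IsSectorial.elemGraph_one (hA : IsSectorial A) (hω : sectAngle A < ω)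
    (hωπ : ω < Real.pi) : ((1 : SGerm ω), (1 : X →L[ℂ] X)) ∈ elemGraph A ω := by
  obtain ⟨δ, h1, h2⟩ := exists_between hω
  refine (hA.mem_elemGraph_iff hωπ h1 h2).2 ⟨fun _ => 0, zero_mem_elemFun hωπ.le, 1, 0, ?_, ?_⟩
  · refine germ_congr (f := fun _ => 1) fun z _ => ?_
    simp
  · have := cauchyInt_const_mul (A := A) δ 0 (fun _ => 0)
    simp only [zero_mul, zero_smul] at this
    rw [this]
    simp

variable [CompleteSpace X]

/-- The Cauchy integral of `(1 + s z)⁻¹ - (1 + z)⁻¹`. After multiplication by the injective operator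
`(1 + A)⁻¹` it becomes the integral of `(1 - s) (1 + s z)⁻¹ z / (1 + z) ^ 2`. -/
theorem IsSectorial.cauchyInt_resFun_sub (hA : IsSectorial A) (hω : sectAngle A < ω)
    (hωπ : ω < Real.pi) (h1 : sectAngle A < δ) (h2 : δ < ω) {s : ℝ≥0} (hs : s ≠ 0) :
    cauchyInt A δ (fun z => resFun s z - resFun 1 z) = stieltjesRes A s - stieltjesRes A 1 := by
  have h0 := (sectAngle_nonneg A).trans hω.le
  have habs : |δ| < ω := by rwa [abs_of_nonneg ((sectAngle_nonneg A).trans h1.le)]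
  have hmem := resFun_sub_mem_elemFun h0 hωπ (s := s) (by positivity)
  have hb := bumpFun_mem_elemFun h0 hωπ
  have e1 := hA.stieltjesRes_mul_cauchyInt hω hωπ 1 h1 h2 hmem
  have e2 : cauchyInt A δ (fun z => resFun (1 : ℝ≥0) z * (resFun s z - resFun 1 z)) =
      (1 - ((s : ℝ) : ℂ)) • (stieltjesRes A s * (stieltjesRes A 1 -
        stieltjesRes A 1 * stieltjesRes A 1)) := by
    rw [← hA.cauchyInt_bumpFun hωπ h1 h2, hA.stieltjesRes_mul_cauchyInt hω hωπ s h1 h2 hb,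
      ← cauchyInt_const_mul]
    refine cauchyInt_congr hωπ.le habs fun z hz => ?_
    have h4 := one_add_mul_ne_zero h0 hωπ (mem_insert_of_mem 0 hz) s.coe_nonneg
    have h5 := one_add_mul_ne_zero h0 hωπ (mem_insert_of_mem 0 hz) zero_le_one
    rw [Complex.ofReal_one, one_mul] at h5
    simp only [bumpFun_eq h5, resFun, NNReal.coe_one, Complex.ofReal_one, one_mul]
    have hr := inv_mul_cancel₀ h4
    generalize (1 + ((s : ℝ) : ℂ) * z)⁻¹ = r at hr ⊢
    field_simp
    linear_combination hr
  have e3 := hA.stieltjesRes_mul s 1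
  have e4 : stieltjesRes A 1 * (stieltjesRes A s - stieltjesRes A 1) =
      (1 - ((s : ℝ) : ℂ)) • (stieltjesRes A s * (stieltjesRes A 1 -
        stieltjesRes A 1 * stieltjesRes A 1)) := by
    simp only [NNReal.coe_one, Complex.ofReal_one, one_smul] at e3
    have e5 : (1 - ((s : ℝ) : ℂ)) • (stieltjesRes A s * (stieltjesRes A 1 * stieltjesRes A 1)) =
        (stieltjesRes A 1 - ((s : ℝ) : ℂ) • stieltjesRes A s) * stieltjesRes A 1 := by
      rw [← e3, smul_mul_assoc, mul_assoc]
    rw [mul_sub (stieltjesRes A s), smul_sub, e5, sub_mul, smul_mul_assoc, mul_sub,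
      hA.stieltjesRes_comm 1 s]
    module
  rw [e2, ← e4] at e1
  ext x
  have e6 := congrArg (fun T => T x) e1
  simp only [mul_apply_eq_comp] at e6
  rw [← sub_eq_zero]
  refine hA.stieltjesRes_injective (s := 1) ?_
  rw [map_sub, e6, sub_self]

theorem IsSectorial.elemGraph_resFun (hA : IsSectorial A) (hω : sectAngle A < ω)
    (hωπ : ω < Real.pi) (s : ℝ≥0) : (germ ω (resFun s), stieltjesRes A s) ∈ elemGraph A ω := by
  obtain ⟨δ, h1, h2⟩ := exists_between hω
  rcases eq_or_ne s 0 with rfl | hs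
  · rw [stieltjesRes_zero]
    have h3 : germ ω (resFun (0 : ℝ≥0)) = 1 :=
      germ_congr (g := fun _ => 1) fun z _ => by simp [resFun]
    rw [h3]
    exact hA.elemGraph_one hω hωπ
  · refine (hA.mem_elemGraph_iff hωπ h1 h2).2 ⟨_, resFun_sub_mem_elemFun
      ((sectAngle_nonneg A).trans hω.le) hωπ (s := s) (by positivity), 0, 1, ?_, ?_⟩
    · refine germ_congr fun z _ => ?_
      ring
    · rw [hA.cauchyInt_resFun_sub hω hωπ h1 h2 hs]
      module

theorem IsSectorial.elemGraph_bumpFun (hA : IsSectorial A) (hω : sectAngle A < ω)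
    (hωπ : ω < Real.pi) : (germ ω bumpFun, stieltjesRes A 1 - stieltjesRes A 1 * stieltjesRes A 1) ∈
      elemGraph A ω := by
  obtain ⟨δ, h1, h2⟩ := exists_between hω
  rw [← hA.cauchyInt_bumpFun hωπ h1 h2]
  exact hA.elemGraph_of_elemFun hωπ h1 h2
    (bumpFun_mem_elemFun ((sectAngle_nonneg A).trans hω.le) hωπ)

theorem IsSectorial.elemGraph_comm (hA : IsSectorial A) (hω : sectAngle A < ω)
    (hωπ : ω < Real.pi) (s : ℝ≥0) {F : SGerm ω} {T : X →L[ℂ] X} (hF : (F, T) ∈ elemGraph A ω) :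
    T * stieltjesRes A s = stieltjesRes A s * T := by
  obtain ⟨δ, h1, h2⟩ := exists_between hω
  obtain ⟨f, hf, c, d, rfl, rfl⟩ := (hA.mem_elemGraph_iff hωπ h1 h2).1 hF
  simp only [add_mul, mul_add, smul_mul_assoc, mul_smul_comm, one_mul, mul_one,
    hA.cauchyInt_comm hωπ s h1 h2 hf, hA.stieltjesRes_comm 1 s]

/-- The product of `(1 + z)⁻¹` and `(1 + s z)⁻¹` is elementary up to a multiple of `(1 + z)⁻¹`. -/
theorem IsSectorial.elemGraph_resFun_mul (hA : IsSectorial A) (hω : sectAngle A < ω)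
    (hωπ : ω < Real.pi) (s : ℝ≥0) : (germ ω (resFun (1 : ℝ≥0)) * germ ω (resFun s),
      stieltjesRes A 1 * stieltjesRes A s) ∈ elemGraph A ω := by
  obtain ⟨δ, h1, h2⟩ := exists_between hω
  have h0 := (sectAngle_nonneg A).trans hω.le
  rcases eq_or_ne s 0 with rfl | hs
  · have h3 : germ ω (resFun (0 : ℝ≥0)) = 1 :=
      germ_congr (g := fun _ => 1) fun z _ => by simp [resFun]
    rw [h3, mul_one, stieltjesRes_zero, mul_one]
    exact hA.elemGraph_resFun hω hωπ 1
  · have hmem := resFun_sub_mem_elemFun h0 hωπ (s := s) (by positivity)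
    have e1 := hA.elemGraph_of_elemFun hωπ h1 h2 (resFun_mul_mem_elemFun h0 hωπ 1 hmem)
    rw [← hA.stieltjesRes_mul_cauchyInt hω hωπ 1 h1 h2 hmem,
      hA.cauchyInt_resFun_sub hω hωπ h1 h2 hs] at e1
    have e2 := hA.elemGraph_add hω hωπ (hA.elemGraph_add hω hωπ e1 (hA.elemGraph_resFun hω hωπ 1))
      (hA.elemGraph_const_mul hω hωπ (-1) (hA.elemGraph_bumpFun hω hωπ))
    convert e2 using 2
    · refine germ_congr (f := fun z => resFun (1 : ℝ≥0) z * resFun s z)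
        (g := fun z => resFun (1 : ℝ≥0) z * (resFun s z - resFun 1 z) + resFun (1 : ℝ≥0) z +
          -1 * bumpFun z) fun z _ => ?_
      simp only [NNReal.coe_one, bumpFun]
      ring
    · rw [mul_sub]
      module

theorem IsSectorial.elemGraph_mul_resFun (hA : IsSectorial A) (hω : sectAngle A < ω)
    (hωπ : ω < Real.pi) (s : ℝ≥0) {F : SGerm ω} {T : X →L[ℂ] X} (hF : (F, T) ∈ elemGraph A ω) :
    (F * germ ω (resFun s), T * stieltjesRes A s) ∈ elemGraph A ω := by
  obtain ⟨δ, h1, h2⟩ := exists_between hω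
  have h0 := (sectAngle_nonneg A).trans hω.le
  obtain ⟨f, hf, c, d, rfl, rfl⟩ := (hA.mem_elemGraph_iff hωπ h1 h2).1 hF
  have e1 := hA.elemGraph_of_elemFun hωπ h1 h2 (resFun_mul_mem_elemFun h0 hωπ s hf)
  rw [← hA.stieltjesRes_mul_cauchyInt hω hωπ s h1 h2 hf, hA.cauchyInt_comm hωπ s h1 h2 hf] at e1
  have e2 := hA.elemGraph_add hω hωπ (hA.elemGraph_add hω hωπ e1
    (hA.elemGraph_const_mul hω hωπ c (hA.elemGraph_resFun hω hωπ s)))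
    (hA.elemGraph_const_mul hω hωπ d (hA.elemGraph_resFun_mul hω hωπ s))
  convert e2 using 2
  · refine germ_congr (f := fun z => (f z + c + d * resFun 1 z) * resFun s z)
      (g := fun z => resFun s z * f z + c * resFun s z +
        d * (resFun (1 : ℝ≥0) z * resFun s z)) fun z _ => ?_
    simp only [NNReal.coe_one]
    ring
  · simp only [add_mul, smul_mul_assoc, one_mul]

theorem IsSectorial.dom_elemGraph_mul (hA : IsSectorial A) (hω : sectAngle A < ω)
    (hωπ : ω < Real.pi) {F G : SGerm ω} (hF : F ∈ dom (elemGraph A ω))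
    (hG : G ∈ dom (elemGraph A ω)) : F * G ∈ dom (elemGraph A ω) := by
  obtain ⟨δ, h1, h2⟩ := exists_between hω
  have h0 := (sectAngle_nonneg A).trans hω.le
  obtain ⟨T, hF⟩ := hF
  obtain ⟨S, hG⟩ := hG
  obtain ⟨f, hf, c, d, rfl, -⟩ := (hA.mem_elemGraph_iff hωπ h1 h2).1 hF
  obtain ⟨g, hg, c', d', rfl, -⟩ := (hA.mem_elemGraph_iff hωπ h1 h2).1 hG
  have e1 := hA.elemGraph_of_elemFun hωπ h1 h2
    (mul_mem_elemFun hωπ.le (elem_form_mem_Hinf h0 hωπ hg c' d') hf)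
  have e2 := hA.elemGraph_add hω hωπ (hA.elemGraph_add hω hωπ e1
    (hA.elemGraph_const_mul hω hωπ c hG))
    (hA.elemGraph_const_mul hω hωπ d (hA.elemGraph_mul_resFun hω hωπ 1 hG))
  have e3 := germ_congr (ω := ω) (f := fun z => (f z + c + d * resFun 1 z) *
      (g z + c' + d' * resFun 1 z))
      (g := fun z => (g z + c' + d' * resFun 1 z) * f z + c * (g z + c' + d' * resFun 1 z) +
        d * ((g z + c' + d' * resFun 1 z) * resFun (1 : ℝ≥0) z)) fun z _ => by
    simp only [NNReal.coe_one]
    ring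
  exact (show germ ω _ * germ ω _ = _ from e3) ▸ (⟨_, e2⟩ : _ ∈ dom (elemGraph A ω))

end Graph

/-! ### Bounded elements of the sectorial calculus -/

section BoundedElements

variable {X : Type*} [NormedAddCommGroup X] [NormedSpace ℂ X]
  {A : X →ₗ.[ℂ] X} {ω δ : ℝ}

theorem tendsto_comp_exp_atBot {f : ℂ → ℂ} (hf : f ∈ HinfZero ω) :
    Tendsto (fun x : ℝ => f (Complex.exp (x + (0 : ℝ) * Complex.I))) atBot (𝓝 (f 0)) := by
  have h : Tendsto Real.exp atBot (𝓝[>] 0) :=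
    tendsto_nhdsWithin_iff.2 ⟨Real.tendsto_exp_atBot,
      Eventually.of_forall fun x => Real.exp_pos x⟩
  simpa [Function.comp_def] using hf.2.comp h

theorem HinfZero_congr (h0 : 0 < ω) {f g : ℂ → ℂ} (h : EqOn f g (insert 0 (sector ω)))
    (hf : f ∈ HinfZero ω) : g ∈ HinfZero ω := by
  obtain ⟨C, hC⟩ := hf.1.2
  refine ⟨⟨hf.1.1.congr fun z hz => (h (mem_insert_of_mem 0 hz)).symm, C, fun z hz =>
    h (mem_insert_of_mem 0 hz) ▸ hC z hz⟩, ?_⟩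
  rw [← h (mem_insert _ _)]
  refine hf.2.congr' ?_
  filter_upwards [self_mem_nhdsWithin] with t ht
  exact h (mem_insert_of_mem 0 (ofReal_mem_sector h0 ht))

theorem IsSectBounded.congr (h0 : 0 < ω) {f g : ℂ → ℂ} {T : X →L[ℂ] X}
    (hf : IsSectBounded A ω f T) (h : EqOn f g (insert 0 (sector ω))) :
    IsSectBounded A ω g T := by
  have h1 : germ ω f = germ ω g := germ_congr fun z hz => h (mem_insert_of_mem 0 hz)
  exact ⟨HinfZero_congr h0 h hf.1, h1 ▸ hf.2.1, h1 ▸ hf.2.2⟩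

theorem mem_isSectBounded_mul {f : ℂ → ℂ} {T : X →L[ℂ] X} (hf : IsSectBounded A ω f T)
    {F : SGerm ω} {U V : X →L[ℂ] X} (hF : (F, U) ∈ elemGraph A ω)
    (hFf : (F * germ ω f, V) ∈ elemGraph A ω) : V = U * T := by
  ext x
  have h : (x, T x) ∈ sectCalc A ω (germ ω f) := by
    rw [hf.2.2]
    rfl
  exact h F U V hF hFf

/-- `(E, R)` is a regulariser: a pair in the elementary calculus with injective `R` which commutes
with the calculus, whose multiplication preserves the calculus, and which maps the bounded functions
in the domain of the sectorial calculus to elementary ones. -/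
structure IsRegulariser (A : X →ₗ.[ℂ] X) (ω : ℝ) (E : SGerm ω) (R : X →L[ℂ] X) : Prop where
  mul_mem : ∀ F T, (F, T) ∈ elemGraph A ω → (F * E, T * R) ∈ elemGraph A ω
  comm : ∀ F T, (F, T) ∈ elemGraph A ω → T * R = R * T
  injective : ∀ x, R x = 0 → x = 0
  regular : ∀ f ∈ HinfZero ω, germ ω f ∈ sectDom A ω → E * germ ω f ∈ dom (elemGraph A ω)

variable [CompleteSpace X]

/-- If `A` has a nontrivial kernel then a function in the domain of the sectorial calculus is
integrable at `0` after subtraction of its limit: the elements of an anchor set cannot all vanish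
at `0`, since they act as multiplication by their limit at `0` on the kernel. -/
theorem IsSectorial.resFun_mul_sub_mem_elemFun (hA : IsSectorial A) (hω : sectAngle A < ω)
    (hωπ : ω < Real.pi) {k : X} (hk : stieltjesRes A 1 k = k) (hk0 : k ≠ 0) {f : ℂ → ℂ}
    (hf : f ∈ HinfZero ω) (hd : germ ω f ∈ sectDom A ω) :
    (fun z => resFun 1 z * (f z - f 0)) ∈ elemFun ω := by
  obtain ⟨δ, h1, h2⟩ := exists_between hω
  have h0 := (sectAngle_nonneg A).trans_lt hω
  obtain ⟨-, hanch⟩ := hd.2 1 ⟨1, hA.elemGraph_one hω hωπ⟩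
  have hex : ∃ e ∈ regs (elemGraph A ω) (1 * germ ω f), ∃ T, (e, T) ∈ elemGraph A ω ∧ T k ≠ 0 := by
    by_contra! hcon
    exact hk0 (hanch k hcon)
  obtain ⟨e, ⟨-, S, heS⟩, T, heT, hTk⟩ := hex
  obtain ⟨g, hg, c, d, rfl, rfl⟩ := (hA.mem_elemGraph_iff hωπ h1 h2).1 heT
  obtain ⟨g', hg', c', d', he, -⟩ := (hA.mem_elemGraph_iff hωπ h1 h2).1 heS
  have hTk' : (cauchyInt A δ g + c • 1 + d • stieltjesRes A 1) k = (c + d) • k := by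
    simp only [add_apply, smul_apply, hk, hA.cauchyInt_apply_of_fixed hωπ h1 h2 hg hk]
    simp [add_smul]
  have hcd : c + d ≠ 0 := fun h => hTk (by rw [hTk', h, zero_smul])
  have hF := elem_form_mem_Hinf h0.le hωπ hg c d
  have heq : EqOn (fun z => (g z + c + d * resFun 1 z) * f z)
      (fun z => g' z + c' + d' * resFun 1 z) (sector ω) :=
    eqOn_of_germ_eq (mul_mem_Hinf hF hf.1).1.continuousOn
      (elem_form_mem_Hinf h0.le hωπ hg' c' d').1.continuousOn (by rwa [one_mul] at he)
  have hr := resFun_mem_Hinf h0.le hωπ zero_le_one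
  have hm : (fun z => resFun 1 z * g' z + (-1 * (resFun 1 z * f z)) * g z +
      (d * f z + -d') * bumpFun z) ∈ elemFun ω :=
    add_mem_elemFun hωπ.le (add_mem_elemFun hωπ.le (mul_mem_elemFun hωπ.le hr hg')
      (mul_mem_elemFun hωπ.le (mul_mem_Hinf (const_mem_Hinf (-1)) (mul_mem_Hinf hr hf.1)) hg))
      (mul_mem_elemFun hωπ.le (add_mem_Hinf (mul_mem_Hinf (const_mem_Hinf d) hf.1)
        (const_mem_Hinf (-d'))) (bumpFun_mem_elemFun h0.le hωπ))
  have hm2 : (fun z => resFun 1 z * ((c + d) * f z - (c' + d'))) ∈ elemFun ω := by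
    refine elemFun_congr hωπ.le (fun z hz => ?_) hm
    have := heq hz
    simp only [bumpFun] at this ⊢
    linear_combination (- resFun 1 z) * this
  have hlim : Tendsto (fun x : ℝ => resFun 1 (Complex.exp (x + (0 : ℝ) * Complex.I)) *
      ((c + d) * f (Complex.exp (x + (0 : ℝ) * Complex.I)) - (c' + d'))) atBot
      (𝓝 (1 * ((c + d) * f 0 - (c' + d')))) :=
    (tendsto_resFun_exp_atBot 1).mul (((tendsto_comp_exp_atBot hf).const_mul _).sub_const _)
  have hL := eq_zero_of_tendsto_of_integrable (((mem_elemFun_iff hωπ.le).1 hm2).2 0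
    (by simpa using h0)) (Or.inr rfl) hlim
  refine elemFun_congr hωπ.le (fun z _ => ?_)
    (mul_mem_elemFun hωπ.le (const_mem_Hinf (c + d)⁻¹) hm2)
  field_simp
  linear_combination (resFun 1 z) * hL

/-- The function `(1 + z)⁻¹` is a regulariser if `A` has a nontrivial kernel, and otherwise
`z / (1 + z) ^ 2` is one. -/
theorem IsSectorial.exists_isRegulariser (hA : IsSectorial A) (hω : sectAngle A < ω)
    (hωπ : ω < Real.pi) : ∃ E R, IsRegulariser A ω E R := by
  obtain ⟨δ, h1, h2⟩ := exists_between hω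
  have h0 := (sectAngle_nonneg A).trans hω.le
  have hr := hA.elemGraph_resFun hω hωπ 1
  by_cases hk : ∃ k : X, stieltjesRes A 1 k = k ∧ k ≠ 0
  · obtain ⟨k, hk, hk0⟩ := hk
    refine ⟨germ ω (resFun (1 : ℝ≥0)), stieltjesRes A 1, ⟨fun F T h =>
      hA.elemGraph_mul_resFun hω hωπ 1 h, fun F T h => hA.elemGraph_comm hω hωπ 1 h,
      fun x hx => hA.stieltjesRes_injective hx, fun f hf hd => ?_⟩⟩
    have h3 := hA.elemGraph_of_elemFun hωπ h1 h2
      (hA.resFun_mul_sub_mem_elemFun hω hωπ hk hk0 hf hd)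
    have h4 := hA.elemGraph_add hω hωπ h3 (hA.elemGraph_const_mul hω hωπ (f 0) hr)
    have h5 := germ_congr (ω := ω) (f := fun z => resFun (1 : ℝ≥0) z * f z)
      (g := fun z => resFun 1 z * (f z - f 0) + f 0 * resFun (1 : ℝ≥0) z) fun z _ => by
        simp only [NNReal.coe_one]
        ring
    exact (show germ ω _ * germ ω _ = _ from h5) ▸ (⟨_, h4⟩ : _ ∈ dom (elemGraph A ω))
  · push Not at hk
    have hE : germ ω bumpFun = germ ω (resFun (1 : ℝ≥0)) * (1 + germ ω (fun _ => -1) *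
        germ ω (resFun (1 : ℝ≥0))) :=
      germ_congr (g := fun z => resFun (1 : ℝ≥0) z * (1 + -1 * resFun (1 : ℝ≥0) z)) fun z _ => by
        simp only [NNReal.coe_one, bumpFun]
        ring
    refine ⟨germ ω bumpFun, stieltjesRes A 1 - stieltjesRes A 1 * stieltjesRes A 1,
      ⟨fun F T h => ?_, fun F T h => ?_, fun x hx => ?_, fun f hf hd => ?_⟩⟩
    · have h3 := hA.elemGraph_mul_resFun hω hωπ 1 h
      have h4 := hA.elemGraph_mul_resFun hω hωπ 1 h3
      have h5 := hA.elemGraph_add hω hωπ h3 (hA.elemGraph_const_mul hω hωπ (-1) h4)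
      convert h5 using 2
      · rw [hE]
        ring
      · rw [mul_sub, mul_assoc]
        module
    · have h3 := hA.elemGraph_comm hω hωπ 1 h
      rw [mul_sub, sub_mul, h3, ← mul_assoc, h3, mul_assoc, h3, mul_assoc]
    · refine hk x (sub_eq_zero.1 (hA.stieltjesRes_injective (s := 1) ?_)).symm
      rw [map_sub]
      exact hx
    · have h3 := hA.elemGraph_of_elemFun hωπ h1 h2
        (mul_mem_elemFun hωπ.le hf.1 (bumpFun_mem_elemFun h0 hωπ))
      rw [mul_comm]
      exact ⟨_, h3⟩

/-- A characterisation of the bounded elements of the sectorial calculus by a regulariser. -/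
theorem IsRegulariser.isSectBounded_iff (hA : IsSectorial A) (hω : sectAngle A < ω)
    (hωπ : ω < Real.pi) {E : SGerm ω} {R : X →L[ℂ] X} (hE : IsRegulariser A ω E R) {f : ℂ → ℂ}
    {T : X →L[ℂ] X} : IsSectBounded A ω f T ↔ f ∈ HinfZero ω ∧
      ∀ F U, (F, U) ∈ elemGraph A ω → (F * E * germ ω f, U * R * T) ∈ elemGraph A ω := by
  have h1 := hA.elemGraph_one hω hωπ
  constructor
  · intro hf
    refine ⟨hf.1, fun F U hF => ?_⟩
    obtain ⟨V, hV⟩ := hA.dom_elemGraph_mul hω hωπ ⟨U, hF⟩ (hE.regular f hf.1 hf.2.1)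
    rw [← mul_assoc] at hV
    rwa [mem_isSectBounded_mul hf (hE.mul_mem F U hF) hV] at hV
  · rintro ⟨hf, h⟩
    have hER : (E, R) ∈ elemGraph A ω := by simpa using hE.mul_mem 1 1 h1
    have hEf : (E * germ ω f, R * T) ∈ elemGraph A ω := by simpa using h 1 1 h1
    refine ⟨hf, ⟨germ_mem_mer hf.1.1, fun e he => ?_⟩, Set.ext fun p => ⟨fun hp => ?_, ?_⟩⟩
    · have h3 : E ∈ regs (elemGraph A ω) (e * germ ω f) :=
        ⟨⟨R, hER⟩, by simpa [mul_left_comm] using hA.dom_elemGraph_mul hω hωπ he ⟨_, hEf⟩⟩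
      exact ⟨⟨E, h3⟩, fun x hx => hE.injective x (hx E h3 R hER)⟩
    · have h3 := hp E R (R * T) hER hEf
      rw [mem_ofPred_eq, ← sub_eq_zero]
      refine hE.injective _ ?_
      rw [map_sub, ← h3, mul_apply_eq_comp, sub_self]
    · intro hp e U V he hV
      rw [mem_ofPred_eq] at hp
      have h3 := hE.mul_mem _ _ hV
      have h4 := h e U he
      rw [show e * E * germ ω f = e * germ ω f * E by ring] at h4
      have h5 := hA.elemGraph_unique hω hωπ h3 h4
      rw [hE.comm _ _ hV, hE.comm _ _ he, mul_assoc] at h5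
      have h6 := congrArg (fun S => S p.1) h5
      simp only [mul_apply_eq_comp] at h6
      rw [hp, ← sub_eq_zero]
      refine hE.injective _ ?_
      rw [map_sub, h6, sub_self]

theorem IsSectorial.isSectBounded_one (hA : IsSectorial A) (hω : sectAngle A < ω)
    (hωπ : ω < Real.pi) : IsSectBounded A ω (fun _ => 1) 1 := by
  obtain ⟨E, R, hE⟩ := hA.exists_isRegulariser hω hωπ
  refine (hE.isSectBounded_iff hA hω hωπ).2 ⟨⟨const_mem_Hinf 1, tendsto_const_nhds⟩,
    fun F U hF => ?_⟩
  have h1 : germ ω (fun _ => 1) = 1 := rfl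
  rw [h1, mul_one, mul_one]
  exact hE.mul_mem F U hF

theorem add_mem_HinfZero {f g : ℂ → ℂ} (hf : f ∈ HinfZero ω) (hg : g ∈ HinfZero ω) :
    (fun z => f z + g z) ∈ HinfZero ω :=
  ⟨add_mem_Hinf hf.1 hg.1, hf.2.add hg.2⟩

theorem mul_mem_HinfZero {f g : ℂ → ℂ} (hf : f ∈ HinfZero ω) (hg : g ∈ HinfZero ω) :
    (fun z => f z * g z) ∈ HinfZero ω :=
  ⟨mul_mem_Hinf hf.1 hg.1, hf.2.mul hg.2⟩

theorem const_mem_HinfZero (c : ℂ) : (fun _ => c) ∈ HinfZero ω :=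
  ⟨const_mem_Hinf c, tendsto_const_nhds⟩

theorem resFun_mem_HinfZero (h0 : 0 ≤ ω) (hωπ : ω < Real.pi) (s : ℝ≥0) :
    resFun s ∈ HinfZero ω := by
  refine ⟨resFun_mem_Hinf h0 hωπ s.coe_nonneg, ?_⟩
  have h : ContinuousAt (fun t : ℝ => resFun s (t : ℂ)) 0 := by
    unfold resFun
    refine ContinuousAt.inv₀ (by fun_prop) (by simp)
  have h2 := h.tendsto.mono_left (nhdsWithin_le_nhds (s := Ioi 0))
  simpa using h2

theorem IsSectorial.isSectBounded_add (hA : IsSectorial A) (hω : sectAngle A < ω)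
    (hωπ : ω < Real.pi) {f g : ℂ → ℂ} {T S : X →L[ℂ] X} (hf : IsSectBounded A ω f T)
    (hg : IsSectBounded A ω g S) : IsSectBounded A ω (fun z => f z + g z) (T + S) := by
  obtain ⟨E, R, hE⟩ := hA.exists_isRegulariser hω hωπ
  rw [hE.isSectBounded_iff hA hω hωπ] at *
  refine ⟨add_mem_HinfZero hf.1 hg.1, fun F U hF => ?_⟩
  have h1 := hA.elemGraph_add hω hωπ (hf.2 F U hF) (hg.2 F U hF)
  rwa [← mul_add, ← mul_add] at h1

theorem IsSectorial.isSectBounded_const_mul (hA : IsSectorial A) (hω : sectAngle A < ω)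
    (hωπ : ω < Real.pi) (a : ℂ) {f : ℂ → ℂ} {T : X →L[ℂ] X} (hf : IsSectBounded A ω f T) :
    IsSectBounded A ω (fun z => a * f z) (a • T) := by
  obtain ⟨E, R, hE⟩ := hA.exists_isRegulariser hω hωπ
  rw [hE.isSectBounded_iff hA hω hωπ] at *
  refine ⟨mul_mem_HinfZero (const_mem_HinfZero a) hf.1, fun F U hF => ?_⟩
  have h1 := hA.elemGraph_const_mul hω hωπ a (hf.2 F U hF)
  rwa [mul_left_comm, ← mul_smul_comm] at h1

theorem IsSectorial.isSectBounded_mul_resFun (hA : IsSectorial A) (hω : sectAngle A < ω)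
    (hωπ : ω < Real.pi) (s : ℝ≥0) {f : ℂ → ℂ} {T : X →L[ℂ] X} (hf : IsSectBounded A ω f T) :
    IsSectBounded A ω (fun z => f z * resFun s z) (T * stieltjesRes A s) := by
  obtain ⟨E, R, hE⟩ := hA.exists_isRegulariser hω hωπ
  rw [hE.isSectBounded_iff hA hω hωπ] at *
  refine ⟨mul_mem_HinfZero hf.1 (resFun_mem_HinfZero ((sectAngle_nonneg A).trans hω.le) hωπ s),
    fun F U hF => ?_⟩
  have h1 := hA.elemGraph_mul_resFun hω hωπ s (hf.2 F U hF)
  rwa [mul_assoc, mul_assoc _ T] at h1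

theorem IsSectorial.isSectBounded_comm (hA : IsSectorial A) (hω : sectAngle A < ω)
    (hωπ : ω < Real.pi) (s : ℝ≥0) {f : ℂ → ℂ} {T : X →L[ℂ] X} (hf : IsSectBounded A ω f T) :
    T * stieltjesRes A s = stieltjesRes A s * T := by
  obtain ⟨E, R, hE⟩ := hA.exists_isRegulariser hω hωπ
  have h1 := ((hE.isSectBounded_iff hA hω hωπ).1 hf).2 1 1 (hA.elemGraph_one hω hωπ)
  have h2 := hA.elemGraph_comm hω hωπ s h1
  rw [one_mul, ← mul_assoc, hE.comm _ _ (hA.elemGraph_resFun hω hωπ s), mul_assoc,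
    mul_assoc] at h2
  ext x
  have h3 := congrArg (fun S => S x) h2
  simp only [mul_apply_eq_comp] at h3
  rw [← sub_eq_zero]
  refine hE.injective _ ?_
  rw [map_sub]
  simp only [mul_apply_eq_comp]
  rw [h3, sub_self]

end BoundedElements

/-! ### The uniform extension is single valued -/

section Closability

variable {X : Type*} [NormedAddCommGroup X] [NormedSpace ℂ X]
  {A : X →ₗ.[ℂ] X} {ω δ : ℝ}

theorem IsSectorial.norm_cauchyInt_le (hA : IsSectorial A) (hωπ : ω < Real.pi)
    (h1 : sectAngle A < δ) (h2 : δ < ω) : ∃ C : ℝ, ∀ f ∈ elemFun ω,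
      ‖cauchyInt A δ f‖ ≤ C * ((∫ x : ℝ, ‖f (Complex.exp (x + (-δ : ℝ) * Complex.I))‖) +
        ∫ x : ℝ, ‖f (Complex.exp (x + δ * Complex.I))‖) := by
  have h0 : |δ| = δ := abs_of_nonneg ((sectAngle_nonneg A).trans h1.le)
  obtain ⟨C, hC0, hC⟩ := hA.norm_lineInt_le hωπ (δ := δ) (by rwa [h0]) (by rwa [h0])
  obtain ⟨D, hD0, hD⟩ := hA.norm_lineInt_le hωπ (δ := -δ) (by rwa [abs_neg, h0])
    (by rwa [abs_neg, h0])
  refine ⟨‖(2 * Real.pi * Complex.I : ℂ)⁻¹‖ * (C + D), fun f hf => ?_⟩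
  rw [cauchyInt_eq_lineInt, norm_smul, mul_assoc ‖_‖]
  have h5 := (norm_sub_le (lineInt A (-δ) f) (lineInt A δ f)).trans
    (add_le_add (hD f hf) (hC f hf))
  refine mul_le_mul_of_nonneg_left (h5.trans ?_) (norm_nonneg _)
  have h3 : 0 ≤ ∫ x : ℝ, ‖f (Complex.exp (x + (-δ : ℝ) * Complex.I))‖ :=
    integral_nonneg fun _ => norm_nonneg _
  have h4 : 0 ≤ ∫ x : ℝ, ‖f (Complex.exp (x + δ * Complex.I))‖ :=
    integral_nonneg fun _ => norm_nonneg _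
  nlinarith [mul_nonneg hC0 h3, mul_nonneg hD0 h4]

theorem tendsto_integral_norm_line (hωπ : ω < Real.pi) (hδ : |δ| < ω) {h : ℂ → ℂ}
    (hh : h ∈ elemFun ω) {p : ℕ → ℂ → ℂ} (hp : ∀ n, p n ∈ Hinf ω) {C : ℝ}
    (hC : ∀ᶠ n in atTop, ∀ z ∈ sector ω, ‖p n z‖ ≤ C)
    (h0 : ∀ z ∈ sector ω, Tendsto (fun n => p n z) atTop (𝓝 0)) :
    Tendsto (fun n => ∫ x : ℝ, ‖p n (Complex.exp (x + δ * Complex.I)) *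
      h (Complex.exp (x + δ * Complex.I))‖) atTop (𝓝 0) := by
  have hi := ((mem_elemFun_iff hωπ.le).1 hh).2 δ hδ
  have h1 := tendsto_integral_filter_of_dominated_convergence (μ := volume) (l := atTop)
    (F := fun (n : ℕ) (x : ℝ) => ‖p n (Complex.exp (x + δ * Complex.I)) *
      h (Complex.exp (x + δ * Complex.I))‖) (f := fun _ => 0)
    (fun x : ℝ => C * ‖h (Complex.exp (x + δ * Complex.I))‖)
    (Eventually.of_forall fun n => (continuous_comp_line hωπ.le
      (mul_mem_Hinf (hp n) hh.1).1 hδ).norm.aestronglyMeasurable) ?_ (hi.norm.const_mul C)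
    (Eventually.of_forall fun x => ?_)
  · simpa using h1
  · filter_upwards [hC] with n hn
    refine Eventually.of_forall fun x => ?_
    rw [norm_norm, norm_mul]
    exact mul_le_mul_of_nonneg_right (hn _ (line_mem_sector hωπ.le hδ x)) (norm_nonneg _)
  · simpa using ((h0 _ (line_mem_sector hωπ.le hδ x)).mul_const _).norm

theorem IsSectorial.tendsto_cauchyInt (hA : IsSectorial A) (hωπ : ω < Real.pi)
    (h1 : sectAngle A < δ) (h2 : δ < ω) {h : ℂ → ℂ}
    (hh : h ∈ elemFun ω) {p : ℕ → ℂ → ℂ} (hp : ∀ n, p n ∈ Hinf ω) {C : ℝ}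
    (hC : ∀ᶠ n in atTop, ∀ z ∈ sector ω, ‖p n z‖ ≤ C)
    (h0 : ∀ z ∈ sector ω, Tendsto (fun n => p n z) atTop (𝓝 0)) :
    Tendsto (fun n => cauchyInt A δ (fun z => p n z * h z)) atTop (𝓝 0) := by
  have h3 : |δ| = δ := abs_of_nonneg ((sectAngle_nonneg A).trans h1.le)
  obtain ⟨D, hD⟩ := hA.norm_cauchyInt_le hωπ h1 h2
  refine squeeze_zero_norm (fun n => hD _ (mul_mem_elemFun hωπ.le (hp n) hh)) ?_
  have h4 := ((tendsto_integral_norm_line hωπ (δ := -δ) (by rwa [abs_neg, h3]) hh hp hC h0).add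
    (tendsto_integral_norm_line hωπ (δ := δ) (by rwa [h3]) hh hp hC h0)).const_mul D
  simpa using h4

theorem tendsto_resFun_atTop (h0 : 0 ≤ ω) (hωπ : ω < Real.pi) {z : ℂ} (hz : z ∈ sector ω) :
    Tendsto (fun n : ℕ => resFun ((n : ℝ≥0) : ℝ) z) atTop (𝓝 0) := by
  have hc := sectConst_pos h0 hωπ
  refine squeeze_zero_norm (fun n => norm_resFun_le h0 hωπ (mem_insert_of_mem 0 hz)
    (NNReal.coe_nonneg _)) ?_
  have hz0 : 0 < ‖z‖ := norm_pos_iff.2 hz.1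
  refine Tendsto.inv_tendsto_atTop (Tendsto.const_mul_atTop hc (tendsto_atTop_add_const_left _ 1
    (Tendsto.atTop_mul_const hz0 ?_)))
  simpa using tendsto_natCast_atTop_atTop (R := ℝ)

variable [CompleteSpace X]

/-- The sectorial calculus restricted to bounded operators is closable for uniform convergence
and convergence in operator norm. The elementary calculus at `d n z · z / (1 + z) ^ 2` shows that
the limit `D'` takes values in the kernel of `A`. If the kernel is not zero, then
`(1 + z)⁻¹ (d n z - d n 0)` is elementary by the structure of the domain; the corresponding operators
converge to `D'`, and `(1 + N A)⁻¹` sends them to `0` as `N → ∞` whereas it fixes the values of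
`D'`. -/
theorem IsSectorial.eq_zero_of_tendsto (hA : IsSectorial A) (hω : sectAngle A < ω)
    (hωπ : ω < Real.pi) {d : ℕ → ℂ → ℂ} {D : ℕ → X →L[ℂ] X} {D' : X →L[ℂ] X}
    (hd : ∀ n, IsSectBounded A ω (d n) (D n))
    (h0 : TendstoUniformlyOn d (fun _ => 0) atTop (insert 0 (sector ω)))
    (hD : Tendsto D atTop (𝓝 D')) : D' = 0 := by
  obtain ⟨δ, h1, h2⟩ := exists_between hω
  have hω0 := (sectAngle_nonneg A).trans hω.le
  have hb := bumpFun_mem_elemFun hω0 hωπ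
  have hbd : ∀ᶠ n in atTop, ∀ z ∈ sector ω, ‖d n z‖ ≤ 1 := by
    filter_upwards [Metric.tendstoUniformlyOn_iff.1 h0 1 one_pos] with n hn z hz
    have := hn z (mem_insert_of_mem 0 hz)
    rw [dist_zero_left] at this
    exact this.le
  have hlim : Tendsto (fun n => cauchyInt A δ (fun z => d n z * bumpFun z)) atTop (𝓝 0) :=
    hA.tendsto_cauchyInt hωπ h1 h2 hb (fun n => (hd n).1.1) hbd
      (fun z hz => h0.tendsto_at (mem_insert_of_mem 0 hz))
  have heq : ∀ n, cauchyInt A δ (fun z => d n z * bumpFun z) =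
      (stieltjesRes A 1 - stieltjesRes A 1 * stieltjesRes A 1) * D n := fun n =>
    mem_isSectBounded_mul (hd n) (hA.elemGraph_bumpFun hω hωπ) (by
      have := hA.elemGraph_of_elemFun hωπ h1 h2 (mul_mem_elemFun hωπ.le (hd n).1.1 hb)
      rw [mul_comm]
      exact this)
  simp only [heq] at hlim
  have h3 := tendsto_nhds_unique hlim (hD.const_mul _)
  have hfix : ∀ x, stieltjesRes A 1 (D' x) = D' x := by
    intro x
    have h4 := congrArg (fun S => S x) h3
    simp only [mul_apply_eq_comp, sub_apply, zero_apply] at h4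
    refine (sub_eq_zero.1 (hA.stieltjesRes_injective (s := 1) ?_)).symm
    rw [map_sub]
    exact h4.symm
  by_contra hne
  obtain ⟨x, hx⟩ : ∃ x, D' x ≠ 0 := by
    by_contra! hcon
    exact hne (ContinuousLinearMap.ext hcon)
  -- now `D' x` is a nonzero element of the kernel of `A`
  have hel := fun n => hA.resFun_mul_sub_mem_elemFun hω hωπ (hfix x) hx (hd n).1 (hd n).2.1
  set W : ℕ → X →L[ℂ] X := fun n => cauchyInt A δ (fun z => resFun 1 z * (d n z - d n 0)) with hW
  have hWeq : ∀ n, W n + d n 0 • stieltjesRes A 1 = stieltjesRes A 1 * D n := by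
    intro n
    refine mem_isSectBounded_mul (hd n) (hA.elemGraph_resFun hω hωπ 1) ?_
    have h4 := hA.elemGraph_add hω hωπ (hA.elemGraph_of_elemFun hωπ h1 h2 (hel n))
      (hA.elemGraph_const_mul hω hωπ (d n 0) (hA.elemGraph_resFun hω hωπ 1))
    have h5 := germ_congr (ω := ω) (f := fun z => resFun (1 : ℝ≥0) z * d n z)
      (g := fun z => resFun 1 z * (d n z - d n 0) + d n 0 * resFun (1 : ℝ≥0) z) fun z _ => by
        simp only [NNReal.coe_one]
        ring
    rw [show germ ω _ * germ ω _ = _ from h5]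
    exact h4
  have hSD : stieltjesRes A 1 * D' = D' := ContinuousLinearMap.ext hfix
  have hWlim : Tendsto W atTop (𝓝 D') := by
    have h4 : Tendsto (fun n => stieltjesRes A 1 * D n - d n 0 • stieltjesRes A 1) atTop
        (𝓝 (stieltjesRes A 1 * D' - (0 : ℂ) • stieltjesRes A 1)) :=
      (hD.const_mul _).sub ((h0.tendsto_at (mem_insert _ _)).smul_const _)
    rw [zero_smul, sub_zero, hSD] at h4
    refine h4.congr fun n => ?_
    rw [← hWeq n, add_sub_cancel_right]
  obtain ⟨C, hC1, hC⟩ := hA.exists_stieltjesRes_bound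
  have hle : ∀ n, ‖D'‖ ≤ C * ‖D' - W n‖ := by
    intro n
    have h4 : Tendsto (fun N : ℕ => stieltjesRes A (N : ℝ≥0) * W n) atTop (𝓝 0) := by
      have h5 := hA.tendsto_cauchyInt hωπ h1 h2 (hel n) (p := fun N : ℕ => resFun (N : ℝ≥0))
        (fun N => resFun_mem_Hinf hω0 hωπ (NNReal.coe_nonneg _)) (C := (sectConst ω)⁻¹)
        (Eventually.of_forall fun N z hz => norm_resFun_le_const hω0 hωπ (mem_insert_of_mem 0 hz)
          (NNReal.coe_nonneg _)) (fun z hz => tendsto_resFun_atTop hω0 hωπ hz)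
      refine h5.congr fun N => ?_
      rw [hW, hA.stieltjesRes_mul_cauchyInt hω hωπ N h1 h2 (hel n)]
    have h6 : ∀ N : ℕ, ‖D'‖ ≤ C * ‖D' - W n‖ + ‖stieltjesRes A (N : ℝ≥0) * W n‖ := by
      intro N
      have h7 : D' = stieltjesRes A (N : ℝ≥0) * (D' - W n) + stieltjesRes A (N : ℝ≥0) * W n := by
        rw [← mul_add, sub_add_cancel]
        ext y
        exact (hA.stieltjesRes_apply_of_fixed N (hfix y)).symm
      calc ‖D'‖ = ‖stieltjesRes A (N : ℝ≥0) * (D' - W n) + stieltjesRes A (N : ℝ≥0) * W n‖ := by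
            rw [← h7]
        _ ≤ ‖stieltjesRes A (N : ℝ≥0) * (D' - W n)‖ + ‖stieltjesRes A (N : ℝ≥0) * W n‖ :=
            norm_add_le _ _
        _ ≤ _ := add_le_add_left ((norm_mul_le _ _).trans
            (mul_le_mul_of_nonneg_right (hC _) (norm_nonneg _))) _
    have h8 := ge_of_tendsto' (h4.norm.const_add (C * ‖D' - W n‖)) h6
    simpa using h8
  have hz : Tendsto (fun n => C * ‖D' - W n‖) atTop (𝓝 0) := by
    simpa using ((hWlim.const_sub D').norm).const_mul C
  exact hne (norm_le_zero_iff.1 (ge_of_tendsto' hz hle))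

theorem IsSectorial.uniGraph_unique (hA : IsSectorial A) (hω : sectAngle A < ω)
    (hωπ : ω < Real.pi) {F : SGerm ω} {T T' : X →L[ℂ] X} (h : (F, T) ∈ uniGraph A ω)
    (h' : (F, T') ∈ uniGraph A ω) : T = T' := by
  have hω0 := (sectAngle_nonneg A).trans_lt hω
  obtain ⟨f, hf, hF, e, S, he, hef, hS⟩ := h
  obtain ⟨f', hf', hF', e', S', he', hef', hS'⟩ := h'
  have h1 : EqOn f f' (sector ω) := eqOn_of_germ_eq hf.1.1.continuousOn hf'.1.1.continuousOn
    (hF.symm.trans hF')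
  have h2 : EqOn f f' (insert 0 (sector ω)) := by
    rintro z (rfl | hz)
    · refine tendsto_nhds_unique hf.2 (hf'.2.congr' ?_)
      filter_upwards [self_mem_nhdsWithin] with t ht
      exact (h1 (ofReal_mem_sector hω0 ht)).symm
    · exact h1 hz
  rw [← sub_eq_zero]
  refine hA.eq_zero_of_tendsto hω hωπ (d := fun n z => e n z + -1 * e' n z)
    (D := fun n => S n + (-1 : ℂ) • S' n)
    (fun n => hA.isSectBounded_add hω hωπ (he n) (hA.isSectBounded_const_mul hω hωπ (-1) (he' n)))
    ?_ ?_
  · have h3 := hef.sub (hef'.congr_right h2.symm)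
    refine (h3.congr (Eventually.of_forall fun n z _ => ?_)).congr_right fun z _ => ?_
    · simp [sub_eq_add_neg]
    · simp
  · simpa [sub_eq_add_neg] using hS.add (hS'.const_smul (-1 : ℂ))

end Closability

/-! ### The algebra generated by the resolvents acts on the uniform extension -/

section Multipliers

open BoundedContinuousFunction

variable {X : Type*} [NormedAddCommGroup X] [NormedSpace ℂ X]
  {A : X →ₗ.[ℂ] X} {ω : ℝ}

/-- The function `(1 + s z)⁻¹` as a bounded continuous function on the sector together with `0`. -/
noncomputable def resBCF (h0 : 0 ≤ ω) (hωπ : ω < Real.pi) (s : ℝ≥0) :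
    ↥(insert (0 : ℂ) (sector ω)) →ᵇ ℂ :=
  BoundedContinuousFunction.ofNormedAddCommGroup (fun z => resFun s z)
    (continuous_iff_continuousAt.2 fun z => (differentiableAt_resFun (one_add_mul_ne_zero h0 hωπ z.2
      s.coe_nonneg)).continuousAt.comp continuous_subtype_val.continuousAt) (sectConst ω)⁻¹
    fun z => norm_resFun_le_const h0 hωπ z.2 s.coe_nonneg

/-- The pair of the function `(1 + s z)⁻¹` and the operator `(1 + s A)⁻¹`. -/
noncomputable def resPair (A : X →ₗ.[ℂ] X) (h0 : 0 ≤ ω) (hωπ : ω < Real.pi) (s : ℝ≥0) :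
    (↥(insert (0 : ℂ) (sector ω)) →ᵇ ℂ) × (X →L[ℂ] X) :=
  (resBCF h0 hωπ s, stieltjesRes A s)

/-- The closed unital algebra generated by the pairs of the function `(1 + s z)⁻¹` and the operator
`(1 + s A)⁻¹`, closed for uniform convergence and convergence in operator norm. -/
noncomputable def resAlg (A : X →ₗ.[ℂ] X) (h0 : 0 ≤ ω) (hωπ : ω < Real.pi) :
    Subalgebra ℂ ((↥(insert (0 : ℂ) (sector ω)) →ᵇ ℂ) × (X →L[ℂ] X)) :=
  (Algebra.adjoin ℂ (range (resPair A h0 hωπ))).topologicalClosure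

theorem resPair_mem_resAlg (h0 : 0 ≤ ω) (hωπ : ω < Real.pi) (s : ℝ≥0) :
    resPair A h0 hωπ s ∈ resAlg A h0 hωπ :=
  Subalgebra.le_topologicalClosure _ (Algebra.subset_adjoin ⟨s, rfl⟩)

theorem isClosed_resAlg (h0 : 0 ≤ ω) (hωπ : ω < Real.pi) :
    IsClosed (resAlg A h0 hωπ : Set ((↥(insert (0 : ℂ) (sector ω)) →ᵇ ℂ) × (X →L[ℂ] X))) :=
  Subalgebra.isClosed_topologicalClosure _

open Classical in
/-- Extension by zero of a function on the sector together with `0`. -/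
noncomputable def zeroExt (b : ↥(insert (0 : ℂ) (sector ω)) →ᵇ ℂ) (z : ℂ) : ℂ :=
  if h : z ∈ insert (0 : ℂ) (sector ω) then b ⟨z, h⟩ else 0

theorem zeroExt_of_mem (b : ↥(insert (0 : ℂ) (sector ω)) →ᵇ ℂ) {z : ℂ}
    (h : z ∈ insert (0 : ℂ) (sector ω)) : zeroExt b z = b ⟨z, h⟩ := dif_pos h

theorem tendstoUniformlyOn_mul {S : Set ℂ} {e g : ℕ → ℂ → ℂ} {f h : ℂ → ℂ} {C D : ℝ}
    (he : TendstoUniformlyOn e f atTop S) (hg : TendstoUniformlyOn g h atTop S)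
    (hf : ∀ z ∈ S, ‖f z‖ ≤ C) (hh : ∀ z ∈ S, ‖h z‖ ≤ D) :
    TendstoUniformlyOn (fun n z => e n z * g n z) (fun z => f z * h z) atTop S := by
  rw [Metric.tendstoUniformlyOn_iff] at *
  intro ε hε
  set K := 1 + |C| + |D| with hK
  have hK0 : 0 < K := by positivity
  have hη : 0 < min 1 (ε / K) := by positivity
  filter_upwards [he _ hη, hg _ hη] with n h1 h2 z hz
  have h1 := h1 z hz
  have h2 := h2 z hz
  rw [dist_eq_norm] at *
  have h3 : f z * h z - e n z * g n z = (f z - e n z) * h z + f z * (h z - g n z) -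
      (f z - e n z) * (h z - g n z) := by ring
  have h4 : ‖f z * h z - e n z * g n z‖ ≤ ‖f z - e n z‖ * ‖h z‖ + ‖f z‖ * ‖h z - g n z‖ +
      ‖f z - e n z‖ * ‖h z - g n z‖ := by
    rw [h3, ← norm_mul, ← norm_mul, ← norm_mul]
    exact (norm_sub_le _ _).trans (add_le_add_left (norm_add_le _ _) _)
  have h5 := (hf z hz).trans (le_abs_self C)
  have h6 := (hh z hz).trans (le_abs_self D)
  have h7 := h1.trans_le (min_le_left _ _)
  have h8 := h1.trans_le (min_le_right _ _)
  have h9 := h2.trans_le (min_le_right _ _)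
  rw [lt_div_iff₀ hK0] at h8 h9
  have h10 : ‖f z - e n z‖ * ‖h z‖ ≤ ‖f z - e n z‖ * |D| :=
    mul_le_mul_of_nonneg_left h6 (norm_nonneg _)
  have h11 : ‖f z‖ * ‖h z - g n z‖ ≤ |C| * ‖h z - g n z‖ :=
    mul_le_mul_of_nonneg_right h5 (norm_nonneg _)
  have h12 : ‖f z - e n z‖ * ‖h z - g n z‖ ≤ 1 * ‖h z - g n z‖ :=
    mul_le_mul_of_nonneg_right h7.le (norm_nonneg _)
  have hη' : ‖f z - e n z‖ < ε / K := by rwa [lt_div_iff₀ hK0]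
  have hη'' : ‖h z - g n z‖ < ε / K := by rwa [lt_div_iff₀ hK0]
  have h13 : ε / K * K = ε := by field_simp
  nlinarith [abs_nonneg C, abs_nonneg D, mul_le_mul_of_nonneg_right hη'.le (abs_nonneg D),
    mul_le_mul_of_nonneg_left hη''.le (abs_nonneg C)]

/-- Uniform limits of bounded holomorphic functions with limits at `0` are again of this kind. -/
theorem HinfZero_of_tendstoUniformlyOn {g : ℕ → ℂ → ℂ} {f : ℂ → ℂ} (h0 : 0 < ω)
    (hg : ∀ n, g n ∈ HinfZero ω) (h : TendstoUniformlyOn g f atTop (insert 0 (sector ω))) :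
    f ∈ HinfZero ω := by
  refine ⟨⟨?_, ?_⟩, ?_⟩
  · exact (h.mono (subset_insert _ _)).tendstoLocallyUniformlyOn.differentiableOn
      (Eventually.of_forall fun n => (hg n).1.1) (isOpen_sector ω)
  · obtain ⟨n, hn⟩ := (Metric.tendstoUniformlyOn_iff.1 h 1 one_pos).exists
    obtain ⟨C, hC⟩ := (hg n).1.2
    refine ⟨1 + C, fun z hz => ?_⟩
    have h1 := hn z (mem_insert_of_mem 0 hz)
    rw [dist_eq_norm] at h1
    have h2 := norm_add_le (f z - g n z) (g n z)
    rw [sub_add_cancel] at h2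
    exact h2.trans (add_le_add h1.le (hC z hz))
  · have h1 : TendstoUniformlyOn (fun n (t : ℝ) => g n t) (fun t : ℝ => f t) atTop (Ioi 0) := by
      rw [Metric.tendstoUniformlyOn_iff] at h ⊢
      intro ε hε
      filter_upwards [h ε hε] with n hn t ht
      exact hn t (mem_insert_of_mem 0 (ofReal_mem_sector h0 ht))
    exact ((tendstoUniformlyOn_iff_tendstoUniformlyOnFilter.1 h1).mono_right
      inf_le_right).tendsto_of_eventually_tendsto
      (Eventually.of_forall fun n => (hg n).2) (h.tendsto_at (mem_insert _ _))

variable [CompleteSpace X]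

/-- Elements of the algebra generated by the resolvents are multipliers of the bounded part of the
sectorial calculus. -/
theorem IsSectorial.isSectBounded_mul_of_mem_adjoin (hA : IsSectorial A) (hω : sectAngle A < ω)
    (h0 : 0 ≤ ω) (hωπ : ω < Real.pi) {y : (↥(insert (0 : ℂ) (sector ω)) →ᵇ ℂ) × (X →L[ℂ] X)}
    (hy : y ∈ Algebra.adjoin ℂ (range (resPair A h0 hωπ))) :
    ∀ f T, IsSectBounded A ω f T →
      IsSectBounded A ω (fun z => f z * zeroExt y.1 z) (T * y.2) ∧ T * y.2 = y.2 * T := by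
  have hω0 := (sectAngle_nonneg A).trans_lt hω
  induction hy using Algebra.adjoin_induction with
  | mem y hy =>
    obtain ⟨s, rfl⟩ := hy
    intro f T hf
    refine ⟨(hA.isSectBounded_mul_resFun hω hωπ s hf).congr hω0 fun z hz => ?_,
      hA.isSectBounded_comm hω hωπ s hf⟩
    simp only [zeroExt_of_mem _ hz]
    rfl
  | algebraMap c =>
    intro f T hf
    have h2 : ((algebraMap ℂ ((↥(insert (0 : ℂ) (sector ω)) →ᵇ ℂ) × (X →L[ℂ] X)) c).2) =
        c • (1 : X →L[ℂ] X) := Algebra.algebraMap_eq_smul_one c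
    rw [h2, mul_smul_comm, smul_mul_assoc, mul_one, one_mul]
    refine ⟨(hA.isSectBounded_const_mul hω hωπ c hf).congr hω0 fun z hz => ?_, rfl⟩
    simp only [zeroExt_of_mem _ hz]
    exact mul_comm _ _
  | add y y' _ _ h h' =>
    intro f T hf
    have h1 := h f T hf
    have h2 := h' f T hf
    rw [Prod.snd_add, mul_add, add_mul, h1.2, h2.2, ← h1.2, ← h2.2]
    refine ⟨(hA.isSectBounded_add hω hωπ h1.1 h2.1).congr hω0 fun z hz => ?_, rfl⟩
    simp only [zeroExt_of_mem _ hz, Prod.fst_add, BoundedContinuousFunction.add_apply]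
    ring
  | mul y y' _ _ h h' =>
    intro f T hf
    have h1 := h f T hf
    have h2 := h' _ _ h1.1
    have h3 := (h' _ _ hf).2
    rw [Prod.snd_mul, ← mul_assoc]
    refine ⟨h2.1.congr hω0 fun z hz => ?_, ?_⟩
    · simp only [zeroExt_of_mem _ hz, Prod.fst_mul, BoundedContinuousFunction.mul_apply]
      ring
    · rw [h1.2, mul_assoc, h3, ← mul_assoc]

/-- The multipliers of the uniform extension: pairs of a function and a commuting operator which act
on the graph of the uniform extension by multiplication. -/
def uniMul (A : X →ₗ.[ℂ] X) (ω : ℝ) : Set (SGerm ω × (X →L[ℂ] X)) :=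
  {p | ∀ F T, (F, T) ∈ uniGraph A ω → (F * p.1, T * p.2) ∈ uniGraph A ω ∧ T * p.2 = p.2 * T}

/-- The closed algebra generated by the resolvents acts on the uniform extension. Limits are allowed
on both sides, since the uniform extension is itself defined by limits. -/
theorem IsSectorial.mem_uniMul (hA : IsSectorial A) (hω : sectAngle A < ω)
    (h0 : 0 ≤ ω) (hωπ : ω < Real.pi) {y : (↥(insert (0 : ℂ) (sector ω)) →ᵇ ℂ) × (X →L[ℂ] X)}
    (hy : y ∈ resAlg A h0 hωπ) {g : ℂ → ℂ} (hg : ∀ z : ↥(insert (0 : ℂ) (sector ω)), g z = y.1 z) :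
    (germ ω g, y.2) ∈ uniMul A ω := by
  have hω0 := (sectAngle_nonneg A).trans_lt hω
  obtain ⟨u, hu, hlim⟩ := mem_closure_iff_seq_limit.1 hy
  have hg' : TendstoUniformlyOn (fun n => zeroExt (u n).1) g atTop (insert 0 (sector ω)) := by
    have h1 := BoundedContinuousFunction.tendsto_iff_tendstoUniformly.1
      ((continuous_fst.tendsto y).comp hlim)
    rw [Metric.tendstoUniformly_iff] at h1
    rw [Metric.tendstoUniformlyOn_iff]
    intro ε hε
    filter_upwards [h1 ε hε] with n hn z hz
    rw [zeroExt_of_mem _ hz, hg ⟨z, hz⟩]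
    exact hn ⟨z, hz⟩
  rintro F T ⟨f, hf, hF, e, S, he, hef, hS⟩
  simp only at hF hS
  have hSu : Tendsto (fun n => S n * (u n).2) atTop (𝓝 (T * y.2)) :=
    hS.mul ((continuous_snd.tendsto y).comp hlim)
  have hm := fun n => hA.isSectBounded_mul_of_mem_adjoin hω h0 hωπ (hu n) _ _ (he n)
  have hgH : g ∈ HinfZero ω := by
    refine HinfZero_of_tendstoUniformlyOn hω0 (g := fun n => zeroExt (u n).1) (fun n => ?_) hg'
    have h1 := hA.isSectBounded_mul_of_mem_adjoin hω h0 hωπ (hu n) _ _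
      (hA.isSectBounded_one hω hωπ)
    simpa using h1.1.1
  obtain ⟨C, hC⟩ := hf.1.2
  refine ⟨⟨fun z => f z * g z, mul_mem_HinfZero hf hgH, by rw [hF]; rfl, _, _,
    fun n => (hm n).1, ?_, hSu⟩, ?_⟩
  · refine tendstoUniformlyOn_mul (C := max C ‖f 0‖) (D := ‖y.1‖) hef hg' ?_ fun z hz => ?_
    · rintro z (rfl | hz)
      · exact le_max_right _ _
      · exact (hC z hz).trans (le_max_left _ _)
    · rw [hg ⟨z, hz⟩]
      exact y.1.norm_coe_le_norm _
  · refine tendsto_nhds_unique hSu ((((continuous_snd.tendsto y).comp hlim).mul hS).congr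
      fun n => ?_)
    exact (hm n).2.symm

theorem IsSectorial.one_mem_uniGraph (hA : IsSectorial A) (hω : sectAngle A < ω)
    (hωπ : ω < Real.pi) : ((1 : SGerm ω), (1 : X →L[ℂ] X)) ∈ uniGraph A ω :=
  ⟨fun _ => 1, const_mem_HinfZero 1, rfl, fun _ _ => 1, fun _ => 1,
    fun _ => hA.isSectBounded_one hω hωπ, fun _ hu => Eventually.of_forall fun _ _ _ =>
      refl_mem_uniformity hu, tendsto_const_nhds⟩

theorem IsSectorial.uniMul_subset (hA : IsSectorial A) (hω : sectAngle A < ω)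
    (hωπ : ω < Real.pi) : uniMul A ω ⊆ uniGraph A ω := fun p hp => by
  simpa using (hp 1 1 (hA.one_mem_uniGraph hω hωπ)).1

/-- A family of multipliers with trivial joint kernel which regularises `F` to multipliers
determines the operator that the uniform extension assigns to `F`. -/
theorem IsSectorial.uniCalc_eq (hA : IsSectorial A) (hω : sectAngle A < ω)
    (hωπ : ω < Real.pi) {F : SGerm ω} (hF : F ∈ mer ω)
    {M : Set (SGerm ω × (X →L[ℂ] X) × (X →L[ℂ] X))} (hM : M.Nonempty)
    (h1 : ∀ m ∈ M, (m.1, m.2.1) ∈ uniMul A ω) (h2 : ∀ m ∈ M, (m.1 * F, m.2.2) ∈ uniMul A ω)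
    (h3 : ∀ x, (∀ m ∈ M, m.2.1 x = 0) → x = 0) :
    F ∈ uniDom A ω ∧ uniCalc A ω F = {p | ∀ m ∈ M, m.2.2 p.1 = m.2.1 p.2} := by
  have hsub := hA.uniMul_subset hω hωπ
  refine ⟨⟨hF, fun e ⟨T, he⟩ => ?_⟩, Set.ext fun p => ⟨fun hp m hm => ?_, fun hp e T S he hS => ?_⟩⟩
  · have h4 : ∀ m ∈ M, m.1 ∈ regs (uniGraph A ω) (e * F) := fun m hm =>
      ⟨⟨_, hsub (h1 m hm)⟩, _, mul_left_comm m.1 e F ▸ ((h2 m hm) e T he).1⟩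
    obtain ⟨m, hm⟩ := hM
    exact ⟨⟨_, h4 m hm⟩, fun x hx => h3 x fun m hm => hx _ (h4 m hm) _ (hsub (h1 m hm))⟩
  · exact hp m.1 m.2.1 m.2.2 (hsub (h1 m hm)) (hsub (h2 m hm))
  · rw [← sub_eq_zero]
    refine h3 _ fun m hm => ?_
    have h4 := h1 m hm _ _ hS
    have h5 := h2 m hm _ _ he
    have h6 := h1 m hm _ _ he
    have h7 : S * m.2.1 = T * m.2.2 :=
      hA.uniGraph_unique hω hωπ h4.1 (by rw [show e * F * m.1 = e * (m.1 * F) by ring]; exact h5.1)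
    have h8 : m.2.1 (S p.1) = T (m.2.2 p.1) := by
      have := congrArg (fun V => V p.1) (h4.2.symm.trans h7)
      simpa only [mul_apply_eq_comp] using this
    have h9 : T (m.2.1 p.2) = m.2.1 (T p.2) := by
      have := congrArg (fun V => V p.2) h6.2
      simpa only [mul_apply_eq_comp] using this
    rw [map_sub, h8, hp m hm, h9, sub_self]

end Multipliers

/-! ### Integrals with respect to complex measures -/

section ComplexMeasures

theorem isFiniteMeasure_variation (μ : ComplexMeasure ℝ≥0) : IsFiniteMeasure μ.variation := by
  have h : μ.variation ≤ (ComplexMeasure.re μ).variation + (ComplexMeasure.im μ).variation := by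
    refine VectorMeasure.variation_le_of_forall_enorm_le fun E _ => ?_
    have h1 : ‖μ E‖ₑ ≤ ‖(μ E).re‖ₑ + ‖(μ E).im‖ₑ := by
      rw [← enorm_norm (μ E), ← enorm_norm (μ E).re, ← enorm_norm (μ E).im,
        Real.enorm_of_nonneg (norm_nonneg _), Real.enorm_of_nonneg (norm_nonneg _),
        Real.enorm_of_nonneg (norm_nonneg _), ← ENNReal.ofReal_add (norm_nonneg _) (norm_nonneg _)]
      exact ENNReal.ofReal_le_ofReal (Complex.norm_le_abs_re_add_abs_im _)
    exact h1.trans (add_le_add (VectorMeasure.enorm_measure_le_variation (ComplexMeasure.re μ) E)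
      (VectorMeasure.enorm_measure_le_variation (ComplexMeasure.im μ) E))
  rw [← SignedMeasure.totalVariation_eq_variation,
    ← SignedMeasure.totalVariation_eq_variation] at h
  have h1 : ∀ s : SignedMeasure ℝ≥0, IsFiniteMeasure s.totalVariation := fun s => by
    rw [SignedMeasure.totalVariation]
    infer_instance
  have := h1 (ComplexMeasure.re μ)
  have := h1 (ComplexMeasure.im μ)
  exact isFiniteMeasure_of_le _ h

variable {E E' : Type*} [NormedAddCommGroup E] [NormedSpace ℂ E] [CompleteSpace E]
  [NormedAddCommGroup E'] [NormedSpace ℂ E'] [CompleteSpace E'] {μ : ComplexMeasure ℝ≥0}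

/-- Integration with respect to a complex measure commutes with continuous linear maps. -/
theorem cintegral_comp_comm (L : E →L[ℂ] E') {g : ℝ≥0 → E} (hg : Integrable g μ.variation) :
    cintegral μ (fun s => L (g s)) = L (cintegral μ g) := by
  have := isFiniteMeasure_variation μ
  refine Integrable.induction
    (fun g : ℝ≥0 → E => cintegral μ (fun s => L (g s)) = L (cintegral μ g)) ?_ ?_ ?_ ?_ hg
  · intro c s hs hμ
    have h1 : (fun x => L (s.indicator (fun _ => c) x)) = s.indicator fun _ => L c :=
      (s.indicator_comp_of_zero (g := L) (f := fun _ => c) (map_zero L)).symm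
    have h2 := setToFun_indicator_const
      (dominatedFinMeasAdditive_cbmApplyMeasure μ
        (ContinuousLinearMap.lsmul ℝ ℂ : ℂ →L[ℝ] E →L[ℝ] E).flip) hs hμ.ne c
    have h3 := setToFun_indicator_const
      (dominatedFinMeasAdditive_cbmApplyMeasure μ
        (ContinuousLinearMap.lsmul ℝ ℂ : ℂ →L[ℝ] E' →L[ℝ] E').flip) hs hμ.ne (L c)
    rw [h1]
    refine h3.trans (Eq.trans ?_ (congrArg L h2.symm))
    exact (map_smul L _ _).symm
  · intro f g _ hf hg h1 h2
    have h3 := VectorMeasure.integral_add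
      (B := (ContinuousLinearMap.lsmul ℝ ℂ : ℂ →L[ℝ] E →L[ℝ] E).flip) hf hg
    have h4 := VectorMeasure.integral_add
      (B := (ContinuousLinearMap.lsmul ℝ ℂ : ℂ →L[ℝ] E' →L[ℝ] E').flip)
      (L.integrable_comp hf) (L.integrable_comp hg)
    have h5 : (fun s => L ((f + g) s)) = (fun s => L (f s)) + fun s => L (g s) :=
      funext fun s => map_add L _ _
    rw [h5]
    refine h4.trans (Eq.trans ?_ (congrArg L h3.symm))
    rw [map_add]
    exact congrArg₂ (· + ·) h1 h2
  · have h1 : Continuous fun f : Lp E 1 μ.variation => cintegral μ f := continuous_setToFun _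
    have h2 : Continuous fun f : Lp E 1 μ.variation => cintegral μ (L.compLp f) :=
      (continuous_setToFun (dominatedFinMeasAdditive_cbmApplyMeasure μ
        (ContinuousLinearMap.lsmul ℝ ℂ : ℂ →L[ℝ] E' →L[ℝ] E').flip)).comp
        (L.compLpL 1 μ.variation).continuous
    refine isClosed_eq (h2.congr fun f => ?_) (L.continuous.comp h1)
    exact VectorMeasure.integral_congr_ae (L.coeFn_compLp f)
  · intro f g hfg hf h
    have h1 := VectorMeasure.integral_congr_ae
      (B := (ContinuousLinearMap.lsmul ℝ ℂ : ℂ →L[ℝ] E →L[ℝ] E).flip) hfg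
    have h2 := VectorMeasure.integral_congr_ae
      (B := (ContinuousLinearMap.lsmul ℝ ℂ : ℂ →L[ℝ] E' →L[ℝ] E').flip) (hfg.fun_comp L)
    exact h2.symm.trans (h.trans (congrArg L h1))

theorem cintegral_mem {V : Submodule ℂ E} (hV : IsClosed (V : Set E)) {g : ℝ≥0 → E}
    (hg : Integrable g μ.variation) (h : ∀ s, g s ∈ V) : cintegral μ g ∈ V := by
  have : CompleteSpace V := hV.completeSpace_coe
  have h1 : Integrable (fun s => (⟨g s, h s⟩ : V)) μ.variation := by
    refine ⟨?_, ?_⟩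
    · exact (Topology.IsEmbedding.subtypeVal.aestronglyMeasurable_comp_iff).1 hg.1
    · exact hg.2
  have h2 := cintegral_comp_comm V.subtypeL h1
  simp only [Submodule.subtypeL_apply] at h2
  rw [h2]
  exact Subtype.prop _

theorem integral_mem_of_isClosed {α : Type*} [MeasurableSpace α] {ρ : Measure α}
    {V : Submodule ℂ E} (hV : IsClosed (V : Set E)) {g : α → E}
    (hg : Integrable g ρ) (h : ∀ s, g s ∈ V) : ∫ s, g s ∂ρ ∈ V := by
  have : CompleteSpace V := hV.completeSpace_coe
  have h1 : Integrable (fun s => (⟨g s, h s⟩ : V)) ρ := by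
    refine ⟨?_, ?_⟩
    · exact (Topology.IsEmbedding.subtypeVal.aestronglyMeasurable_comp_iff).1 hg.1
    · exact hg.2
  have h2 := V.subtypeL.integral_comp_comm h1
  simp only [Submodule.subtypeL_apply] at h2
  rw [h2]
  exact Subtype.prop _

end ComplexMeasures

/-! ### Integrability of the resolvents -/

section ResolventFamilies

open BoundedContinuousFunction

/-- A bounded family which satisfies the identity of `(1 + s z)⁻¹` is continuous off `0`. -/
theorem continuousOn_of_stieltjes_identity {B : Type*} [NormedRing B] [NormedAlgebra ℂ B]
    {u : ℝ≥0 → B} {C : ℝ} (hC : ∀ s, ‖u s‖ ≤ C)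
    (hu : ∀ s t : ℝ≥0, (((t : ℝ) : ℂ) - ((s : ℝ) : ℂ)) • (u s * u t) =
      ((t : ℝ) : ℂ) • u t - ((s : ℝ) : ℂ) • u s) : ContinuousOn u (Ioi 0) := by
  intro s hs
  refine ContinuousAt.continuousWithinAt ?_
  have hs0 : (0 : ℝ) < s := hs
  have hs1 : ((s : ℝ) : ℂ) ≠ 0 := Complex.ofReal_ne_zero.2 hs0.ne'
  have hC0 : 0 ≤ C := (norm_nonneg _).trans (hC 0)
  have h1 : ∀ t, ‖u t - u s‖ ≤ |(t : ℝ) - s| / s * (C * C + C) := by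
    intro t
    have h2 : u t - u s = ((((s : ℝ) : ℂ)⁻¹) * (((s : ℝ) : ℂ) - ((t : ℝ) : ℂ))) •
        (u t - u s * u t) := by
      have h3 : ((s : ℝ) : ℂ) • (u t - u s) = (((s : ℝ) : ℂ) - ((t : ℝ) : ℂ)) •
          (u t - u s * u t) := by
        have h4 := hu s t
        rw [smul_sub (((s : ℝ) : ℂ) - ((t : ℝ) : ℂ)), ← neg_sub ((t : ℝ) : ℂ), neg_smul _ (u s * u t),
          h4]
        module
      rw [mul_smul, ← h3, smul_smul, inv_mul_cancel₀ hs1, one_smul]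
    rw [h2, norm_smul, norm_mul, norm_inv, ← Complex.ofReal_sub, Complex.norm_real,
      Complex.norm_real, Real.norm_eq_abs, Real.norm_eq_abs, abs_of_pos hs0, abs_sub_comm (s : ℝ),
      inv_mul_eq_div]
    refine mul_le_mul_of_nonneg_left ?_ (by positivity)
    refine (norm_sub_le _ _).trans ?_
    rw [add_comm (C * C)]
    exact add_le_add (hC t) ((norm_mul_le _ _).trans (mul_le_mul (hC s) (hC t) (norm_nonneg _) hC0))
  rw [ContinuousAt, tendsto_iff_norm_sub_tendsto_zero]
  refine squeeze_zero (fun _ => norm_nonneg _) h1 ?_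
  have h5 : Continuous fun t : ℝ≥0 => |(t : ℝ) - s| / s * (C * C + C) := by fun_prop
  simpa using h5.tendsto s

theorem aestronglyMeasurable_of_continuousOn_Ioi {B : Type*} [NormedAddCommGroup B]
    {u : ℝ≥0 → B} (hu : ContinuousOn u (Ioi 0)) (ρ : Measure ℝ≥0) : AEStronglyMeasurable u ρ := by
  have h1 : AEStronglyMeasurable u (ρ.restrict ({0} ∪ Ioi 0)) := by
    refine aestronglyMeasurable_union_iff.2 ⟨?_, hu.aestronglyMeasurable measurableSet_Ioi⟩
    rw [Measure.restrict_singleton]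
    exact aestronglyMeasurable_dirac.smul_measure _
  have h2 : ({0} ∪ Ioi 0 : Set ℝ≥0) = univ := by
    ext t
    simp
  rwa [h2, Measure.restrict_univ] at h1

variable {X : Type*} [NormedAddCommGroup X] [NormedSpace ℂ X]
  {A : X →ₗ.[ℂ] X} {ω : ℝ}

theorem resBCF_mul (h0 : 0 ≤ ω) (hωπ : ω < Real.pi) (s t : ℝ≥0) :
    (((t : ℝ) : ℂ) - ((s : ℝ) : ℂ)) • (resBCF h0 hωπ s * resBCF h0 hωπ t) =
      ((t : ℝ) : ℂ) • resBCF h0 hωπ t - ((s : ℝ) : ℂ) • resBCF h0 hωπ s := by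
  ext z
  have h1 := one_add_mul_ne_zero h0 hωπ z.2 s.coe_nonneg
  have h2 := one_add_mul_ne_zero h0 hωπ z.2 t.coe_nonneg
  change (((t : ℝ) : ℂ) - ((s : ℝ) : ℂ)) * (resFun s z * resFun t z) =
    ((t : ℝ) : ℂ) * resFun t z - ((s : ℝ) : ℂ) * resFun s z
  have h3 := inv_mul_cancel₀ h1
  have h4 := inv_mul_cancel₀ h2
  simp only [resFun] at *
  generalize (1 + ((s : ℝ) : ℂ) * (z : ℂ))⁻¹ = a at *
  generalize (1 + ((t : ℝ) : ℂ) * (z : ℂ))⁻¹ = b at *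
  linear_combination (t : ℝ) * b * h3 - (s : ℝ) * a * h4

theorem IsSectorial.exists_resPair_bound (hA : IsSectorial A) (h0 : 0 ≤ ω) (hωπ : ω < Real.pi) :
    ∃ C : ℝ, ∀ s, ‖resPair A h0 hωπ s‖ ≤ C := by
  obtain ⟨C, -, hC⟩ := hA.exists_stieltjesRes_bound
  refine ⟨max (sectConst ω)⁻¹ C, fun s => ?_⟩
  refine max_le_max ?_ (hC s)
  exact BoundedContinuousFunction.norm_ofNormedAddCommGroup_le _
    (inv_nonneg.2 (sectConst_pos h0 hωπ).le)
    fun z => norm_resFun_le_const h0 hωπ z.2 s.coe_nonneg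

theorem IsSectorial.aestronglyMeasurable_resPair (hA : IsSectorial A) (h0 : 0 ≤ ω)
    (hωπ : ω < Real.pi) (ρ : Measure ℝ≥0) : AEStronglyMeasurable (resPair A h0 hωπ) ρ := by
  obtain ⟨C, hC⟩ := hA.exists_resPair_bound h0 hωπ
  exact aestronglyMeasurable_of_continuousOn_Ioi (continuousOn_of_stieltjes_identity hC fun s t =>
    Prod.ext (resBCF_mul h0 hωπ s t) (hA.stieltjesRes_mul s t)) ρ

theorem IsSectorial.integrable_resPair_pow (hA : IsSectorial A) (h0 : 0 ≤ ω)
    (hωπ : ω < Real.pi) (ρ : Measure ℝ≥0) [IsFiniteMeasure ρ] (m : ℕ) :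
    Integrable (fun s => resPair A h0 hωπ s ^ m) ρ := by
  obtain ⟨C, hC⟩ := hA.exists_resPair_bound h0 hωπ
  have hC0 : 0 ≤ C := (norm_nonneg _).trans (hC 0)
  refine Integrable.of_bound ((hA.aestronglyMeasurable_resPair h0 hωπ ρ).pow m)
    (‖(1 : (↥(insert (0 : ℂ) (sector ω)) →ᵇ ℂ) × (X →L[ℂ] X))‖ * C ^ m)
    (Eventually.of_forall fun s => ?_)
  induction m with
  | zero => simp
  | succ m ih =>
    rw [pow_succ, pow_succ, ← mul_assoc]
    exact (norm_mul_le _ _).trans (mul_le_mul ih (hC s) (norm_nonneg _) (by positivity))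

end ResolventFamilies

/-! ### The Stieltjes calculus -/

section Stieltjes

open BoundedContinuousFunction

variable {X : Type*} [NormedAddCommGroup X] [NormedSpace ℂ X]
  {A : X →ₗ.[ℂ] X} {ω : ℝ}

/-- Evaluation of the function component at a point of the sector or at `0`. -/
noncomputable def evalFst (X : Type*) [NormedAddCommGroup X] [NormedSpace ℂ X] (ω : ℝ)
    (z : ↥(insert (0 : ℂ) (sector ω))) :
    ((↥(insert (0 : ℂ) (sector ω)) →ᵇ ℂ) × (X →L[ℂ] X)) →L[ℂ] ℂ :=
  (BoundedContinuousFunction.evalCLM ℂ z).comp (ContinuousLinearMap.fst ℂ _ _)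

theorem evalFst_apply (z : ↥(insert (0 : ℂ) (sector ω)))
    (y : (↥(insert (0 : ℂ) (sector ω)) →ᵇ ℂ) × (X →L[ℂ] X)) : evalFst X ω z y = y.1 z := rfl

theorem IsSectorial.integrable_stieltjesRes_pow (hA : IsSectorial A) (h0 : 0 ≤ ω)
    (hωπ : ω < Real.pi) (m : ℕ) (μ : ComplexMeasure ℝ≥0) :
    Integrable (fun s => stieltjesRes A s ^ m) μ.variation := by
  have := isFiniteMeasure_variation μ
  exact (hA.integrable_resPair_pow h0 hωπ μ.variation m).snd

theorem germ_mem_mer_of_mem_uniGraph {F : SGerm ω} {T : X →L[ℂ] X} (h : (F, T) ∈ uniGraph A ω) :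
    F ∈ mer ω := by
  obtain ⟨f, hf, hF, -⟩ := h
  exact (show F = germ ω f from hF) ▸ germ_mem_mer hf.1.1

theorem mer_of_le {ω' : ℝ} (h : ω ≤ ω') {f : ℂ → ℂ} (hf : germ ω' f ∈ mer ω') :
    germ ω f ∈ mer ω := by
  obtain ⟨g, hg, he⟩ := hf
  exact ⟨g, fun z hz => hg z (sector_mono h hz), germ_eq_of_le h he⟩

theorem one_mem_dom_stieltjesGraph (A : X →ₗ.[ℂ] X) : 1 ∈ dom (stieltjesGraph A) := by
  refine ⟨_, 0, VectorMeasure.dirac 0 1, ?_, rfl⟩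
  refine germ_congr (f := fun _ => 1) fun z _ => ?_
  simp only [stieltjesFun, pow_zero, inv_one, cintegral]
  rw [VectorMeasure.integral_dirac]
  simp

variable [CompleteSpace X]

theorem IsSectorial.stieltjes_mem_uniMul (hA : IsSectorial A) (hω : sectAngle A < ω)
    (hωπ : ω < Real.pi) (m : ℕ) (μ : ComplexMeasure ℝ≥0) :
    (germ ω (stieltjesFun m μ), stieltjesOp A m μ) ∈ uniMul A ω := by
  have := isFiniteMeasure_variation μ
  have h0 := (sectAngle_nonneg A).trans hω.le
  have hi := hA.integrable_resPair_pow h0 hωπ μ.variation m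
  have h1 : cintegral μ (fun s => resPair A h0 hωπ s ^ m) ∈ resAlg A h0 hωπ :=
    cintegral_mem (V := Subalgebra.toSubmodule (resAlg A h0 hωπ)) (isClosed_resAlg h0 hωπ) hi
      fun s => pow_mem (resPair_mem_resAlg h0 hωπ s) m
  have h2 : (cintegral μ (fun s => resPair A h0 hωπ s ^ m)).2 = stieltjesOp A m μ :=
    (cintegral_comp_comm (ContinuousLinearMap.snd ℂ (↥(insert (0 : ℂ) (sector ω)) →ᵇ ℂ)
      (X →L[ℂ] X)) hi).symm
  rw [← h2]
  refine hA.mem_uniMul hω h0 hωπ h1 fun z => ?_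
  rw [← evalFst_apply, ← cintegral_comp_comm _ hi, stieltjesFun]
  congr 1
  funext s
  rw [evalFst_apply, ← inv_pow]
  rfl

/-- A multiplier belongs to the algebraic extension of the uniform extension, with the expected
value. -/
theorem IsSectorial.uniCalc_of_mem_uniMul (hA : IsSectorial A) (hω : sectAngle A < ω)
    (hωπ : ω < Real.pi) {F : SGerm ω} {T : X →L[ℂ] X} (h : (F, T) ∈ uniMul A ω) :
    F ∈ uniDom A ω ∧ uniCalc A ω F = {p | p.2 = T p.1} := by
  have h1 : ((1 : SGerm ω), (1 : X →L[ℂ] X)) ∈ uniMul A ω := fun F S hF => by simpa using hF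
  have h2 := hA.uniCalc_eq hω hωπ (germ_mem_mer_of_mem_uniGraph (hA.uniMul_subset hω hωπ h))
    (M := {(1, 1, T)}) ⟨_, rfl⟩ (by rintro m rfl; exact h1) (by rintro m rfl; simpa using h)
    (fun x hx => by simpa using hx _ rfl)
  refine ⟨h2.1, h2.2.trans (Set.ext fun p => ?_)⟩
  simp [eq_comm]

/-- The extended Stieltjes calculus is contained in the algebraic extension of the uniform
extension: the regularisers in the Stieltjes algebra are multipliers of the uniform extension. -/
theorem IsSectorial.uniCalc_of_mem_extStieltjesDom (hA : IsSectorial A) (hω : sectAngle A < ω)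
    (hωπ : ω < Real.pi) {f : ℂ → ℂ} (hf : germ Real.pi f ∈ extStieltjesDom A) :
    germ ω f ∈ uniDom A ω ∧ uniCalc A ω (germ ω f) = extStieltjesCalc A (germ Real.pi f) := by
  have hres : ∀ g T, (germ Real.pi g, T) ∈ stieltjesGraph A → (germ ω g, T) ∈ uniMul A ω := by
    rintro g T ⟨m, μ, h1, h2⟩
    simp only at h1 h2
    rw [germ_eq_of_le hωπ.le h1, h2]
    exact hA.stieltjes_mem_uniMul hω hωπ m μ
  set M : Set (SGerm ω × (X →L[ℂ] X) × (X →L[ℂ] X)) := {m | ∃ g, m.1 = germ ω g ∧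
    (germ Real.pi g, m.2.1) ∈ stieltjesGraph A ∧
    (germ Real.pi g * germ Real.pi f, m.2.2) ∈ stieltjesGraph A} with hM
  have hmk : ∀ e T S, (e, T) ∈ stieltjesGraph A → (e * germ Real.pi f, S) ∈ stieltjesGraph A →
      ∃ F, (F, T, S) ∈ M := by
    intro e T S he hS
    obtain ⟨m, μ, h1, -⟩ := id he
    exact ⟨_, stieltjesFun m μ, rfl, by rwa [← show e = _ from h1], by rwa [← show e = _ from h1]⟩
  obtain ⟨hne, hanch⟩ := hf.2 1 (one_mem_dom_stieltjesGraph A)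
  rw [one_mul] at hne hanch
  have h := hA.uniCalc_eq hω hωπ (mer_of_le hωπ.le hf.1) (M := M) ?_ ?_ ?_ ?_
  · refine ⟨h.1, h.2.trans (Set.ext fun p => ⟨fun hp e T S he hS => ?_, ?_⟩)⟩
    · obtain ⟨F, hF⟩ := hmk e T S he hS
      exact hp _ hF
    · rintro hp m ⟨g, -, h1, h2⟩
      exact hp _ _ _ h1 h2
  · obtain ⟨e, ⟨T, he⟩, S, hS⟩ := hne
    obtain ⟨F, hF⟩ := hmk e T S he hS
    exact ⟨_, hF⟩
  · rintro m ⟨g, h1, h2, -⟩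
    rw [h1]
    exact hres g _ h2
  · rintro m ⟨g, h1, -, h2⟩
    rw [h1]
    exact hres (fun z => g z * f z) _ h2
  · intro x hx
    refine hanch x fun e ⟨_, S, hS⟩ T he => ?_
    obtain ⟨F, hF⟩ := hmk e T S he hS
    exact hx _ hF

end Stieltjes

/-! ### The Hirsch calculus -/

section Hirsch

open BoundedContinuousFunction

variable {X : Type*} [NormedAddCommGroup X] [NormedSpace ℂ X]
  {A : X →ₗ.[ℂ] X} {ω : ℝ} {ρ : Measure ℝ≥0} {h : ℝ≥0 → ℂ}

theorem IsSectorial.integrableOn_near (hA : IsSectorial A) (h0 : 0 ≤ ω) (hωπ : ω < Real.pi)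
    (hh : Measurable h) (hh1 : ∀ t, ‖h t‖ = 1)
    (hρ : Integrable (fun t : ℝ≥0 => 1 / (1 + (t : ℝ))) ρ) :
    IntegrableOn (fun t => h t • resPair A h0 hωπ t) (Icc 0 1) ρ := by
  obtain ⟨C, hC⟩ := hA.exists_resPair_bound h0 hωπ
  have hC0 : 0 ≤ C := (norm_nonneg _).trans (hC 0)
  refine Integrable.mono' (hρ.integrableOn.const_mul (C * 2))
    (hh.aestronglyMeasurable.smul (hA.aestronglyMeasurable_resPair h0 hωπ _))
    ((ae_restrict_iff' measurableSet_Icc).2 (Eventually.of_forall fun t ht => ?_))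
  have ht1 : (t : ℝ) ≤ 1 := ht.2
  rw [norm_smul, hh1, one_mul, mul_assoc]
  refine (hC t).trans (le_mul_of_one_le_right hC0 ?_)
  rw [mul_one_div, le_div_iff₀ (by positivity)]
  linarith

theorem IsSectorial.integrableOn_far (hA : IsSectorial A) (h0 : 0 ≤ ω) (hωπ : ω < Real.pi)
    (hh : Measurable h) (hh1 : ∀ t, ‖h t‖ = 1)
    (hρ : Integrable (fun t : ℝ≥0 => 1 / (1 + (t : ℝ))) ρ) :
    IntegrableOn (fun t => h t • ((((t : ℝ) : ℂ)⁻¹) • (1 - resPair A h0 hωπ t))) (Ioi 1) ρ := by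
  obtain ⟨C, hC⟩ := hA.exists_resPair_bound h0 hωπ
  have hC0 : 0 ≤ C := (norm_nonneg _).trans (hC 0)
  set K := ‖(1 : (↥(insert (0 : ℂ) (sector ω)) →ᵇ ℂ) × (X →L[ℂ] X))‖ + C with hK
  have hK0 : 0 ≤ K := by positivity
  have hm : Measurable fun t : ℝ≥0 => (((t : ℝ) : ℂ)⁻¹) := by fun_prop
  refine Integrable.mono' (hρ.integrableOn.const_mul (K * 2))
    (hh.aestronglyMeasurable.smul (hm.aestronglyMeasurable.smul (aestronglyMeasurable_const.sub
      (hA.aestronglyMeasurable_resPair h0 hωπ _))))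
    ((ae_restrict_iff' measurableSet_Ioi).2 (Eventually.of_forall fun t ht => ?_))
  have ht1 : 1 < (t : ℝ) := ht
  rw [norm_smul, norm_smul, hh1, one_mul, norm_inv, Complex.norm_real, Real.norm_eq_abs,
    abs_of_nonneg t.coe_nonneg, mul_comm, mul_assoc]
  refine mul_le_mul ((norm_sub_le _ _).trans (add_le_add_right (hC t) _)) ?_ (by positivity) hK0
  rw [mul_one_div, inv_eq_one_div, div_le_div_iff₀ (by positivity) (by positivity)]
  linarith

variable [CompleteSpace X]

/-- The pair of the function `z ↦ (1 + z)⁻¹ f(z)`, where `f` is the function of the Hirsch calculus,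
and the corresponding operator. It results from `(1 + z)⁻¹ z = 1 - (1 + z)⁻¹` in the
integral over `[0, 1]` and from `z (1 + t z)⁻¹ = t⁻¹ (1 - (1 + t z)⁻¹)` in the integral over
`(1, ∞)`. -/
theorem IsSectorial.hirsch_mem_uniMul (hA : IsSectorial A) (hω : sectAngle A < ω)
    (hωπ : ω < Real.pi) (hh : Measurable h) (hh1 : ∀ t, ‖h t‖ = 1)
    (hρ : Integrable (fun t : ℝ≥0 => 1 / (1 + (t : ℝ))) ρ) (a : ℂ) :
    (germ ω (resFun (1 : ℝ≥0)) * germ ω (hirschFun a ρ h), a • stieltjesRes A 1 +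
      (1 - stieltjesRes A 1) * hirschNear A ρ h + stieltjesRes A 1 * hirschFar A ρ h) ∈
      uniMul A ω := by
  have h0 := (sectAngle_nonneg A).trans hω.le
  have hn := hA.integrableOn_near h0 hωπ hh hh1 hρ
  have hf := hA.integrableOn_far h0 hωπ hh hh1 hρ
  set N := ∫ t in Icc 0 1, h t • resPair A h0 hωπ t ∂ρ with hN
  set F := ∫ t in Ioi 1, h t • ((((t : ℝ) : ℂ)⁻¹) • (1 - resPair A h0 hωπ t)) ∂ρ with hF
  have hr := fun t => resPair_mem_resAlg (A := A) h0 hωπ t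
  have hNm : N ∈ resAlg A h0 hωπ := integral_mem_of_isClosed
    (V := Subalgebra.toSubmodule (resAlg A h0 hωπ)) (isClosed_resAlg h0 hωπ) hn
    fun t => Subalgebra.smul_mem _ (hr t) _
  have hFm : F ∈ resAlg A h0 hωπ := integral_mem_of_isClosed
    (V := Subalgebra.toSubmodule (resAlg A h0 hωπ)) (isClosed_resAlg h0 hωπ) hf
    fun t => Subalgebra.smul_mem _ (Subalgebra.smul_mem _ (sub_mem (one_mem _) (hr t)) _) _
  have hN2 : N.2 = hirschNear A ρ h := ((ContinuousLinearMap.snd ℂ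
    (↥(insert (0 : ℂ) (sector ω)) →ᵇ ℂ) (X →L[ℂ] X)).integral_comp_comm hn).symm
  have hF2 : F.2 = hirschFar A ρ h := ((ContinuousLinearMap.snd ℂ
    (↥(insert (0 : ℂ) (sector ω)) →ᵇ ℂ) (X →L[ℂ] X)).integral_comp_comm hf).symm
  have hy : a • resPair A h0 hωπ 1 + (1 - resPair A h0 hωπ 1) * N + resPair A h0 hωπ 1 * F ∈
      resAlg A h0 hωπ :=
    add_mem (add_mem (Subalgebra.smul_mem _ (hr 1) _) (mul_mem (sub_mem (one_mem _) (hr 1)) hNm))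
      (mul_mem (hr 1) hFm)
  rw [← hN2, ← hF2]
  refine hA.mem_uniMul hω h0 hωπ hy (g := fun z => resFun (1 : ℝ≥0) z * hirschFun a ρ h z)
    fun z => ?_
  have hne := one_add_mul_ne_zero h0 hωπ z.2 zero_le_one
  rw [Complex.ofReal_one, one_mul] at hne
  have hnt := fun t : ℝ≥0 => one_add_mul_ne_zero h0 hωπ z.2 t.coe_nonneg
  have hNz : N.1 z = ∫ t in Icc 0 1, h t * resFun t z ∂ρ :=
    ((evalFst X ω z).integral_comp_comm hn).symm
  have hFz : F.1 z = ∫ t in Ioi 1, h t * (((t : ℝ) : ℂ)⁻¹ * (1 - resFun t z)) ∂ρ :=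
    ((evalFst X ω z).integral_comp_comm hf).symm
  have hin : IntegrableOn (fun t => h t * resFun t z) (Icc 0 1) ρ :=
    (evalFst X ω z).integrable_comp hn
  have hif : IntegrableOn (fun t => h t * (((t : ℝ) : ℂ)⁻¹ * (1 - resFun t z))) (Ioi 1) ρ :=
    (evalFst X ω z).integrable_comp hf
  set u : ℝ≥0 → ℂ := fun t => h t * (z / (1 + z * ((t : ℝ) : ℂ))) with hu
  have hu1 : EqOn u (fun t => z * (h t * resFun t z)) (Icc 0 1) := fun t _ => by
    simp only [hu, resFun, div_eq_mul_inv, mul_comm (z : ℂ) ((t : ℝ) : ℂ)]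
    ring
  have hu2 : EqOn u (fun t => h t * (((t : ℝ) : ℂ)⁻¹ * (1 - resFun t z))) (Ioi 1) := fun t ht => by
    have ht0 : ((t : ℝ) : ℂ) ≠ 0 :=
      Complex.ofReal_ne_zero.2 (zero_lt_one.trans (show (1 : ℝ) < t from ht)).ne'
    have h3 := inv_mul_cancel₀ (hnt t)
    simp only [hu, resFun, div_eq_mul_inv, mul_comm (z : ℂ) ((t : ℝ) : ℂ)]
    generalize (1 + ((t : ℝ) : ℂ) * (z : ℂ))⁻¹ = r at h3 ⊢
    field_simp
    linear_combination h t * h3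
  have hun : Icc (0 : ℝ≥0) 1 ∪ Ioi 1 = univ := by
    ext t
    simp
  have hdis : Disjoint (Icc (0 : ℝ≥0) 1) (Ioi 1) :=
    disjoint_left.2 fun t h1 h2 => not_lt.2 h1.2 h2
  have hint : ∫ t, u t ∂ρ = z * N.1 z + F.1 z := by
    rw [← setIntegral_univ, ← hun, setIntegral_union hdis measurableSet_Ioi
      (IntegrableOn.congr_fun (hin.const_mul _) hu1.symm measurableSet_Icc)
      (hif.congr_fun hu2.symm measurableSet_Ioi), setIntegral_congr_fun measurableSet_Icc hu1,
      setIntegral_congr_fun measurableSet_Ioi hu2, integral_const_mul, hNz, hFz]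
  have hz1 : (a • resPair A h0 hωπ 1 + (1 - resPair A h0 hωπ 1) * N + resPair A h0 hωπ 1 * F).1 z =
      a * resFun (1 : ℝ≥0) z + (1 - resFun (1 : ℝ≥0) z) * N.1 z + resFun (1 : ℝ≥0) z * F.1 z := rfl
  rw [hz1, hirschFun, show ∫ t, h t * (z / (1 + z * ((t : ℝ) : ℂ))) ∂ρ = _ from hint]
  simp only [resFun, NNReal.coe_one, Complex.ofReal_one, one_mul]
  field_simp
  ring

theorem IsSectorial.hirschFun_mem_mer (hA : IsSectorial A) (hω : sectAngle A < ω)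
    (hωπ : ω < Real.pi) (hh : Measurable h) (hh1 : ∀ t, ‖h t‖ = 1)
    (hρ : Integrable (fun t : ℝ≥0 => 1 / (1 + (t : ℝ))) ρ) (a : ℂ) :
    germ ω (hirschFun a ρ h) ∈ mer ω := by
  have h0 := (sectAngle_nonneg A).trans hω.le
  obtain ⟨g, hg, he, -⟩ := hA.uniMul_subset hω hωπ (hA.hirsch_mem_uniMul hω hωπ hh hh1 hρ a)
  have h1 : germ ω (hirschFun a ρ h) = germ ω (fun z => (1 + z) * g z) := by
    have h2 : germ ω (fun z => 1 + z) * germ ω (resFun (1 : ℝ≥0)) = 1 :=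
      germ_congr (f := fun z => (1 + z) * resFun (1 : ℝ≥0) z) (g := fun _ => 1) fun z hz => by
        have hne := one_add_mul_ne_zero h0 hωπ (mem_insert_of_mem 0 hz) zero_le_one
        simp only [resFun, NNReal.coe_one, Complex.ofReal_one, one_mul] at hne ⊢
        exact mul_inv_cancel₀ hne
    rw [← one_mul (germ ω (hirschFun a ρ h)), ← h2, mul_assoc]
    exact congrArg (germ ω (fun z => 1 + z) * ·) he
  rw [h1]
  exact germ_mem_mer (((differentiableOn_const 1).add differentiableOn_id).mul hg.1.1)

/-- The Hirsch calculus is contained in the algebraic extension of the uniform extension, by the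
regulariser `(1 + z)⁻¹`. -/
theorem IsSectorial.uniCalc_hirschFun (hA : IsSectorial A) (hω : sectAngle A < ω)
    (hωπ : ω < Real.pi) (hh : Measurable h) (hh1 : ∀ t, ‖h t‖ = 1)
    (hρ : Integrable (fun t : ℝ≥0 => 1 / (1 + (t : ℝ))) ρ) (a : ℂ) :
    germ ω (hirschFun a ρ h) ∈ uniDom A ω ∧
      uniCalc A ω (germ ω (hirschFun a ρ h)) = hirschCalc A a ρ h := by
  have h0 := (sectAngle_nonneg A).trans hω.le
  have h1 : (germ ω (resFun (1 : ℝ≥0)), stieltjesRes A 1) ∈ uniMul A ω :=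
    hA.mem_uniMul hω h0 hωπ (resPair_mem_resAlg h0 hωπ 1) fun z => rfl
  have hH := hA.uniCalc_eq hω hωπ (hA.hirschFun_mem_mer hω hωπ hh hh1 hρ a)
    (M := {(germ ω (resFun (1 : ℝ≥0)), stieltjesRes A 1, a • stieltjesRes A 1 +
      (1 - stieltjesRes A 1) * hirschNear A ρ h + stieltjesRes A 1 * hirschFar A ρ h)}) ⟨_, rfl⟩
    (by rintro m rfl; exact h1)
    (by rintro m rfl; exact hA.hirsch_mem_uniMul hω hωπ hh hh1 hρ a)
    (fun x hx => hA.stieltjesRes_injective (hx _ rfl))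
  refine ⟨hH.1, hH.2.trans (Set.ext fun p => ?_)⟩
  have hinv := hA.isInverse_stieltjesRes one_ne_zero
  simp only [NNReal.coe_one, Complex.ofReal_one] at hinv
  simp only [mem_singleton_iff, forall_eq, mem_ofPred_eq, hirschCalc, _root_.add_apply,
    _root_.smul_apply, mul_apply_eq_comp, _root_.sub_apply, one_apply_eq_self]
  set S := stieltjesRes A 1
  set N := hirschNear A ρ h p.1
  set F := hirschFar A ρ h p.1
  constructor
  · intro hp
    have hN : N = S (p.2 - a • p.1 + N - F) := by
      rw [map_sub, map_add, map_sub, map_smul, ← hp]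
      abel
    obtain ⟨hd, he⟩ := hinv.1 (p.2 - a • p.1 + N - F)
    have h2 : (⟨S (p.2 - a • p.1 + N - F), hd⟩ : A.domain) = ⟨N, hN ▸ hd⟩ := Subtype.ext hN.symm
    have hdN : N ∈ A.domain := hN ▸ hd
    refine ⟨hdN, ?_⟩
    rw [h2, one_smul, one_smul] at he
    have h3 : N + A ⟨N, hdN⟩ = p.2 - a • p.1 + N - F :=
      (congrArg (· + A ⟨N, hdN⟩) hN).trans he
    clear_value N F
    calc p.2 = (p.2 - a • p.1 + N - F) - N + a • p.1 + F := by abel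
      _ = _ := by
        rw [← h3]
        abel
  · rintro ⟨hd, he⟩
    have h2 := hinv.2 ⟨N, hd⟩
    simp only [one_smul, map_add] at h2
    rw [he, map_add, map_add, map_smul, eq_sub_of_add_eq' h2]

end Hirsch

end SectCalc

theorem proposition11p1 {X : Type*} [NormedAddCommGroup X] [NormedSpace ℂ X] [CompleteSpace X]
    (A : X →ₗ.[ℂ] X) (hA : SectCalc.IsSectorial A)
    (ω : ℝ) (hω : SectCalc.sectAngle A < ω) (hωπ : ω < Real.pi) :
    -- bounded Stieltjes functions belong to the uniform extension, with the expected value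
    (∀ (m : ℕ) (μ : ComplexMeasure ℝ≥0),
      Integrable (fun s => SectCalc.stieltjesRes A s ^ m) μ.variation ∧
      (∀ T : X →L[ℂ] X,
        (SectCalc.germ ω (SectCalc.stieltjesFun m μ), T) ∈ SectCalc.uniGraph A ω ↔
          T = SectCalc.stieltjesOp A m μ) ∧
      SectCalc.germ ω (SectCalc.stieltjesFun m μ) ∈ SectCalc.uniDom A ω ∧
      SectCalc.uniCalc A ω (SectCalc.germ ω (SectCalc.stieltjesFun m μ)) =
        {p | p.2 = SectCalc.stieltjesOp A m μ p.1}) ∧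
    -- the extended Stieltjes calculus is contained in the uniform extension
    (∀ f : ℂ → ℂ, SectCalc.germ Real.pi f ∈ SectCalc.extStieltjesDom A →
      SectCalc.germ ω f ∈ SectCalc.uniDom A ω ∧
      SectCalc.uniCalc A ω (SectCalc.germ ω f) =
        SectCalc.extStieltjesCalc A (SectCalc.germ Real.pi f)) ∧
    -- the Hirsch calculus is contained in the uniform extension
    (∀ (a : ℂ) (ρ : Measure ℝ≥0) (h : ℝ≥0 → ℂ), Measurable h → (∀ t, ‖h t‖ = 1) →
      Integrable (fun t : ℝ≥0 => 1 / (1 + (t : ℝ))) ρ →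
      IntegrableOn (fun t => h t • SectCalc.stieltjesRes A t) (Icc 0 1) ρ ∧
      IntegrableOn (fun t => h t • ((((t : ℝ) : ℂ)⁻¹) • (1 - SectCalc.stieltjesRes A t)))
        (Ioi 1) ρ ∧
      SectCalc.germ ω (SectCalc.hirschFun a ρ h) ∈ SectCalc.uniDom A ω ∧
      SectCalc.uniCalc A ω (SectCalc.germ ω (SectCalc.hirschFun a ρ h)) =
        SectCalc.hirschCalc A a ρ h) := by
  have h0 := (SectCalc.sectAngle_nonneg A).trans hω.le
  refine ⟨fun m μ => ?_, fun f hf => hA.uniCalc_of_mem_extStieltjesDom hω hωπ hf,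
    fun a ρ h hh hh1 hρ => ?_⟩
  · have h1 := hA.stieltjes_mem_uniMul hω hωπ m μ
    have h2 := hA.uniMul_subset hω hωπ h1
    exact ⟨hA.integrable_stieltjesRes_pow h0 hωπ m μ,
      fun T => ⟨fun hT => hA.uniGraph_unique hω hωπ hT h2, fun hT => hT ▸ h2⟩,
      hA.uniCalc_of_mem_uniMul hω hωπ h1⟩
  · exact ⟨(hA.integrableOn_near h0 hωπ hh hh1 hρ).snd, (hA.integrableOn_far h0 hωπ hh hh1 hρ).snd,
      hA.uniCalc_hirschFun hω hωπ hh hh1 hρ a⟩
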